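/- **Setting.** Let $X\subset\mathbb R^m$, $Y\subset\mathbb R^n$ be compact and convex, and let $0<\mu_p\le\mu_d\le L$. Consider $\min_{x\in X}\{f(x):=\max_{y\in Y}F(x,y)\}$, where $F$ is $\mu_p$-strongly convex in $x$ and $\mu_d$-strongly concave in $y$ on $X\times Y$, i.e. $F(x_1,y)-F(x_2,y)-\langle\nabla_xF(x_2,y),x_1-x_2\rangle\ge\frac{\mu_p}{2}\|x_1-x_2\|^2$ and $F(x,y_1)-F(x,y_2)-\langle\nabla_yF(x,y_2),y_1-y_2\rangle\le-\frac{\mu_d}{2}\|y_1-y_2\|^2$. Let $Q\supseteq X$ be a closed convex set of points at which gradients may be queried (e.g. $Q=X$ or $Q=\mathbb R^m$); $F$ is differentiable with $L$-Lipschitz gradient on $Q\times Y$ (Euclidean norms). A stochastic first-order oracle (SFO) returns, for $(x,y)\in Q\times Y$ and a random sample $\xi$, a measurable unbiased estimate $\nabla F(x,y;\xi)$ of $\nabla F(x,y)$ with $\mathbb E\|\nabla F(x,y;\xi)-\nabla F(x,y)\|^2\le\sigma^2$, $\sigma>0$; different calls use i.i.d. samples. Let $D_Y>0$ satisfy $\|y-y'\|\le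 D_Y$ for all $y,y'\in Y$. Write $x^*$ for the minimizer of $f$ on $X$ and $y^*(x)=\arg\max_{y\in Y}F(x,y)$. Fix $(x_{(0)},y_{(0)})\in X\times Y$, set $\Delta_0=f(x_{(0)})-f(x^*)+\frac{\mu_d}{12}\|y^*(x_{(0)})-y_{(0)}\|^2$, and let $0<\epsilon<\Delta_0$. **SREG.** For a function $\psi$ with stochastic gradient $\nabla\psi(\cdot;\xi)$, moduli $\mu_X,\mu_Y$, step size $\eta$, initial point $z_0$ and $T$ steps, put $G(z,\xi)=(\nabla_x\psi(z;\xi),-\nabla_y\psi(z;\xi))$ and, for $t=0,\dots,T-1$, with fresh samples $\xi_t,\hat\xi_t$ (two SFO calls), $$\hat z_t=\arg\min_{z\in X\times Y}\ \eta\langle G(z_t,\xi_t),z\rangle+\tfrac12\|z-z_t\|^2,$$ $$z_{t+1}=\arg\min_{z=(x,y)\in X\times Y}\ \eta\big[\langle G(\hat z_t,\hat\xi_t),z\rangle+\tfrac{\mu_X}{2}\|x-\hat x_t\|^2+\tfrac{\mu_Y}{2}\|y-\hat y_t\|^2\big]+\tfrac12\|z-z_t\|^2.$$ It returns $(\bar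 z_T,z_T)$ with $\bar z_T=\sum_{t<T}\eta\Lambda_t\hat z_t/\sum_{t<T}\eta\Lambda_t$, $\Lambda_t=(1+\mu_X\eta)^t$. **R-Catalyst-Minimax(SREG).** Let $K=\lceil24\sqrt{\mu_d/\mu_p}\,\rceil$ and $E=\lceil\log_2(\Delta_0/\epsilon)\rceil$. Epoch $e=1,\dots,E$ starts from $\bar x_0=\tilde x_0=x_{(e-1)}$, $y_0=y_{(e-1)}$, performs iterations $k=1,\dots,K$, and outputs $x_{(e)}=\tilde x_K$, $y_{(e)}=y_K$. Iteration $k$ sets $\hat x_k=\gamma_k\bar x_{k-1}+(1-\gamma_k)\tilde x_{k-1}$, lets $(\tilde z_k,z_k)$, with $\tilde z_k=(\tilde x_k,\tilde y_k)$ and $z_k=(x_k,y_k)$, be the output of SREG applied to $\Phi_k(x,y)=F(x,y)+\frac{\beta_k}{2}\|x-\hat x_k\|^2$ with stochastic gradient $\nabla F(x,y;\xi)+(\beta_k(x-\hat x_k),0)$, moduli $\mu_X=\beta_k$, $\mu_Y=\mu_d$, $T_e$ steps of size $\eta$, and initial point $(\hat x_k,y_{k-1})$ (with $\hat x_k$ replaced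 by its nearest point of $Q$ in the initial point if $\hat x_k\notin Q$), and then sets $$\bar x_k=\frac{\alpha_{k,e}x_k+(\mu_p-\alpha_{k,e})(1-\gamma_k)\tilde x_{k-1}}{\alpha_{k,e}\gamma_k+\mu_p(1-\gamma_k)}.$$ The parameters are $\gamma_k=\frac2{k+1}$, $\beta_k=\frac{\mu_d(k+1)}{4(k+2)}$, $\alpha_{k,e}=\frac{\beta_k\Lambda_{T_e}}{\Lambda_{T_e}-1}$, $\Lambda_{T_e}=\big(1+\min\{\frac{\mu_d}{96L},\frac{q\log T_e}{T_e}\}\big)^{T_e}$, $\eta=\min\{\frac{k+2}{24(k+1)L},\frac{q\log T_e}{\beta_kT_e}\}$, $q=\max\big\{\frac{2[\log(\mu_d^2D_Y^2/(16\sigma^2))+\log T_e]}{\log T_e},\frac1{\log T_e}\big\}$, and $$T_e=\Big\lceil\frac{288L(\log96+\log(48K^2))}{\mu_d}+\frac{128K2^e}{\Delta_0}\Big[\frac{192\sigma^2\max\{\log(\mu_d^2D_Y^2/\sigma^2)+2,\,0\}}{\mu_d}+\frac{384\sigma^2\max\{\log\frac{49152K\sigma^2}{\mu_d\Delta_0}+e\log2,\,1\}}{\mu_d}\Big]\Big\rceil.$$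 **Theorem.** After $E$ epochs, $$\mathbb E\Big[f(x_{(E)})-f(x^*)+\frac{\mu_d}{6}\big\|y^*(x_{(E)})-y_{(E)}\big\|^2\Big]\le\epsilon ,$$ and the total number of SFO calls is at most $$C\Big(\frac{L}{\sqrt{\mu_d\mu_p}}\Big(1+\log\frac{\mu_d}{\mu_p}\Big)\Big(1+\log_2\frac{\Delta_0}{\epsilon}\Big)+\frac{\sigma^2}{\mu_p\epsilon}\Big[\log^+\frac{\mu_d^2D_Y^2}{\sigma^2}+2+\log^+\frac{\sigma^2}{\Delta_0\mu_p}\Big]+\frac{\sigma^2}{\mu_p\epsilon}\log_2\frac{\Delta_0}{\epsilon}\Big),$$ where $C$ is a universal constant and $\log^+t=\max\{\log t,0\}$. -/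

import Mathlib

open MeasureTheory ProbabilityTheory

namespace CatalystMinimax

noncomputable section

/-! ### The minimax problem -/

section Problem

variable {V : Type*}

/-- A minimizer of `φ` over `S` (an arbitrary point if there is none). -/
def argminOn [Nonempty V] (S : Set V) (φ : V → ℝ) : V :=
  Classical.epsilon fun v => v ∈ S ∧ IsMinOn φ S v

variable {E G : Type*}

/-- The primal objective `f x = max_{y ∈ Y} F x y`. -/
def primal (F : E → G → ℝ) (Y : Set G) (x : E) : ℝ :=
  sSup (F x '' Y)

/-- The optimal value `f x* = min_{x ∈ X} f x`. -/
def primalOpt (F : E → G → ℝ) (X : Set E) (Y : Set G) : ℝ :=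
  sInf (primal F Y '' X)

/-- The best response `y*(x) = argmax_{y ∈ Y} F x y`. -/
def bestResponse [Nonempty G] (F : E → G → ℝ) (Y : Set G) (x : E) : G :=
  argminOn Y fun y => -F x y

/-- The potential `f x - f x* + c ‖y*(x) - y‖²`. -/
def potential [NormedAddCommGroup G] (F : E → G → ℝ) (X : Set E) (Y : Set G) (c : ℝ)
    (x : E) (y : G) : ℝ :=
  primal F Y x - primalOpt F X Y + c * ‖bestResponse F Y x - y‖ ^ 2

variable [NormedAddCommGroup E] [InnerProductSpace ℝ E] [CompleteSpace E]
  [NormedAddCommGroup G] [InnerProductSpace ℝ G] [CompleteSpace G]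

/-- `min_{x ∈ X} max_{y ∈ Y} F x y` with `X`, `Y` compact and convex, `F` being `μp`-strongly convex
in `x`, `μd`-strongly concave in `y`, with `L`-Lipschitz gradient `(gx, gy)`. The set `Q ⊇ X` is the
set of primal points at which the gradient may be queried (`Q = X` and `Q = univ` are the two
extreme cases); convexity and concavity are only required on `X × Y`. -/
structure IsMinimaxProblem (F : E → G → ℝ) (gx : E → G → E) (gy : E → G → G)
    (X Q : Set E) (Y : Set G) (L μp μd : ℝ) : Prop where
  compact_X : IsCompact X
  convex_X : Convex ℝ X
  compact_Y : IsCompact Y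
  convex_Y : Convex ℝ Y
  closed_Q : IsClosed Q
  convex_Q : Convex ℝ Q
  X_subset_Q : X ⊆ Q
  grad_x : ∀ x ∈ Q, ∀ y ∈ Y, HasGradientWithinAt (fun x' => F x' y) (gx x y) Q x
  grad_y : ∀ x ∈ Q, ∀ y ∈ Y, HasGradientWithinAt (fun y' => F x y') (gy x y) Y y
  strongConvex : ∀ x₁ ∈ X, ∀ x₂ ∈ X, ∀ y ∈ Y,
    F x₁ y - F x₂ y - inner ℝ (gx x₂ y) (x₁ - x₂) ≥ μp / 2 * ‖x₁ - x₂‖ ^ 2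
  strongConcave : ∀ x ∈ X, ∀ y₁ ∈ Y, ∀ y₂ ∈ Y,
    F x y₁ - F x y₂ - inner ℝ (gy x y₂) (y₁ - y₂) ≤ -(μd / 2) * ‖y₁ - y₂‖ ^ 2
  lipschitz : ∀ x ∈ Q, ∀ y ∈ Y, ∀ x' ∈ Q, ∀ y' ∈ Y,
    √(‖gx x y - gx x' y'‖ ^ 2 + ‖gy x y - gy x' y'‖ ^ 2)
      ≤ L * √(‖x - x'‖ ^ 2 + ‖y - y'‖ ^ 2)

variable [MeasurableSpace E] [MeasurableSpace G] {Ξ : Type*} [MeasurableSpace Ξ]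

/-- Stochastic first-order oracle: `g x y ξ = (∇ₓF(x,y;ξ), ∇ᵧF(x,y;ξ))` is, for `ξ` drawn from `ν`,
an unbiased estimate of `(gx x y, gy x y)` with variance at most `σ²`. -/
structure IsSFO (g : E → G → Ξ → E × G) (gx : E → G → E) (gy : E → G → G)
    (Q : Set E) (Y : Set G) (ν : Measure Ξ) (σ : ℝ) : Prop where
  measurable : Measurable fun p : E × G × Ξ => g p.1 p.2.1 p.2.2
  integrable_x : ∀ x ∈ Q, ∀ y ∈ Y, Integrable (fun ξ => (g x y ξ).1) ν
  integrable_y : ∀ x ∈ Q, ∀ y ∈ Y, Integrable (fun ξ => (g x y ξ).2) ν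
  unbiased_x : ∀ x ∈ Q, ∀ y ∈ Y, ∫ ξ, (g x y ξ).1 ∂ν = gx x y
  unbiased_y : ∀ x ∈ Q, ∀ y ∈ Y, ∫ ξ, (g x y ξ).2 ∂ν = gy x y
  variance : ∀ x ∈ Q, ∀ y ∈ Y,
    ∫⁻ ξ, ENNReal.ofReal (‖(g x y ξ).1 - gx x y‖ ^ 2 + ‖(g x y ξ).2 - gy x y‖ ^ 2) ∂ν
      ≤ ENNReal.ofReal (σ ^ 2)

end Problem

/-! ### The stochastic regularized extragradient method (SREG) -/

section SREG

variable {E G Ξ : Type*} [NormedAddCommGroup E] [InnerProductSpace ℝ E]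
  [NormedAddCommGroup G] [InnerProductSpace ℝ G]

/-- `½ ‖z - w‖²` on the product space with its Euclidean norm. -/
def halfSq (z w : E × G) : ℝ :=
  1 / 2 * (‖z.1 - w.1‖ ^ 2 + ‖z.2 - w.2‖ ^ 2)

/-- `⟨(a, -b), z⟩` where `v = (a, b)` is a (stochastic) gradient: the pairing of `z` with the
saddle operator `G = (∇ₓψ, -∇ᵧψ)`. -/
def saddlePairing (v z : E × G) : ℝ :=
  inner ℝ v.1 z.1 - inner ℝ v.2 z.2

/-- The first extragradient update, with stochastic gradient `v` at `z`:
`ẑ = argmin_{w ∈ X × Y} η ⟨G, w⟩ + ½ ‖w - z‖²`. -/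
def sregMidStep (X : Set E) (Y : Set G) (η : ℝ) (v z : E × G) : E × G :=
  argminOn (X ×ˢ Y) fun w => η * saddlePairing v w + halfSq w z

/-- The second extragradient update, with stochastic gradient `v` at `zh`:
`z⁺ = argmin_{w ∈ X × Y} η [⟨G, w⟩ + μX/2 ‖x - x̂‖² + μY/2 ‖y - ŷ‖²] + ½ ‖w - z‖²`. -/
def sregNextStep (X : Set E) (Y : Set G) (μX μY η : ℝ) (v zh z : E × G) : E × G :=
  argminOn (X ×ˢ Y) fun w =>
    η * (saddlePairing v w + μX / 2 * ‖w.1 - zh.1‖ ^ 2 + μY / 2 * ‖w.2 - zh.2‖ ^ 2)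
      + halfSq w z

/-- The iterates `z_t` of SREG. `h x y ξ` is the stochastic gradient of the objective, `s` is the
stream of samples; step `t` calls the oracle twice, with the samples `s (2t)` and `s (2t+1)`. -/
def sregIter (X : Set E) (Y : Set G) (h : E → G → Ξ → E × G) (μX μY : ℝ) (η : ℕ → ℝ)
    (s : ℕ → Ξ) (z₀ : E × G) : ℕ → E × G
  | 0 => z₀
  | t + 1 =>
    let z := sregIter X Y h μX μY η s z₀ t
    let zh := sregMidStep X Y (η t) (h z.1 z.2 (s (2 * t))) z
    sregNextStep X Y μX μY (η t) (h zh.1 zh.2 (s (2 * t + 1))) zh z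

/-- The intermediate points `ẑ_t` of SREG. -/
def sregMid (X : Set E) (Y : Set G) (h : E → G → Ξ → E × G) (μX μY : ℝ) (η : ℕ → ℝ)
    (s : ℕ → Ξ) (z₀ : E × G) (t : ℕ) : E × G :=
  let z := sregIter X Y h μX μY η s z₀ t
  sregMidStep X Y (η t) (h z.1 z.2 (s (2 * t))) z

/-- The weights `Λ_0 = 1`, `Λ_{t+1} = (1 + μX η_t) Λ_t`. -/
def sregWeight (μX : ℝ) (η : ℕ → ℝ) : ℕ → ℝ
  | 0 => 1
  | t + 1 => (1 + μX * η t) * sregWeight μX η t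

/-- The ergodic average `(∑_{t<T} η_t Λ_t ẑ_t) / (∑_{t<T} η_t Λ_t)` returned by SREG. -/
def sregAverage (X : Set E) (Y : Set G) (h : E → G → Ξ → E × G) (μX μY : ℝ) (η : ℕ → ℝ)
    (s : ℕ → Ξ) (z₀ : E × G) (T : ℕ) : E × G :=
  (∑ t ∈ Finset.range T, η t * sregWeight μX η t)⁻¹ •
    ∑ t ∈ Finset.range T, (η t * sregWeight μX η t) • sregMid X Y h μX μY η s z₀ t

end SREG

/-! ### The catalyst scheme and its restarted version -/

section Catalyst

/-- The constants of the problem and of the run: Lipschitz and strong convexity/concavity moduli,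
noise level, (a bound on) the diameter of `Y`, and the initial potential. -/
structure Params where
  L : ℝ
  μp : ℝ
  μd : ℝ
  σ : ℝ
  DY : ℝ
  Δ₀ : ℝ

/-- The epoch length `K = ⌈24 √(μd / μp)⌉`. -/
def Params.K (p : Params) : ℕ := ⌈24 * √(p.μd / p.μp)⌉₊

/-- The number of SREG steps per iteration in epoch `e`. -/
def Params.T (p : Params) (e : ℕ) : ℕ :=
  ⌈288 * p.L * (Real.log 96 + Real.log (48 * (p.K : ℝ) ^ 2)) / p.μd
    + 128 * (p.K : ℝ) * 2 ^ e / p.Δ₀ *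
      (192 * p.σ ^ 2 * max (Real.log (p.μd ^ 2 * p.DY ^ 2 / p.σ ^ 2) + 2) 0 / p.μd
        + 384 * p.σ ^ 2 *
          max (Real.log (49152 * (p.K : ℝ) * p.σ ^ 2 / (p.μd * p.Δ₀)) + e * Real.log 2) 1
            / p.μd)⌉₊

/-- `γ_k = 2 / (k + 1)`. -/
def gam (k : ℕ) : ℝ := 2 / ((k : ℝ) + 1)

/-- `β_k = μd (k + 1) / (4 (k + 2))`. -/
def Params.β (p : Params) (k : ℕ) : ℝ := p.μd * ((k : ℝ) + 1) / (4 * ((k : ℝ) + 2))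

/-- `q = max {2 [log (μd² DY² / (16 σ²)) + log T] / log T, 1 / log T}` with `T = T_e`. -/
def Params.q (p : Params) (e : ℕ) : ℝ :=
  max (2 * (Real.log (p.μd ^ 2 * p.DY ^ 2 / (16 * p.σ ^ 2)) + Real.log (p.T e))
        / Real.log (p.T e))
    (1 / Real.log (p.T e))

/-- The constant step size `η = min {(k + 2) / (24 (k + 1) L), q log T_e / (β_k T_e)}`. -/
def Params.η (p : Params) (e k : ℕ) : ℝ :=
  min (((k : ℝ) + 2) / (24 * ((k : ℝ) + 1) * p.L))
    (p.q e * Real.log (p.T e) / (p.β k * (p.T e : ℝ)))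

/-- `Λ_{T_e} = (1 + min {μd / (96 L), q log T_e / T_e}) ^ T_e`. -/
def Params.Λ (p : Params) (e : ℕ) : ℝ :=
  (1 + min (p.μd / (96 * p.L)) (p.q e * Real.log (p.T e) / (p.T e : ℝ))) ^ p.T e

/-- `α_{k,e} = β_k Λ_{T_e} / (Λ_{T_e} - Λ_0)`, with `Λ_0 = 1`. -/
def Params.α (p : Params) (e k : ℕ) : ℝ := p.β k * p.Λ e / (p.Λ e - 1)

variable {E G Ξ : Type*}

/-- What Catalyst-Minimax keeps after an iteration: `x̄_k`, `x̃_k`, `y_k`, and the number of oracle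
calls made so far. -/
structure State (E G : Type*) where
  xbar : E
  xtil : E
  y : G
  calls : ℕ

variable [NormedAddCommGroup E] [InnerProductSpace ℝ E]
  [NormedAddCommGroup G] [InnerProductSpace ℝ G]

/-- The stochastic gradient of `Φ(x, y) = F(x, y) + β/2 ‖x - x̂‖²` obtained from an oracle `g`
for `F`, with one call to `g`. -/
def proxOracle (g : E → G → Ξ → E × G) (β : ℝ) (xhat : E) : E → G → Ξ → E × G :=
  fun x y ξ => ((g x y ξ).1 + β • (x - xhat), (g x y ξ).2)

/-- The nearest point of `Q`; it is `x` itself when `x ∈ Q`. -/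
def nearest (Q : Set E) (x : E) : E := argminOn Q fun x' => ‖x' - x‖ ^ 2

/-- Iteration `k` of Catalyst-Minimax(SREG) within epoch `e`. The subproblem is `β_k`-strongly
convex in `x` and `μd`-strongly concave in `y`. Each of the `T_e` steps of SREG makes two calls to
the oracle; the `i`-th call of the whole run uses the sample `s i`. -/
def catalystStep (p : Params) (X Q : Set E) (Y : Set G) (g : E → G → Ξ → E × G) (s : ℕ → Ξ)
    (e k : ℕ) (st : State E G) : State E G :=
  let xhat := gam k • st.xbar + (1 - gam k) • st.xtil
  let h := proxOracle g (p.β k) xhat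
  let η : ℕ → ℝ := fun _ => p.η e k
  let s' : ℕ → Ξ := fun i => s (st.calls + i)
  let z₀ : E × G := (nearest Q xhat, st.y)
  let ztil := sregAverage X Y h (p.β k) p.μd η s' z₀ (p.T e)
  let z := sregIter X Y h (p.β k) p.μd η s' z₀ (p.T e)
  { xbar := (p.α e k * gam k + p.μp * (1 - gam k))⁻¹ •
      (p.α e k • z.1 + ((p.μp - p.α e k) * (1 - gam k)) • st.xtil)
    xtil := ztil.1
    y := z.2
    calls := st.calls + 2 * p.T e }

/-- The state of Catalyst-Minimax(SREG) in epoch `e` after `k` iterations, from the initial point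
`x̄_0 = x̃_0 = x`, `y_0 = y`, with `c` oracle calls made before. -/
def catalystIter (p : Params) (X Q : Set E) (Y : Set G) (g : E → G → Ξ → E × G) (s : ℕ → Ξ)
    (e : ℕ) (x : E) (y : G) (c : ℕ) : ℕ → State E G
  | 0 => ⟨x, x, y, c⟩
  | k + 1 => catalystStep p X Q Y g s e (k + 1) (catalystIter p X Q Y g s e x y c k)

/-- R-Catalyst-Minimax(SREG): the state after `e` epochs, each of `K` iterations, epoch `e + 1`
being started from the pair `(x̃, y)` output by epoch `e`. -/
def rCatalyst (p : Params) (X Q : Set E) (Y : Set G) (g : E → G → Ξ → E × G) (s : ℕ → Ξ)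
    (x₀ : E) (y₀ : G) : ℕ → State E G
  | 0 => ⟨x₀, x₀, y₀, 0⟩
  | e + 1 =>
    let st := rCatalyst p X Q Y g s x₀ y₀ e
    catalystIter p X Q Y g s (e + 1) st.xtil st.y st.calls p.K

end Catalyst

end

end CatalystMinimax

set_option linter.unusedSectionVars false

/-! The proof separates a pathwise part from a probabilistic part. For every realization of the
samples, SREG, one outer iteration and one epoch satisfy deterministic inequalities in which the
oracle errors appear as explicit remainders. Expectations are taken only at the end, using that an
error has mean zero against quantities fixed by the earlier samples and second moment at most σ².

Inner loop (`sreg_gap_le`). Each extragradient step gives a three-point inequality, and strong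
convexity at the midpoint cancels the regularizers centred there, leaving a contraction by 1 + μX η.
The comparator y will be the best response to the output, which depends on all samples, so its
pairing with the errors does not have mean zero. The auxiliary sequence `ghostIter` repairs this:
the errors are paired with midpoint minus ghost, a quantity fixed by the past, and the rest is the
regret of the ghost. The ghost is pulled towards the iterates so that it contracts at the same rate;
the surplus μY ≥ 2 μX pays for the pull.

Outer loop (`catalystStep_le`, `potential_step`, `epoch_le`). The comparators are γ x* + (1-γ) x̃ in
x and y*(x̃_k) in y, as in accelerated proximal point methods. After multiplication by (k+1)(k+2)
the inequalities telescope. Growth of f around x* and K² ≥ 576 μd/μp turn the initial distance into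
a small multiple of the initial gap, so an epoch multiplies the potential by 1/50 and adds noise.
The remaining dependence on the starting y of the inner solver is handled by `initial_term_le`:
either Λ is of order K² and the term is absorbed by the slack of the telescoping, or Λ is so large
compared with D_Y² that the term is of the size of the noise.

Parameters (`Params.Valid.calibrated`, `Params.Valid.calls_le`). The formula for T_e makes the noise
of epoch e at most Δ₀/2^(e+1), so the expected potential is at least halved every epoch
(`integral_rCatalyst_le`). The cost is a geometric sum dominated by the last epoch, where 2^E is at
most 2Δ₀/ε, plus a curvature term paid once per epoch. -/

namespace CatalystMinimax

/-! ### Projections onto closed convex sets -/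

section Projection

/-- `argminOn` is an arbitrary choice; strict minimality pins it down. This turns the updates into
explicit projections, which makes them continuous and hence measurable. -/
theorem argminOn_eq {V : Type*} [Nonempty V] {S : Set V} {φ : V → ℝ} {v : V} (hv : v ∈ S)
    (h : ∀ w ∈ S, w ≠ v → φ v < φ w) : argminOn S φ = v := by
  have hex : ∃ w, w ∈ S ∧ IsMinOn φ S w :=
    ⟨v, hv, fun w hw => by
      by_cases hwv : w = v
      · simp [hwv]
      · exact (h w hw hwv).le⟩
  obtain ⟨hS, hmin⟩ := Classical.epsilon_spec hex
  by_contra hne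
  exact absurd (hmin hv) (not_le.2 (h _ hS hne))

variable {H : Type*} [NormedAddCommGroup H] [InnerProductSpace ℝ H]

theorem norm_sq_sub_of_inner (u v w : H) :
    ‖w - u‖ ^ 2 = ‖v - u‖ ^ 2 + ‖w - v‖ ^ 2 - 2 * inner ℝ (u - v) (w - v) := by
  have : w - u = (w - v) - (u - v) := by abel
  rw [this, norm_sub_sq_real, ← norm_neg (v - u), neg_sub, real_inner_comm]
  ring

theorem nearest_eq {S : Set H} {u v : H} (hv : v ∈ S)
    (h : ∀ w ∈ S, inner ℝ (u - v) (w - v) ≤ 0) : nearest S u = v := by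
  refine argminOn_eq hv fun w hw hwv => ?_
  have h1 := norm_sq_sub_of_inner u v w
  have h2 : 0 < ‖w - v‖ := norm_pos_iff.2 (sub_ne_zero.2 hwv)
  nlinarith [h w hw]

variable [CompleteSpace H] {S : Set H}

theorem nearest_spec (hc : IsClosed S) (hS : Convex ℝ S) (hne : S.Nonempty) (u : H) :
    nearest S u ∈ S ∧ ∀ w ∈ S, inner ℝ (u - nearest S u) (w - nearest S u) ≤ 0 := by
  obtain ⟨v, hv, hvu⟩ := exists_norm_eq_iInf_of_complete_convex hne hc.isComplete hS u
  have h := (norm_eq_iInf_iff_real_inner_le_zero hS hv).1 hvu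
  rw [nearest_eq hv h]
  exact ⟨hv, h⟩

theorem norm_nearest_sub_nearest_le (hc : IsClosed S) (hS : Convex ℝ S) (hne : S.Nonempty)
    (u w : H) : ‖nearest S u - nearest S w‖ ≤ ‖u - w‖ := by
  obtain ⟨hu, hu'⟩ := nearest_spec hc hS hne u
  obtain ⟨hw, hw'⟩ := nearest_spec hc hS hne w
  set a := nearest S u
  set b := nearest S w
  have h1 := hu' b hw
  have h2 := hw' a hu
  have h3 : inner ℝ (u - w) (a - b) = ‖a - b‖ ^ 2 - inner ℝ (u - a) (b - a)
      - inner ℝ (w - b) (a - b) := by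
    rw [← real_inner_self_eq_norm_sq]
    simp only [inner_sub_left, inner_sub_right]
    ring
  have h4 := real_inner_le_norm (u - w) (a - b)
  by_contra hlt
  push Not at hlt
  nlinarith [norm_nonneg (u - w), norm_nonneg (a - b)]

theorem continuous_nearest (hc : IsClosed S) (hS : Convex ℝ S) (hne : S.Nonempty) :
    Continuous (nearest S) :=
  (LipschitzWith.of_dist_le_mul (K := 1) fun u w => by
    simpa [dist_eq_norm] using norm_nearest_sub_nearest_le hc hS hne u w).continuous

/-- Moving an extrapolated prox-center that has left `Q` back to `Q` does not increase its distance
to any comparator in X ⊆ Q. -/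
theorem norm_sub_nearest_le (hc : IsClosed S) (hS : Convex ℝ S) {x : H} (hx : x ∈ S) (u : H) :
    ‖x - nearest S u‖ ^ 2 ≤ ‖x - u‖ ^ 2 := by
  have h := (nearest_spec hc hS ⟨x, hx⟩ u).2 x hx
  nlinarith [norm_sq_sub_of_inner u (nearest S u) x, sq_nonneg ‖nearest S u - u‖]

end Projection

/-! ### The extragradient updates as projections, and their three-point inequality -/

section Steps

variable {E G : Type*} [NormedAddCommGroup E] [InnerProductSpace ℝ E] [CompleteSpace E]
  [NormedAddCommGroup G] [InnerProductSpace ℝ G] [CompleteSpace G] {X : Set E} {Y : Set G}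

/-- Completing the square around `p`. If `p` is the projection of the unconstrained minimizer, the
inner product is nonpositive on the constraint set, so `p` is the strict minimizer there. -/
theorem prox_objective_eq {H : Type*} [NormedAddCommGroup H] [InnerProductSpace ℝ H] {c : ℝ}
    (hc : 0 ≤ c) (a b d w p : H) :
    1 / 2 * ‖w - a‖ ^ 2 + c / 2 * ‖w - b‖ ^ 2 + inner ℝ d w =
      1 / 2 * ‖p - a‖ ^ 2 + c / 2 * ‖p - b‖ ^ 2 + inner ℝ d p + (1 + c) / 2 * ‖w - p‖ ^ 2
      - (1 + c) * inner ℝ ((1 + c)⁻¹ • (a + c • b - d) - p) (w - p) := by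
  have hc' : (1 + c) ≠ 0 := by positivity
  rw [inner_sub_left, real_inner_smul_left]
  field_simp
  simp only [← real_inner_self_eq_norm_sq, inner_sub_left, inner_sub_right, inner_add_left,
    real_inner_smul_left, real_inner_comm a w, real_inner_comm b w, real_inner_comm p w,
    real_inner_comm p a, real_inner_comm p b]
  ring

theorem sregNextStep_eq (hXc : IsClosed X) (hX : Convex ℝ X) (hXne : X.Nonempty)
    (hYc : IsClosed Y) (hY : Convex ℝ Y) (hYne : Y.Nonempty) {μX μY η : ℝ}
    (hμX : 0 ≤ μX) (hμY : 0 ≤ μY) (hη : 0 ≤ η) (v zh z : E × G) :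
    sregNextStep X Y μX μY η v zh z =
      (nearest X ((1 + η * μX)⁻¹ • (z.1 + (η * μX) • zh.1 - η • v.1)),
        nearest Y ((1 + η * μY)⁻¹ • (z.2 + (η * μY) • zh.2 + η • v.2))) := by
  set px := nearest X ((1 + η * μX)⁻¹ • (z.1 + (η * μX) • zh.1 - η • v.1)) with hpx
  set py := nearest Y ((1 + η * μY)⁻¹ • (z.2 + (η * μY) • zh.2 + η • v.2)) with hpy
  obtain ⟨hx, hx'⟩ := nearest_spec hXc hX hXne
    ((1 + η * μX)⁻¹ • (z.1 + (η * μX) • zh.1 - η • v.1))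
  obtain ⟨hy, hy'⟩ := nearest_spec hYc hY hYne
    ((1 + η * μY)⁻¹ • (z.2 + (η * μY) • zh.2 + η • v.2))
  rw [← hpx] at hx hx'
  rw [← hpy] at hy hy'
  refine argminOn_eq ⟨hx, hy⟩ fun w hw hne => ?_
  have h1 := prox_objective_eq (c := η * μX) (by positivity) z.1 zh.1 (η • v.1) w.1 px
  have h2 := prox_objective_eq (c := η * μY) (by positivity) z.2 zh.2 (-(η • v.2)) w.2 py
  rw [sub_neg_eq_add] at h2
  have hx1 := hx' w.1 hw.1
  have hy1 := hy' w.2 hw.2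
  simp only [inner_neg_left, real_inner_smul_left] at h1 h2 hx1 hy1
  have hcx : 0 < 1 + η * μX := by positivity
  have hcy : 0 < 1 + η * μY := by positivity
  have hpos : 0 < (1 + η * μX) / 2 * ‖w.1 - px‖ ^ 2 + (1 + η * μY) / 2 * ‖w.2 - py‖ ^ 2 := by
    by_cases hw1 : w.1 = px
    · have hw2 : w.2 ≠ py := fun h => hne (Prod.ext hw1 h)
      have : 0 < ‖w.2 - py‖ := norm_pos_iff.2 (sub_ne_zero.2 hw2)
      positivity
    · have : 0 < ‖w.1 - px‖ := norm_pos_iff.2 (sub_ne_zero.2 hw1)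
      positivity
  have hx2 := mul_nonneg hcx.le (neg_nonneg.2 hx1)
  have hy2 := mul_nonneg hcy.le (neg_nonneg.2 hy1)
  simp only [saddlePairing, halfSq]
  linarith

theorem sregMidStep_eq (hXc : IsClosed X) (hX : Convex ℝ X) (hXne : X.Nonempty)
    (hYc : IsClosed Y) (hY : Convex ℝ Y) (hYne : Y.Nonempty) {η : ℝ} (hη : 0 ≤ η)
    (v z : E × G) :
    sregMidStep X Y η v z = (nearest X (z.1 - η • v.1), nearest Y (z.2 + η • v.2)) := by
  -- The first update is the second one with both moduli equal to zero.
  have h := sregNextStep_eq hXc hX hXne hYc hY hYne le_rfl le_rfl hη v z z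
  simpa [sregNextStep, sregMidStep] using h

/-- One component of an extragradient step, from the variational inequalities of its two
projections. -/
theorem extragradient_component {H : Type*} [NormedAddCommGroup H] [InnerProductSpace ℝ H]
    [CompleteSpace H] {S : Set H} (hc : IsClosed S) (hS : Convex ℝ S) {μ η : ℝ} (hμ : 0 ≤ μ)
    (hη : 0 ≤ η) (v v' z : H) {zh z' u : H} (hzh : zh = nearest S (z - η • v))
    (hz' : z' = nearest S ((1 + η * μ)⁻¹ • (z + (η * μ) • zh - η • v'))) (hu : u ∈ S) :
    η * inner ℝ v' (zh - u) + (1 + η * μ) / 2 * ‖u - z'‖ ^ 2 + 1 / 2 * ‖zh - z‖ ^ 2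
      ≤ 1 / 2 * ‖u - z‖ ^ 2 + η * μ / 2 * ‖u - zh‖ ^ 2 + η ^ 2 / 2 * ‖v' - v‖ ^ 2 := by
  obtain ⟨-, h1⟩ := nearest_spec hc hS ⟨u, hu⟩ (z - η • v)
  obtain ⟨hmem, h2⟩ := nearest_spec hc hS ⟨u, hu⟩
    ((1 + η * μ)⁻¹ • (z + (η * μ) • zh - η • v'))
  rw [← hzh] at h1
  rw [← hz'] at hmem h2
  have h1 := h1 z' hmem
  have h2 := h2 u hu
  have hcx : 0 < 1 + η * μ := by positivity
  have h3 : inner ℝ (z + (η * μ) • zh - η • v' - (1 + η * μ) • z') (u - z') ≤ 0 := by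
    have : z + (η * μ) • zh - η • v' - (1 + η * μ) • z' =
        (1 + η * μ) • ((1 + η * μ)⁻¹ • (z + (η * μ) • zh - η • v') - z') := by
      rw [smul_sub, smul_inv_smul₀ hcx.ne']
    rw [this, real_inner_smul_left]
    exact mul_nonpos_of_nonneg_of_nonpos hcx.le h2
  -- Young's inequality for the cross term η⟨v' - v, zh - z'⟩ left after testing the first
  -- projection at z' and the second at u.
  have h4 : 0 ≤ ‖(z' - zh) + η • (v' - v)‖ ^ 2 := sq_nonneg _
  have h5 : 0 ≤ η * μ * ‖z' - zh‖ ^ 2 := by positivity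
  simp only [← real_inner_self_eq_norm_sq, inner_sub_left, inner_sub_right, inner_add_left,
    inner_add_right, real_inner_smul_left, real_inner_smul_right, real_inner_comm z u,
    real_inner_comm zh u, real_inner_comm z' u, real_inner_comm zh z, real_inner_comm z' z,
    real_inner_comm z' zh, real_inner_comm v' v, real_inner_comm v' zh,
    real_inner_comm v' z', real_inner_comm v zh,
    real_inner_comm v z'] at *
  nlinarith

end Steps

/-! ### First-order optimality -/

section FirstOrder

variable {H : Type*} [NormedAddCommGroup H] [InnerProductSpace ℝ H] [CompleteSpace H]

theorem inner_gradient_nonneg_of_isMinOn {φ : H → ℝ} {g a x : H} {S Q : Set H} (hS : Convex ℝ S)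
    (hSQ : S ⊆ Q) (hg : HasGradientWithinAt φ g Q a) (ha : a ∈ S) (hmin : IsMinOn φ S a)
    (hx : x ∈ S) : 0 ≤ inner ℝ g (x - a) := by
  have h := hg.hasFDerivWithinAt.mono hSQ
  have := hmin.localize.hasFDerivWithinAt_nonneg h
    (sub_mem_posTangentConeAt_of_segment_subset (hS.segment_subset ha hx))
  simpa using this

end FirstOrder

/-! ### The primal function, best responses and the saddle point -/

namespace IsMinimaxProblem

variable {E G : Type*} [NormedAddCommGroup E] [InnerProductSpace ℝ E] [CompleteSpace E]
  [NormedAddCommGroup G] [InnerProductSpace ℝ G] [CompleteSpace G]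
  {F : E → G → ℝ} {gx : E → G → E} {gy : E → G → G} {X Q : Set E} {Y : Set G} {L μp μd : ℝ}

/-- Only the gradient values on Q × Y matter; this later permits replacing the given gradient by one
that is measurable on the whole space. -/
theorem congr (hP : IsMinimaxProblem F gx gy X Q Y L μp μd) {gx' : E → G → E} {gy' : E → G → G}
    (hx : ∀ x ∈ Q, ∀ y ∈ Y, gx' x y = gx x y) (hy : ∀ x ∈ Q, ∀ y ∈ Y, gy' x y = gy x y) :
    IsMinimaxProblem F gx' gy' X Q Y L μp μd where
  compact_X := hP.compact_X
  convex_X := hP.convex_X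
  compact_Y := hP.compact_Y
  convex_Y := hP.convex_Y
  closed_Q := hP.closed_Q
  convex_Q := hP.convex_Q
  X_subset_Q := hP.X_subset_Q
  grad_x x h y h' := by rw [hx x h y h']; exact hP.grad_x x h y h'
  grad_y x h y h' := by rw [hy x h y h']; exact hP.grad_y x h y h'
  strongConvex x₁ h₁ x₂ h₂ y h := by
    rw [hx x₂ (hP.X_subset_Q h₂) y h]; exact hP.strongConvex x₁ h₁ x₂ h₂ y h
  strongConcave x h y₁ h₁ y₂ h₂ := by
    rw [hy x (hP.X_subset_Q h) y₂ h₂]; exact hP.strongConcave x h y₁ h₁ y₂ h₂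
  lipschitz x h y h' x₁ h₁ y₁ h₁' := by
    rw [hx x h y h', hy x h y h', hx x₁ h₁ y₁ h₁', hy x₁ h₁ y₁ h₁']
    exact hP.lipschitz x h y h' x₁ h₁ y₁ h₁'

variable (hP : IsMinimaxProblem F gx gy X Q Y L μp μd)
include hP

theorem lipschitz_sq {x x' : E} {y y' : G} (hL : 0 ≤ L) (hx : x ∈ Q) (hy : y ∈ Y) (hx' : x' ∈ Q)
    (hy' : y' ∈ Y) :
    ‖gx x y - gx x' y'‖ ^ 2 + ‖gy x y - gy x' y'‖ ^ 2
      ≤ L ^ 2 * (‖x - x'‖ ^ 2 + ‖y - y'‖ ^ 2) := by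
  have h := hP.lipschitz x hx y hy x' hx' y' hy'
  rw [Real.sqrt_le_left (by positivity), mul_pow, Real.sq_sqrt (by positivity)] at h
  exact h

theorem continuousOn_y {x : E} (hx : x ∈ X) : ContinuousOn (F x) Y := fun y hy =>
  (hP.grad_y x (hP.X_subset_Q hx) y hy).continuousWithinAt

theorem bddAbove_image {x : E} (hx : x ∈ X) : BddAbove (F x '' Y) :=
  (hP.compact_Y.image_of_continuousOn (hP.continuousOn_y hx)).bddAbove

theorem le_primal {x : E} {y : G} (hx : x ∈ X) (hy : y ∈ Y) : F x y ≤ primal F Y x :=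
  le_csSup (hP.bddAbove_image hx) ⟨y, hy, rfl⟩

theorem bestResponse_spec (hY : Y.Nonempty) {x : E} (hx : x ∈ X) :
    bestResponse F Y x ∈ Y ∧ IsMinOn (fun y => -F x y) Y (bestResponse F Y x) :=
  Classical.epsilon_spec (hP.compact_Y.exists_isMinOn hY (hP.continuousOn_y hx).neg)

theorem bestResponse_mem (hY : Y.Nonempty) {x : E} (hx : x ∈ X) : bestResponse F Y x ∈ Y :=
  (hP.bestResponse_spec hY hx).1

theorem primal_eq (hY : Y.Nonempty) {x : E} (hx : x ∈ X) :
    primal F Y x = F x (bestResponse F Y x) := by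
  obtain ⟨h, h'⟩ := hP.bestResponse_spec hY hx
  refine le_antisymm (csSup_le (hY.image _) ?_) (hP.le_primal hx h)
  rintro _ ⟨y, hy, rfl⟩
  exact neg_le_neg_iff.1 (h' hy)

theorem inner_grad_y_nonpos (hY : Y.Nonempty) {x : E} {y : G} (hx : x ∈ X) (hy : y ∈ Y) :
    inner ℝ (gy x (bestResponse F Y x)) (y - bestResponse F Y x) ≤ 0 := by
  obtain ⟨h, h'⟩ := hP.bestResponse_spec hY hx
  have hg := (hP.grad_y x (hP.X_subset_Q hx) _ h).hasFDerivWithinAt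
  have hmax : IsMaxOn (fun y => F x y) Y (bestResponse F Y x) := fun z hz =>
    show F x z ≤ F x _ from neg_le_neg_iff.1 (h' hz)
  have := hmax.localize.hasFDerivWithinAt_nonpos hg
    (sub_mem_posTangentConeAt_of_segment_subset (hP.convex_Y.segment_subset h hy))
  simpa using this

theorem quadratic_growth_y (hY : Y.Nonempty) {x : E} {y : G} (hx : x ∈ X) (hy : y ∈ Y) :
    F x y + μd / 2 * ‖bestResponse F Y x - y‖ ^ 2 ≤ primal F Y x := by
  have h := hP.strongConcave x hx y hy _ (hP.bestResponse_mem hY hx)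
  have h2 := hP.inner_grad_y_nonpos hY hx hy
  rw [hP.primal_eq hY hx, norm_sub_rev]
  linarith

/-- Strong concavity at y*(x') and quadratic growth at y*(x), both for F(x, ·), add up to the full
modulus μd; optimality of y*(x') for F(x', ·) then leaves only a difference of gradients at the same
y. -/
theorem bestResponse_lipschitz (hY : Y.Nonempty) (hL : 0 ≤ L) (hμd : 0 < μd) {x x' : E}
    (hx : x ∈ X) (hx' : x' ∈ X) :
    ‖bestResponse F Y x - bestResponse F Y x'‖ ≤ L / μd * ‖x - x'‖ := by
  set y := bestResponse F Y x with hy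
  set y' := bestResponse F Y x' with hy'
  have hyY : y ∈ Y := hP.bestResponse_mem hY hx
  have hyY' : y' ∈ Y := hP.bestResponse_mem hY hx'
  have h1 := hP.strongConcave x hx y hyY y' hyY'
  have h2 := hP.quadratic_growth_y hY hx hyY'
  rw [hP.primal_eq hY hx] at h2
  have h3 := hP.inner_grad_y_nonpos hY hx' hyY
  rw [← hy] at h2
  rw [← hy'] at h3
  have h4 : inner ℝ (gy x y' - gy x' y') (y - y') ≤ L * ‖x - x'‖ * ‖y - y'‖ := by
    refine (real_inner_le_norm _ _).trans ?_
    gcongr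
    have h := hP.lipschitz_sq hL (hP.X_subset_Q hx) hyY' (hP.X_subset_Q hx') hyY'
    simp only [sub_self, norm_zero] at h
    refine (sq_le_sq₀ (norm_nonneg _) (by positivity)).1 ?_
    nlinarith [sq_nonneg ‖gx x y' - gx x' y'‖]
  rw [inner_sub_left] at h4
  have h5 : μd * ‖y - y'‖ ^ 2 ≤ L * ‖x - x'‖ * ‖y - y'‖ := by linarith
  rw [div_mul_eq_mul_div, le_div_iff₀ hμd]
  rcases (norm_nonneg (y - y')).eq_or_lt with h0 | h0
  · rw [← h0]; simp; positivity
  · nlinarith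

theorem continuousOn_bestResponse (hY : Y.Nonempty) (hL : 0 ≤ L) (hμd : 0 < μd) :
    ContinuousOn (bestResponse F Y) X :=
  (LipschitzOnWith.of_dist_le_mul (K := (L / μd).toNNReal) fun x hx x' hx' => by
    rw [dist_eq_norm, dist_eq_norm, Real.coe_toNNReal _ (by positivity)]
    exact hP.bestResponse_lipschitz hY hL hμd hx hx').continuousOn

theorem exists_norm_grad_x_le (hX : X.Nonempty) (hY : Y.Nonempty) (hL : 0 ≤ L) :
    ∃ M, 0 ≤ M ∧ ∀ x ∈ X, ∀ y ∈ Y, ‖gx x y‖ ≤ M := by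
  obtain ⟨x₀, hx₀⟩ := hX
  obtain ⟨y₀, hy₀⟩ := hY
  obtain ⟨A, hA⟩ := hP.compact_X.isBounded.exists_norm_le
  obtain ⟨B, hB⟩ := hP.compact_Y.isBounded.exists_norm_le
  refine ⟨‖gx x₀ y₀‖ + L * √((2 * A) ^ 2 + (2 * B) ^ 2), by positivity, fun x hx y hy => ?_⟩
  have h := hP.lipschitz x (hP.X_subset_Q hx) y hy x₀ (hP.X_subset_Q hx₀) y₀ hy₀
  have h1 : ‖gx x y - gx x₀ y₀‖ ≤ √(‖gx x y - gx x₀ y₀‖ ^ 2 + ‖gy x y - gy x₀ y₀‖ ^ 2) :=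
    Real.le_sqrt_of_sq_le (by nlinarith [sq_nonneg ‖gy x y - gy x₀ y₀‖])
  have h2 : √(‖x - x₀‖ ^ 2 + ‖y - y₀‖ ^ 2) ≤ √((2 * A) ^ 2 + (2 * B) ^ 2) := by
    gcongr
    · linarith [norm_sub_le x x₀, hA x hx, hA x₀ hx₀]
    · linarith [norm_sub_le y y₀, hB y hy, hB y₀ hy₀]
  have h3 := norm_add_le (gx x y - gx x₀ y₀) (gx x₀ y₀)
  rw [sub_add_cancel] at h3
  have h4 := mul_le_mul_of_nonneg_left h2 hL
  linarith

/-- At y = y*(x) the difference f(x) - f(x') is at most F(x, y) - F(x', y), which convexity bounds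
by the gradient norm times the distance. -/
theorem continuousOn_primal (hX : X.Nonempty) (hY : Y.Nonempty) (hL : 0 ≤ L) (hμp : 0 ≤ μp) :
    ContinuousOn (primal F Y) X := by
  obtain ⟨M, hM, hgx⟩ := hP.exists_norm_grad_x_le hX hY hL
  have key : ∀ x ∈ X, ∀ x' ∈ X, primal F Y x - primal F Y x' ≤ M * ‖x - x'‖ := by
    intro x hx x' hx'
    have hy := hP.bestResponse_mem hY hx
    rw [hP.primal_eq hY hx]
    have h1 := hP.le_primal hx' hy
    have h2 := hP.strongConvex x' hx' x hx _ hy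
    have h3 := real_inner_le_norm (-gx x (bestResponse F Y x)) (x' - x)
    have h4 := mul_le_mul_of_nonneg_right (hgx x hx _ hy) (norm_nonneg (x' - x))
    rw [norm_neg, inner_neg_left] at h3
    rw [norm_sub_rev x x']
    nlinarith [mul_nonneg hμp (sq_nonneg ‖x' - x‖)]
  refine (LipschitzOnWith.of_dist_le_mul (K := M.toNNReal) fun x hx x' hx' => ?_).continuousOn
  rw [Real.dist_eq, dist_eq_norm, Real.coe_toNNReal _ hM, abs_le]
  have h := key x' hx' x hx
  rw [norm_sub_rev] at h
  exact ⟨by linarith, key x hx x' hx'⟩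

theorem exists_minimizer (hX : X.Nonempty) (hY : Y.Nonempty) (hL : 0 ≤ L) (hμp : 0 ≤ μp) :
    ∃ xs ∈ X, primal F Y xs = primalOpt F X Y ∧ ∀ x ∈ X, primalOpt F X Y ≤ primal F Y x := by
  obtain ⟨xs, hxs, hmin⟩ :=
    hP.compact_X.exists_isMinOn hX (hP.continuousOn_primal hX hY hL hμp)
  have hbdd : BddBelow (primal F Y '' X) :=
    ⟨primal F Y xs, by rintro _ ⟨x, hx, rfl⟩; exact hmin hx⟩
  refine ⟨xs, hxs, le_antisymm (le_csInf (hX.image _) ?_) (csInf_le hbdd ⟨xs, hxs, rfl⟩),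
    fun x hx => csInf_le hbdd ⟨x, hx, rfl⟩⟩
  rintro _ ⟨x, hx, rfl⟩
  exact hmin hx

theorem convex_comb_x {x x' : E} {y : G} (hx : x ∈ X) (hx' : x' ∈ X) (hy : y ∈ Y) {γ : ℝ}
    (h0 : 0 ≤ γ) (h1 : γ ≤ 1) :
    F (γ • x + (1 - γ) • x') y + μp / 2 * (γ * (1 - γ)) * ‖x - x'‖ ^ 2
      ≤ γ * F x y + (1 - γ) * F x' y := by
  set w := γ • x + (1 - γ) • x' with hw
  have hwX : w ∈ X := hP.convex_X hx hx' h0 (by linarith) (by ring)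
  have ha := hP.strongConvex x hx w hwX y hy
  have hb := hP.strongConvex x' hx' w hwX y hy
  have e1 : x - w = (1 - γ) • (x - x') := by rw [hw]; module
  have e2 : x' - w = (-γ) • (x - x') := by rw [hw]; module
  rw [e1, real_inner_smul_right, norm_smul, mul_pow, Real.norm_eq_abs, sq_abs] at ha
  rw [e2, real_inner_smul_right, norm_smul, mul_pow, Real.norm_eq_abs, sq_abs] at hb
  have ha' := mul_le_mul_of_nonneg_left ha.le h0
  have hb' := mul_le_mul_of_nonneg_left hb.le (sub_nonneg.2 h1)
  nlinarith

/-- Half of the saddle property of (x*, y*(x*)), without a minimax theorem. On the segment w_t = t x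
+ (1-t) x*, convexity at y_t = y*(w_t) gives f* ≤ f(w_t) ≤ t F(x, y_t) + (1-t) f*, so f* ≤ F(x,
y_t). Let t → 0 and use continuity of the best response. -/
theorem saddle_x (hX : X.Nonempty) (hY : Y.Nonempty) (hL : 0 ≤ L) (hμp : 0 ≤ μp) (hμd : 0 < μd)
    {xs : E} (hxs : xs ∈ X) (hopt : primal F Y xs = primalOpt F X Y) {x : E} (hx : x ∈ X) :
    primalOpt F X Y ≤ F x (bestResponse F Y xs) := by
  have hlow : ∀ x ∈ X, primalOpt F X Y ≤ primal F Y x := by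
    obtain ⟨-, -, -, h⟩ := hP.exists_minimizer hX hY hL hμp
    exact h
  set w : ℝ → E := fun t => t • x + (1 - t) • xs with hw
  have hwX : ∀ t ∈ Set.Ioo (0 : ℝ) 1, w t ∈ X := fun t ht =>
    hP.convex_X hx hxs ht.1.le (by linarith [ht.2]) (by ring)
  have hbr : ∀ t ∈ Set.Ioo (0 : ℝ) 1,
      primalOpt F X Y ≤ F x (bestResponse F Y (w t)) := by
    intro t ht
    have hy := hP.bestResponse_mem hY (hwX t ht)
    have h1 := hlow _ (hwX t ht)
    rw [hP.primal_eq hY (hwX t ht)] at h1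
    have h2 := hP.convex_comb_x hx hxs hy ht.1.le ht.2.le
    have h3 := hP.le_primal hxs hy
    rw [hopt] at h3
    have h4 : 0 ≤ μp / 2 * (t * (1 - t)) * ‖x - xs‖ ^ 2 := by
      have := ht.1.le
      have := sub_nonneg.2 ht.2.le
      positivity
    have h5 := mul_le_mul_of_nonneg_left h3 (sub_nonneg.2 ht.2.le)
    have h6 : t * primalOpt F X Y ≤ t * F x (bestResponse F Y (w t)) := by
      simp only [hw] at *
      linarith
    exact le_of_mul_le_mul_left h6 ht.1
  have hw0 : Filter.Tendsto w (nhdsWithin 0 (Set.Ioo 0 1)) (nhdsWithin xs X) := by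
    refine tendsto_nhdsWithin_iff.2 ⟨?_, eventually_nhdsWithin_of_forall hwX⟩
    have hc : Continuous w := by fun_prop
    have := hc.tendsto 0
    simp only [hw, zero_smul, sub_zero, one_smul, zero_add] at this
    exact this.mono_left nhdsWithin_le_nhds
  have hb0 : Filter.Tendsto (fun t => bestResponse F Y (w t)) (nhdsWithin 0 (Set.Ioo 0 1))
      (nhdsWithin (bestResponse F Y xs) Y) :=
    tendsto_nhdsWithin_iff.2 ⟨(hP.continuousOn_bestResponse hY hL hμd xs hxs).tendsto.comp hw0,
      eventually_nhdsWithin_of_forall fun t ht => hP.bestResponse_mem hY (hwX t ht)⟩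
  have hF := (hP.continuousOn_y hx _ (hP.bestResponse_mem hY hxs)).tendsto.comp hb0
  have : (nhdsWithin (0 : ℝ) (Set.Ioo 0 1)).NeBot := left_nhdsWithin_Ioo_neBot one_pos
  exact ge_of_tendsto hF (eventually_nhdsWithin_of_forall hbr)

/-- Quadratic growth of F(x, ·) is tested at y*(x*), where the saddle property bounds F from below
by f*. This makes the drift of best responses a consequence of small primal gaps, with no factor
L/μd. -/
theorem bestResponse_dist_le (hX : X.Nonempty) (hY : Y.Nonempty) (hL : 0 ≤ L) (hμp : 0 ≤ μp)
    (hμd : 0 < μd) {xs : E} (hxs : xs ∈ X) (hopt : primal F Y xs = primalOpt F X Y) {x : E}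
    (hx : x ∈ X) :
    μd / 2 * ‖bestResponse F Y x - bestResponse F Y xs‖ ^ 2
      ≤ primal F Y x - primalOpt F X Y := by
  have h1 := hP.quadratic_growth_y hY hx (hP.bestResponse_mem hY hxs)
  have h2 := hP.saddle_x hX hY hL hμp hμd hxs hopt hx
  linarith

/-- By the saddle property x* minimizes F(·, y*(x*)), a strongly convex minorant of f touching it at
x*. -/
theorem quadratic_growth_x (hX : X.Nonempty) (hY : Y.Nonempty) (hL : 0 ≤ L) (hμp : 0 ≤ μp)
    (hμd : 0 < μd) {xs : E} (hxs : xs ∈ X) (hopt : primal F Y xs = primalOpt F X Y) {x : E}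
    (hx : x ∈ X) : μp / 2 * ‖x - xs‖ ^ 2 ≤ primal F Y x - primalOpt F X Y := by
  have hy := hP.bestResponse_mem hY hxs
  have hmin : IsMinOn (fun x => F x (bestResponse F Y xs)) X xs := fun x' hx' => by
    change F xs _ ≤ F x' _
    rw [← hP.primal_eq hY hxs, hopt]
    exact hP.saddle_x hX hY hL hμp hμd hxs hopt hx'
  have h1 := inner_gradient_nonneg_of_isMinOn hP.convex_X hP.X_subset_Q
    (hP.grad_x xs (hP.X_subset_Q hxs) _ hy) hxs hmin hx
  have h2 := hP.strongConvex x hx xs hxs _ hy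
  have h3 := hP.le_primal hx hy
  rw [← hP.primal_eq hY hxs, hopt] at h2
  linarith

end IsMinimaxProblem

/-! ### The ghost sequence -/

/-- The auxiliary sequence that decouples a comparator depending on the samples from the noise `d`:
`v_{t+1}` is the regularized projected gradient step from `v_t` along `d_t`, with a pull of weight
`c` towards `y_{t+1}`. -/
noncomputable def ghostIter {G : Type*} [NormedAddCommGroup G] [InnerProductSpace ℝ G] (Y : Set G)
    (c η : ℝ) (y d : ℕ → G) (v₀ : G) : ℕ → G
  | 0 => v₀
  | t + 1 => nearest Y ((1 + c)⁻¹ • (ghostIter Y c η y d v₀ t + c • y (t + 1) + η • d t))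

section Ghost

variable {G : Type*} [NormedAddCommGroup G] [InnerProductSpace ℝ G] [CompleteSpace G] {Y : Set G}

theorem ghostIter_mem (hc : IsClosed Y) (hY : Convex ℝ Y) {c η : ℝ} {y d : ℕ → G} {v₀ : G}
    (hv₀ : v₀ ∈ Y) (t : ℕ) : ghostIter Y c η y d v₀ t ∈ Y := by
  cases t with
  | zero => exact hv₀
  | succ t => exact (nearest_spec hc hY ⟨v₀, hv₀⟩ _).1

/-- One-step regret of projected gradient ascent along d. The pull towards y_{t+1} buys the
contraction factor 1 + c at the price of the c/2 term on the right. -/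
theorem ghostIter_succ_le (hcl : IsClosed Y) (hY : Convex ℝ Y) {c η : ℝ} (hc : 0 ≤ c)
    (y d : ℕ → G) (v₀ : G) (t : ℕ) {u : G} (hu : u ∈ Y) :
    η * inner ℝ (d t) (u - ghostIter Y c η y d v₀ t)
        + (1 + c) / 2 * ‖u - ghostIter Y c η y d v₀ (t + 1)‖ ^ 2
      ≤ 1 / 2 * ‖u - ghostIter Y c η y d v₀ t‖ ^ 2 + c / 2 * ‖u - y (t + 1)‖ ^ 2
        + η ^ 2 / 2 * ‖d t‖ ^ 2 := by
  have h := (nearest_spec hcl hY ⟨u, hu⟩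
    ((1 + c)⁻¹ • (ghostIter Y c η y d v₀ t + c • y (t + 1) + η • d t))).2 u hu
  have hv' : ghostIter Y c η y d v₀ (t + 1) =
    nearest Y ((1 + c)⁻¹ • (ghostIter Y c η y d v₀ t + c • y (t + 1) + η • d t)) := rfl
  rw [← hv'] at h
  generalize ghostIter Y c η y d v₀ (t + 1) = v' at *
  clear hv'
  generalize ghostIter Y c η y d v₀ t = v at *
  generalize y (t + 1) = w at *
  generalize d t = d at *
  have hc' : 0 < 1 + c := by positivity
  have h3 : inner ℝ (v + c • w + η • d - (1 + c) • v') (u - v') ≤ 0 := by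
    have : v + c • w + η • d - (1 + c) • v' =
        (1 + c) • ((1 + c)⁻¹ • (v + c • w + η • d) - v') := by
      rw [smul_sub, smul_inv_smul₀ hc'.ne']
    rw [this, real_inner_smul_left]
    exact mul_nonpos_of_nonneg_of_nonpos hc'.le h
  have h4 : 0 ≤ ‖(v' - v) - η • d‖ ^ 2 := sq_nonneg _
  have h5 : 0 ≤ c * ‖v' - w‖ ^ 2 := by positivity
  simp only [← real_inner_self_eq_norm_sq, inner_sub_left, inner_sub_right, inner_add_left,
    real_inner_smul_left, real_inner_smul_right, real_inner_comm v u,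
    real_inner_comm v' u, real_inner_comm w u, real_inner_comm v' v, real_inner_comm w v',
    real_inner_comm d v, real_inner_comm d v'] at *
  nlinarith

end Ghost

/-! ### Pathwise gap bound for SREG -/

/-- A saddle function with gradient `(hx, hy)`, strong convexity and concavity moduli `μX`, `μY`
on `X × Y` and an `M`-Lipschitz gradient on `Q × Y`. -/
structure IsSaddle {E G : Type*} [NormedAddCommGroup E] [InnerProductSpace ℝ E]
    [NormedAddCommGroup G] [InnerProductSpace ℝ G] (Φ : E → G → ℝ) (hx : E → G → E)
    (hy : E → G → G) (X Q : Set E) (Y : Set G) (M μX μY : ℝ) : Prop where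
  closed_X : IsClosed X
  convex_X : Convex ℝ X
  closed_Y : IsClosed Y
  convex_Y : Convex ℝ Y
  X_subset_Q : X ⊆ Q
  strongConvex : ∀ x₁ ∈ X, ∀ x₂ ∈ X, ∀ y ∈ Y,
    Φ x₂ y + inner ℝ (hx x₂ y) (x₁ - x₂) + μX / 2 * ‖x₁ - x₂‖ ^ 2 ≤ Φ x₁ y
  strongConcave : ∀ x ∈ X, ∀ y₁ ∈ Y, ∀ y₂ ∈ Y,
    Φ x y₁ ≤ Φ x y₂ + inner ℝ (hy x y₂) (y₁ - y₂) - μY / 2 * ‖y₁ - y₂‖ ^ 2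
  lipschitz : ∀ x ∈ Q, ∀ y ∈ Y, ∀ x' ∈ Q, ∀ y' ∈ Y,
    ‖hx x y - hx x' y'‖ ^ 2 + ‖hy x y - hy x' y'‖ ^ 2 ≤ M * (‖x - x'‖ ^ 2 + ‖y - y'‖ ^ 2)

theorem norm_sub_add_sub_sq_le {H : Type*} [NormedAddCommGroup H] [InnerProductSpace ℝ H]
    (a b c : H) : ‖a + b - c‖ ^ 2 ≤ 3 * (‖a‖ ^ 2 + ‖b‖ ^ 2 + ‖c‖ ^ 2) := by
  have h1 : 0 ≤ ‖a - b‖ ^ 2 := sq_nonneg _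
  have h2 : 0 ≤ ‖a + c‖ ^ 2 := sq_nonneg _
  have h3 : 0 ≤ ‖b + c‖ ^ 2 := sq_nonneg _
  simp only [← real_inner_self_eq_norm_sq, inner_sub_left, inner_sub_right, inner_add_left,
    inner_add_right, real_inner_comm a b, real_inner_comm a c, real_inner_comm b c] at *
  linarith

/-- Jensen's inequality from a supporting hyperplane at the average alone, which is the form in
which convexity is available. -/
theorem sum_mul_map_average_le {H : Type*} [NormedAddCommGroup H] [InnerProductSpace ℝ H]
    {φ : H → ℝ} {g a : H} {w : ℕ → ℝ} {x : ℕ → H} {T : ℕ}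
    (hw : ∀ t ∈ Finset.range T, 0 ≤ w t) (hS : 0 < ∑ t ∈ Finset.range T, w t)
    (ha : a = (∑ t ∈ Finset.range T, w t)⁻¹ • ∑ t ∈ Finset.range T, w t • x t)
    (hφ : ∀ t ∈ Finset.range T, φ a + inner ℝ g (x t - a) ≤ φ (x t)) :
    (∑ t ∈ Finset.range T, w t) * φ a ≤ ∑ t ∈ Finset.range T, w t * φ (x t) := by
  have h0 : ∑ t ∈ Finset.range T, w t • (x t - a) = 0 := by
    simp only [smul_sub, Finset.sum_sub_distrib, ← Finset.sum_smul]
    rw [ha, smul_inv_smul₀ hS.ne', sub_self]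
  calc (∑ t ∈ Finset.range T, w t) * φ a
      = ∑ t ∈ Finset.range T, w t * (φ a + inner ℝ g (x t - a)) := by
        simp only [mul_add, Finset.sum_add_distrib, ← real_inner_smul_right, ← inner_sum]
        rw [h0, inner_zero_right, add_zero, Finset.sum_mul]
    _ ≤ _ := Finset.sum_le_sum fun t ht => mul_le_mul_of_nonneg_left (hφ t ht) (hw t ht)

section SREGAnalysis

variable {E G Ξ : Type*} [NormedAddCommGroup E] [InnerProductSpace ℝ E]
  [NormedAddCommGroup G] [InnerProductSpace ℝ G]

theorem sregWeight_const (μX η : ℝ) (t : ℕ) :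
    sregWeight μX (fun _ => η) t = (1 + μX * η) ^ t := by
  induction t with
  | zero => rfl
  | succ t ih => rw [sregWeight, ih, pow_succ']

/-- The auxiliary sequence attached to a run of SREG with constant step size `η` and oracle error
`e`. -/
noncomputable def sregGhost (X : Set E) (Y : Set G) (h e : E → G → Ξ → E × G) (μX μY η : ℝ)
    (s : ℕ → Ξ) (z₀ : E × G) : ℕ → G :=
  ghostIter Y (μX * η) η (fun t => (sregIter X Y h μX μY (fun _ => η) s z₀ t).2)
    (fun t => -(e (sregMid X Y h μX μY (fun _ => η) s z₀ t).1
      (sregMid X Y h μX μY (fun _ => η) s z₀ t).2 (s (2 * t + 1))).2) z₀.2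

/-- The contribution of the oracle errors in step `t` to the gap bound of SREG. -/
noncomputable def sregStepNoise (X : Set E) (Y : Set G) (h e : E → G → Ξ → E × G) (μX μY η : ℝ)
    (s : ℕ → Ξ) (z₀ : E × G) (x : E) (t : ℕ) : ℝ :=
  let z := sregIter X Y h μX μY (fun _ => η) s z₀ t
  let zh := sregMid X Y h μX μY (fun _ => η) s z₀ t
  let e₁ := e z.1 z.2 (s (2 * t))
  let e₂ := e zh.1 zh.2 (s (2 * t + 1))
  (inner ℝ e₂.1 (x - zh.1) + inner ℝ e₂.2 (zh.2 - sregGhost X Y h e μX μY η s z₀ t))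
    + 2 * η * ((‖e₁.1‖ ^ 2 + ‖e₁.2‖ ^ 2) + (‖e₂.1‖ ^ 2 + ‖e₂.2‖ ^ 2))

/-- The weighted average of the contributions `sregStepNoise`. -/
noncomputable def sregNoise (X : Set E) (Y : Set G) (h e : E → G → Ξ → E × G) (μX μY η : ℝ)
    (s : ℕ → Ξ) (z₀ : E × G) (x : E) (T : ℕ) : ℝ :=
  (∑ t ∈ Finset.range T, η * (1 + μX * η) ^ t)⁻¹ *
    ∑ t ∈ Finset.range T, η * (1 + μX * η) ^ t * sregStepNoise X Y h e μX μY η s z₀ x t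

variable [CompleteSpace E] [CompleteSpace G] {Φ : E → G → ℝ} {hx : E → G → E} {hy : E → G → G}
  {X Q : Set E} {Y : Set G} {M μX μY η : ℝ}

/-- The two component inequalities are added. The terms centred at the midpoint cancel against
strong convexity and concavity there. The difference of the two stochastic gradients splits into a
Lipschitz part and two errors, hence the factor 3; the step-size condition lets the Lipschitz part
be absorbed by ½‖ẑ - z‖². -/
theorem IsSaddle.step_le (hS : IsSaddle Φ hx hy X Q Y M μX μY) (hμX : 0 ≤ μX) (hμY : 0 ≤ μY)
    (hη : 0 ≤ η) (hM : 3 * η ^ 2 * M ≤ 1) {z zh z' e₁ e₂ : E × G} (hz₁ : z.1 ∈ Q) (hz₂ : z.2 ∈ Y)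
    (hzh : zh = sregMidStep X Y η ((hx z.1 z.2, hy z.1 z.2) + e₁) z)
    (hz' : z' = sregNextStep X Y μX μY η ((hx zh.1 zh.2, hy zh.1 zh.2) + e₂) zh z)
    {x : E} {y : G} (hxX : x ∈ X) (hyY : y ∈ Y) :
    η * (Φ zh.1 y - Φ x zh.2) + (1 + η * μX) / 2 * ‖x - z'.1‖ ^ 2
        + (1 + η * μY) / 2 * ‖y - z'.2‖ ^ 2
      ≤ 1 / 2 * ‖x - z.1‖ ^ 2 + 1 / 2 * ‖y - z.2‖ ^ 2
        + η * (inner ℝ e₂.1 (x - zh.1) + inner ℝ e₂.2 (zh.2 - y))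
        + 3 / 2 * η ^ 2 * ((‖e₁.1‖ ^ 2 + ‖e₁.2‖ ^ 2) + (‖e₂.1‖ ^ 2 + ‖e₂.2‖ ^ 2)) := by
  rw [sregMidStep_eq hS.closed_X hS.convex_X ⟨x, hxX⟩ hS.closed_Y hS.convex_Y ⟨y, hyY⟩ hη] at hzh
  rw [sregNextStep_eq hS.closed_X hS.convex_X ⟨x, hxX⟩ hS.closed_Y hS.convex_Y ⟨y, hyY⟩
    hμX hμY hη] at hz'
  obtain ⟨zh₁, zh₂⟩ := zh
  obtain ⟨z'₁, z'₂⟩ := z'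
  obtain ⟨z₁, z₂⟩ := z
  obtain ⟨a₁, b₁⟩ := e₁
  obtain ⟨a₂, b₂⟩ := e₂
  simp only [Prod.mk_add_mk, Prod.mk.injEq] at *
  have hm1 : zh₁ ∈ X := hzh.1 ▸ (nearest_spec hS.closed_X hS.convex_X ⟨x, hxX⟩ _).1
  have hm2 : zh₂ ∈ Y := hzh.2 ▸ (nearest_spec hS.closed_Y hS.convex_Y ⟨y, hyY⟩ _).1
  have hcx := extragradient_component hS.closed_X hS.convex_X hμX hη _ _ z₁ hzh.1 hz'.1 hxX
  have hy1 : zh₂ = nearest Y (z₂ - η • -(hy z₁ z₂ + b₁)) := by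
    rw [smul_neg, sub_neg_eq_add]; exact hzh.2
  have hy2 : z'₂ = nearest Y ((1 + η * μY)⁻¹ •
      (z₂ + (η * μY) • zh₂ - η • -(hy zh₁ zh₂ + b₂))) := by
    rw [smul_neg, sub_neg_eq_add]; exact hz'.2
  have hcy := extragradient_component hS.closed_Y hS.convex_Y hμY hη (-(hy z₁ z₂ + b₁))
    (-(hy zh₁ zh₂ + b₂)) z₂ hy1 hy2 hyY
  have hconv := hS.strongConvex x hxX zh₁ hm1 zh₂ hm2
  have hconc := hS.strongConcave zh₁ hm1 y hyY zh₂ hm2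
  have hlip := hS.lipschitz zh₁ (hS.X_subset_Q hm1) zh₂ hm2 z₁ hz₁ z₂ hz₂
  have hn1 := norm_sub_add_sub_sq_le (hx zh₁ zh₂ - hx z₁ z₂) a₂ a₁
  have hn2 := norm_sub_add_sub_sq_le (hy zh₁ zh₂ - hy z₁ z₂) b₂ b₁
  have r1 : hx zh₁ zh₂ + a₂ - (hx z₁ z₂ + a₁) = hx zh₁ zh₂ - hx z₁ z₂ + a₂ - a₁ := by abel
  have r2 : ‖-(hy zh₁ zh₂ + b₂) - -(hy z₁ z₂ + b₁)‖ = ‖hy zh₁ zh₂ - hy z₁ z₂ + b₂ - b₁‖ := by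
    rw [← norm_neg]; congr 1; abel
  rw [r1] at hcx
  rw [r2] at hcy
  have i1 : inner ℝ (hx zh₁ zh₂ + a₂) (zh₁ - x)
      = -inner ℝ (hx zh₁ zh₂) (x - zh₁) - inner ℝ a₂ (x - zh₁) := by
    rw [← neg_sub x zh₁, inner_neg_right, inner_add_left]; ring
  have i2 : inner ℝ (-(hy zh₁ zh₂ + b₂)) (zh₂ - y)
      = inner ℝ (hy zh₁ zh₂) (y - zh₂) - inner ℝ b₂ (zh₂ - y) := by
    rw [inner_neg_left, inner_add_left, ← neg_sub y zh₂, inner_neg_right, inner_neg_right]; ring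
  rw [i1] at hcx
  rw [i2] at hcy
  have hη2 : 0 ≤ η ^ 2 / 2 := by positivity
  have k1 := mul_le_mul_of_nonneg_left (add_le_add hn1 hn2) hη2
  have k2 := mul_le_mul_of_nonneg_left hlip (by positivity : 0 ≤ 3 * (η ^ 2 / 2))
  have k3 := mul_le_mul_of_nonneg_right hM
    (by positivity : 0 ≤ 1 / 2 * (‖zh₁ - z₁‖ ^ 2 + ‖zh₂ - z₂‖ ^ 2))
  have k4 := mul_le_mul_of_nonneg_left hconv hη
  have k5 := mul_le_mul_of_nonneg_left hconc hη
  nlinarith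

variable {h e : E → G → Ξ → E × G} {s : ℕ → Ξ} {z₀ : E × G}

theorem sregMid_mem (hS : IsSaddle Φ hx hy X Q Y M μX μY) (hX : X.Nonempty) (hY : Y.Nonempty)
    (hη : 0 ≤ η) (t : ℕ) : sregMid X Y h μX μY (fun _ => η) s z₀ t ∈ X ×ˢ Y := by
  rw [sregMid, sregMidStep_eq hS.closed_X hS.convex_X hX hS.closed_Y hS.convex_Y hY hη]
  exact ⟨(nearest_spec hS.closed_X hS.convex_X hX _).1,
    (nearest_spec hS.closed_Y hS.convex_Y hY _).1⟩

theorem sregIter_succ_mem (hS : IsSaddle Φ hx hy X Q Y M μX μY) (hX : X.Nonempty)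
    (hY : Y.Nonempty) (hμX : 0 ≤ μX) (hμY : 0 ≤ μY) (hη : 0 ≤ η) (t : ℕ) :
    sregIter X Y h μX μY (fun _ => η) s z₀ (t + 1) ∈ X ×ˢ Y := by
  rw [sregIter, sregNextStep_eq hS.closed_X hS.convex_X hX hS.closed_Y hS.convex_Y hY hμX hμY hη]
  exact ⟨(nearest_spec hS.closed_X hS.convex_X hX _).1,
    (nearest_spec hS.closed_Y hS.convex_Y hY _).1⟩

theorem sregIter_mem (hS : IsSaddle Φ hx hy X Q Y M μX μY) (hX : X.Nonempty)
    (hY : Y.Nonempty) (hμX : 0 ≤ μX) (hμY : 0 ≤ μY) (hη : 0 ≤ η) (hz₁ : z₀.1 ∈ Q)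
    (hz₂ : z₀.2 ∈ Y) (t : ℕ) :
    (sregIter X Y h μX μY (fun _ => η) s z₀ t).1 ∈ Q ∧
      (sregIter X Y h μX μY (fun _ => η) s z₀ t).2 ∈ Y := by
  cases t with
  | zero => exact ⟨hz₁, hz₂⟩
  | succ t =>
    have h := sregIter_succ_mem (h := h) (s := s) (z₀ := z₀) hS hX hY hμX hμY hη t
    exact ⟨hS.X_subset_Q h.1, h.2⟩

theorem sregAverage_mem (hS : IsSaddle Φ hx hy X Q Y M μX μY) (hX : X.Nonempty) (hY : Y.Nonempty)
    (hμX : 0 ≤ μX) (hη : 0 < η) {T : ℕ} (hT : 0 < T) :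
    sregAverage X Y h μX μY (fun _ => η) s z₀ T ∈ X ×ˢ Y := by
  rw [sregAverage, Finset.smul_sum]
  simp only [sregWeight_const, smul_smul]
  have hpos : 0 < ∑ t ∈ Finset.range T, η * (1 + μX * η) ^ t :=
    Finset.sum_pos (fun t _ => by positivity) ⟨0, by simpa using hT⟩
  refine (hS.convex_X.prod hS.convex_Y).sum_mem (fun t _ => by positivity) ?_
    fun t _ => sregMid_mem hS hX hY hη.le t
  rw [← Finset.mul_sum, inv_mul_cancel₀ hpos.ne']

theorem sregGhost_mem (hS : IsSaddle Φ hx hy X Q Y M μX μY) (hz₂ : z₀.2 ∈ Y) (t : ℕ) :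
    sregGhost X Y h e μX μY η s z₀ t ∈ Y :=
  ghostIter_mem hS.closed_Y hS.convex_Y hz₂ t

/-- The extragradient step and the ghost step are added: the comparator y disappears from the noise,
and the ghost's pull uses up μX of the modulus μY, leaving at least μX for contraction. The ghost
also adds η²/2 ‖e₂‖² to the existing 3η²/2, whence the 2η in the noise. -/
theorem sreg_gap_step_le (hS : IsSaddle Φ hx hy X Q Y M μX μY) (hμX : 0 ≤ μX) (hμ : 2 * μX ≤ μY)
    (hη : 0 ≤ η) (hM : 3 * η ^ 2 * M ≤ 1)
    (he : ∀ x y ξ, h x y ξ = (hx x y, hy x y) + e x y ξ) (hz₁ : z₀.1 ∈ Q) (hz₂ : z₀.2 ∈ Y)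
    {x : E} {y : G} (hxX : x ∈ X) (hyY : y ∈ Y) (t : ℕ) :
    let z := sregIter X Y h μX μY (fun _ => η) s z₀
    let zh := sregMid X Y h μX μY (fun _ => η) s z₀
    let v := sregGhost X Y h e μX μY η s z₀
    η * (Φ (zh t).1 y - Φ x (zh t).2) + (1 + μX * η) * (1 / 2 * ‖x - (z (t + 1)).1‖ ^ 2
        + 1 / 2 * ‖y - (z (t + 1)).2‖ ^ 2 + 1 / 2 * ‖y - v (t + 1)‖ ^ 2)
      ≤ (1 / 2 * ‖x - (z t).1‖ ^ 2 + 1 / 2 * ‖y - (z t).2‖ ^ 2 + 1 / 2 * ‖y - v t‖ ^ 2)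
        + η * sregStepNoise X Y h e μX μY η s z₀ x t := by
  intro z zh v
  have hμY : 0 ≤ μY := by linarith
  have hz := sregIter_mem (h := h) (s := s) hS ⟨x, hxX⟩ ⟨y, hyY⟩ hμX hμY hη hz₁ hz₂ t
  have hzh : zh t = sregMidStep X Y η ((hx (z t).1 (z t).2, hy (z t).1 (z t).2)
      + e (z t).1 (z t).2 (s (2 * t))) (z t) := by
    rw [← he]; rfl
  have hz' : z (t + 1) = sregNextStep X Y μX μY η ((hx (zh t).1 (zh t).2, hy (zh t).1 (zh t).2)
      + e (zh t).1 (zh t).2 (s (2 * t + 1))) (zh t) (z t) := by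
    rw [← he]; rfl
  have h1 := hS.step_le hμX hμY hη hM hz.1 hz.2 hzh hz' hxX hyY
  have h2 := ghostIter_succ_le hS.closed_Y hS.convex_Y (mul_nonneg hμX hη) (η := η)
    (fun t => (sregIter X Y h μX μY (fun _ => η) s z₀ t).2)
    (fun t => -(e (sregMid X Y h μX μY (fun _ => η) s z₀ t).1
      (sregMid X Y h μX μY (fun _ => η) s z₀ t).2 (s (2 * t + 1))).2) z₀.2 t hyY
  have hn : sregStepNoise X Y h e μX μY η s z₀ x t
    = (inner ℝ (e (zh t).1 (zh t).2 (s (2 * t + 1))).1 (x - (zh t).1)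
        + inner ℝ (e (zh t).1 (zh t).2 (s (2 * t + 1))).2 ((zh t).2 - v t))
      + 2 * η * ((‖(e (z t).1 (z t).2 (s (2 * t))).1‖ ^ 2
          + ‖(e (z t).1 (z t).2 (s (2 * t))).2‖ ^ 2)
        + (‖(e (zh t).1 (zh t).2 (s (2 * t + 1))).1‖ ^ 2
          + ‖(e (zh t).1 (zh t).2 (s (2 * t + 1))).2‖ ^ 2)) := rfl
  rw [hn]
  change _ * inner ℝ (-(e (zh t).1 (zh t).2 (s (2 * t + 1))).2) (y - v t)
    + _ / 2 * ‖y - v (t + 1)‖ ^ 2 ≤ 1 / 2 * ‖y - v t‖ ^ 2 + _ / 2 * ‖y - (z (t + 1)).2‖ ^ 2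
      + _ / 2 * ‖-(e (zh t).1 (zh t).2 (s (2 * t + 1))).2‖ ^ 2 at h2
  rw [norm_neg, inner_neg_left] at h2
  have i1 : inner ℝ (e (zh t).1 (zh t).2 (s (2 * t + 1))).2 ((zh t).2 - v t)
      = inner ℝ (e (zh t).1 (zh t).2 (s (2 * t + 1))).2 ((zh t).2 - y)
        + inner ℝ (e (zh t).1 (zh t).2 (s (2 * t + 1))).2 (y - v t) := by
    rw [← inner_add_right]; congr 1; abel
  rw [i1]
  have p1 := mul_nonneg (mul_nonneg hη (sub_nonneg.2 hμ)) (sq_nonneg ‖y - (z (t + 1)).2‖)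
  have p2 := mul_nonneg (sq_nonneg η) (sq_nonneg ‖(e (z t).1 (z t).2 (s (2 * t))).1‖)
  have p3 := mul_nonneg (sq_nonneg η) (sq_nonneg ‖(e (z t).1 (z t).2 (s (2 * t))).2‖)
  have p4 := mul_nonneg (sq_nonneg η) (sq_nonneg ‖(e (zh t).1 (zh t).2 (s (2 * t + 1))).1‖)
  linarith

/-- The gap bound of SREG, for every realization of the samples and every comparator. -/
theorem sreg_gap_le (hS : IsSaddle Φ hx hy X Q Y M μX μY) (hμX : 0 ≤ μX) (hμ : 2 * μX ≤ μY)
    (hη : 0 < η) (hM : 3 * η ^ 2 * M ≤ 1)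
    (he : ∀ x y ξ, h x y ξ = (hx x y, hy x y) + e x y ξ) (hz₁ : z₀.1 ∈ Q) (hz₂ : z₀.2 ∈ Y)
    {x : E} {y : G} (hxX : x ∈ X) (hyY : y ∈ Y) {T : ℕ} (hT : 0 < T) :
    let z := sregIter X Y h μX μY (fun _ => η) s z₀ T
    let zb := sregAverage X Y h μX μY (fun _ => η) s z₀ T
    let S := ∑ t ∈ Finset.range T, η * (1 + μX * η) ^ t
    Φ zb.1 y - Φ x zb.2
        + S⁻¹ * (1 + μX * η) ^ T * (1 / 2 * ‖x - z.1‖ ^ 2 + 1 / 2 * ‖y - z.2‖ ^ 2)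
      ≤ S⁻¹ * (1 / 2 * ‖x - z₀.1‖ ^ 2 + ‖y - z₀.2‖ ^ 2)
        + sregNoise X Y h e μX μY η s z₀ x T := by
  intro z zb S
  set w : ℕ → ℝ := fun t => η * (1 + μX * η) ^ t with hw
  set zh := sregMid X Y h μX μY (fun _ => η) s z₀ with hzh
  set D : ℕ → ℝ := fun t => 1 / 2 * ‖x - (sregIter X Y h μX μY (fun _ => η) s z₀ t).1‖ ^ 2
    + 1 / 2 * ‖y - (sregIter X Y h μX μY (fun _ => η) s z₀ t).2‖ ^ 2
    + 1 / 2 * ‖y - sregGhost X Y h e μX μY η s z₀ t‖ ^ 2 with hD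
  have hSpos : 0 < S := Finset.sum_pos (fun t _ => by positivity) ⟨0, by simpa using hT⟩
  have hmem : ∀ t, zh t ∈ X ×ˢ Y := sregMid_mem hS ⟨x, hxX⟩ ⟨y, hyY⟩ hη.le
  have hzb : zb ∈ X ×ˢ Y := sregAverage_mem hS ⟨x, hxX⟩ ⟨y, hyY⟩ hμX hη hT
  have hzb1 : zb.1 = (∑ t ∈ Finset.range T, w t)⁻¹ • ∑ t ∈ Finset.range T, w t • (zh t).1 := by
    simp [zb, sregAverage, sregWeight_const, Prod.fst_sum, hw, hzh]
  have hzb2 : zb.2 = (∑ t ∈ Finset.range T, w t)⁻¹ • ∑ t ∈ Finset.range T, w t • (zh t).2 := by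
    simp [zb, sregAverage, sregWeight_const, Prod.snd_sum, hw, hzh]
  have j1 : S * Φ zb.1 y ≤ ∑ t ∈ Finset.range T, w t * Φ (zh t).1 y :=
    sum_mul_map_average_le (φ := fun x => Φ x y) (g := hx zb.1 y) (x := fun t => (zh t).1)
      (fun t _ => by positivity) hSpos hzb1 fun t _ => by
        have := hS.strongConvex _ (hmem t).1 _ hzb.1 y hyY
        have : 0 ≤ μX / 2 * ‖(zh t).1 - zb.1‖ ^ 2 := by positivity
        linarith
  have j2 : S * (-Φ x zb.2) ≤ ∑ t ∈ Finset.range T, w t * (-Φ x (zh t).2) :=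
    sum_mul_map_average_le (φ := fun y => -Φ x y) (g := -hy x zb.2) (x := fun t => (zh t).2)
      (fun t _ => by positivity) hSpos hzb2 fun t _ => by
        have := hS.strongConcave x hxX _ (hmem t).2 _ hzb.2
        have : 0 ≤ μY / 2 * ‖(zh t).2 - zb.2‖ ^ 2 :=
          mul_nonneg (by linarith) (sq_nonneg _)
        rw [inner_neg_left]
        linarith
  have tel : ∀ n, ∑ t ∈ Finset.range n, w t * (Φ (zh t).1 y - Φ x (zh t).2)
      + (1 + μX * η) ^ n * D n
      ≤ D 0 + ∑ t ∈ Finset.range n, w t * sregStepNoise X Y h e μX μY η s z₀ x t := by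
    intro n
    induction n with
    | zero => simp
    | succ n ih =>
      have hstep := sreg_gap_step_le (s := s) hS hμX hμ hη.le hM he hz₁ hz₂ hxX hyY n
      have hmul := mul_le_mul_of_nonneg_left hstep
        (by positivity : 0 ≤ (1 + μX * η) ^ n)
      rw [Finset.sum_range_succ, Finset.sum_range_succ, pow_succ]
      simp only [hw, hD, hzh] at *
      linarith
  have htel := tel T
  -- The y-distance has coefficient 1 because the iterate and the ghost start at the same point.
  have hD0 : D 0 = 1 / 2 * ‖x - z₀.1‖ ^ 2 + ‖y - z₀.2‖ ^ 2 := by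
    simp only [hD, sregIter, sregGhost, ghostIter]
    ring
  have hDT : (1 + μX * η) ^ T * (1 / 2 * ‖x - z.1‖ ^ 2 + 1 / 2 * ‖y - z.2‖ ^ 2)
      ≤ (1 + μX * η) ^ T * D T := by
    refine mul_le_mul_of_nonneg_left ?_ (by positivity)
    have := sq_nonneg ‖y - sregGhost X Y h e μX μY η s z₀ T‖
    simp only [hD, z]
    linarith
  have hsum : ∑ t ∈ Finset.range T, w t * (Φ (zh t).1 y - Φ x (zh t).2)
      = ∑ t ∈ Finset.range T, w t * Φ (zh t).1 y
        + ∑ t ∈ Finset.range T, w t * (-Φ x (zh t).2) := by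
    rw [← Finset.sum_add_distrib]
    exact Finset.sum_congr rfl fun t _ => by ring
  rw [hsum, hD0] at htel
  have hfin : S * (Φ zb.1 y - Φ x zb.2)
      + (1 + μX * η) ^ T * (1 / 2 * ‖x - z.1‖ ^ 2 + 1 / 2 * ‖y - z.2‖ ^ 2)
      ≤ (1 / 2 * ‖x - z₀.1‖ ^ 2 + ‖y - z₀.2‖ ^ 2)
        + ∑ t ∈ Finset.range T, w t * sregStepNoise X Y h e μX μY η s z₀ x t := by
    linarith
  have hmul := mul_le_mul_of_nonneg_left hfin (inv_nonneg.2 hSpos.le)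
  have hn : sregNoise X Y h e μX μY η s z₀ x T = S⁻¹ *
    ∑ t ∈ Finset.range T, w t * sregStepNoise X Y h e μX μY η s z₀ x t := rfl
  rw [hn, mul_assoc, ← mul_add S⁻¹ (1 / 2 * ‖x - z₀.1‖ ^ 2 + ‖y - z₀.2‖ ^ 2)]
  refine le_trans (le_of_eq ?_) hmul
  rw [mul_add S⁻¹, inv_mul_cancel_left₀ hSpos.ne']

/-- The origin of α: with S the sum of the weights, S⁻¹ = β/(Λ - 1) and S⁻¹ Λ = α. -/
theorem sum_geom_weights (T : ℕ) :
    μX * ∑ t ∈ Finset.range T, η * (1 + μX * η) ^ t = (1 + μX * η) ^ T - 1 := by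
  induction T with
  | zero => simp
  | succ T ih => rw [Finset.sum_range_succ, mul_add, ih, pow_succ]; ring

end SREGAnalysis

/-! ### Pathwise analysis of an outer iteration and of an epoch -/

/-- Convexity of the squared norm with the defect ‖p - γ q‖² made explicit. It is applied to the
averaging formula for x̄_k, with m = μp (1-γ), so that the μp-term is paid by strong convexity of F
between x* and x̃. -/
theorem norm_smul_add_smul_sq_le {H : Type*} [NormedAddCommGroup H] [InnerProductSpace ℝ H]
    {α m γ : ℝ} (hα : 0 < α) (hm : 0 ≤ m) (hγ : 0 < γ) {p q d : H}
    (hd : (α * γ + m) • d = α • p + m • q) :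
    α * γ ^ 2 * ‖d‖ ^ 2 ≤ α * ‖p‖ ^ 2 + γ * m * ‖q‖ ^ 2 := by
  have hA : 0 < α * γ + m := by positivity
  have h1 : (α * γ + m) ^ 2 * ‖d‖ ^ 2 = ‖α • p + m • q‖ ^ 2 := by
    rw [← hd, norm_smul, mul_pow, Real.norm_eq_abs, sq_abs]
  have h2 : γ * ‖α • p + m • q‖ ^ 2 + α * m * ‖p - γ • q‖ ^ 2
      = (α * γ + m) * (α * ‖p‖ ^ 2 + γ * m * ‖q‖ ^ 2) := by
    simp only [← real_inner_self_eq_norm_sq, inner_sub_left, inner_sub_right, inner_add_left,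
      inner_add_right, real_inner_smul_left, real_inner_smul_right, real_inner_comm p q]
    ring
  have h3 : 0 ≤ α * m * ‖p - γ • q‖ ^ 2 := by positivity
  have h4 : (α * γ + m) * (γ * (α * γ + m) * ‖d‖ ^ 2)
      ≤ (α * γ + m) * (α * ‖p‖ ^ 2 + γ * m * ‖q‖ ^ 2) := by nlinarith
  have h5 := le_of_mul_le_mul_left h4 hA
  have h6 : 0 ≤ γ * m * ‖d‖ ^ 2 := by positivity
  nlinarith

section Outer

variable {E G Ξ : Type*} [NormedAddCommGroup E] [InnerProductSpace ℝ E] [CompleteSpace E]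
  [NormedAddCommGroup G] [InnerProductSpace ℝ G] [CompleteSpace G]
  {F : E → G → ℝ} {gx : E → G → E} {gy : E → G → G} {X Q : Set E} {Y : Set G}

/-- Only the added quadratic is counted in the modulus in x; the strong convexity of F itself is
kept for the outer inequality. -/
theorem IsMinimaxProblem.isSaddle_prox {L μp μd : ℝ}
    (hP : IsMinimaxProblem F gx gy X Q Y L μp μd) (hL : 0 ≤ L) (hμp : 0 ≤ μp) {β : ℝ} (xhat : E) :
    IsSaddle (fun x y => F x y + β / 2 * ‖x - xhat‖ ^ 2) (fun x y => gx x y + β • (x - xhat)) gy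
      X Q Y (2 * (L ^ 2 + β ^ 2)) β μd where
  closed_X := hP.compact_X.isClosed
  convex_X := hP.convex_X
  closed_Y := hP.compact_Y.isClosed
  convex_Y := hP.convex_Y
  X_subset_Q := hP.X_subset_Q
  strongConvex x₁ h₁ x₂ h₂ y hy := by
    have h := hP.strongConvex x₁ h₁ x₂ h₂ y hy
    have e := norm_sq_sub_of_inner xhat x₂ x₁
    have hp : 0 ≤ μp / 2 * ‖x₁ - x₂‖ ^ 2 := by positivity
    rw [inner_add_left, real_inner_smul_left, e, ← neg_sub x₂ xhat, inner_neg_left]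
    linarith
  strongConcave x hx y₁ h₁ y₂ h₂ := by
    have h := hP.strongConcave x hx y₁ h₁ y₂ h₂
    linarith
  lipschitz x hx y hy x' hx' y' hy' := by
    have h := hP.lipschitz_sq hL hx hy hx' hy'
    have e : gx x y + β • (x - xhat) - (gx x' y' + β • (x' - xhat))
        = (gx x y - gx x' y') + β • (x - x') := by module
    have h1 : ‖(gx x y - gx x' y') + β • (x - x')‖ ^ 2
        ≤ 2 * (‖gx x y - gx x' y'‖ ^ 2 + ‖β • (x - x')‖ ^ 2) := by
      have h2 := parallelogram_law_with_norm ℝ (gx x y - gx x' y') (β • (x - x'))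
      nlinarith [sq_nonneg ‖(gx x y - gx x' y') - β • (x - x')‖]
    rw [norm_smul, mul_pow, Real.norm_eq_abs, sq_abs] at h1
    rw [e]
    nlinarith [sq_nonneg ‖gy x y - gy x' y'‖, mul_nonneg (sq_nonneg β) (sq_nonneg ‖y - y'‖)]

/-- The error of the stochastic oracle `g` with respect to the gradient `(gx, gy)`. -/
def oracleError (g : E → G → Ξ → E × G) (gx : E → G → E) (gy : E → G → G) :
    E → G → Ξ → E × G := fun x y ξ => g x y ξ - (gx x y, gy x y)

/-- The extrapolated prox-center of iteration `k`. -/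
noncomputable def proxCenter (k : ℕ) (st : State E G) : E :=
  gam k • st.xbar + (1 - gam k) • st.xtil

/-- The comparator used in the analysis of iteration `k`. -/
noncomputable def comparator (xs : E) (k : ℕ) (st : State E G) : E :=
  gam k • xs + (1 - gam k) • st.xtil

/-- The contribution of the oracle errors in iteration `k` of epoch `e`. -/
noncomputable def catalystNoise (p : Params) (X Q : Set E) (Y : Set G) (g er : E → G → Ξ → E × G)
    (s : ℕ → Ξ) (xs : E) (e k : ℕ) (st : State E G) : ℝ :=
  sregNoise X Y (proxOracle g (p.β k) (proxCenter k st)) er (p.β k) p.μd (p.η e k)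
    (fun i => s (st.calls + i)) (nearest Q (proxCenter k st), st.y) (comparator xs k st) (p.T e)

/-- What is needed of the parameters of an epoch. -/
structure Params.Admissible (p : Params) (e : ℕ) : Prop where
  μp_pos : 0 < p.μp
  μp_le : p.μp ≤ p.μd
  μd_le : p.μd ≤ p.L
  T_pos : 0 < p.T e
  η_pos : ∀ k, 0 < p.η e k
  Λ_eq : ∀ k, (1 + p.β k * p.η e k) ^ p.T e = p.Λ e
  one_lt_Λ : 1 < p.Λ e

theorem gam_pos (k : ℕ) : 0 < gam k := by unfold gam; positivity

theorem gam_le_one {k : ℕ} (hk : 1 ≤ k) : gam k ≤ 1 := by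
  have : (1 : ℝ) ≤ k := by exact_mod_cast hk
  unfold gam
  rw [div_le_one (by positivity)]
  linarith

variable {p : Params} {e k : ℕ} {g : E → G → Ξ → E × G} {s : ℕ → Ξ} {st : State E G}

theorem Params.Admissible.μd_pos (h : p.Admissible e) : 0 < p.μd := h.μp_pos.trans_le h.μp_le

theorem Params.Admissible.L_pos (h : p.Admissible e) : 0 < p.L := h.μd_pos.trans_le h.μd_le

theorem Params.Admissible.β_pos (h : p.Admissible e) (k : ℕ) : 0 < p.β k := by
  have := h.μd_pos
  unfold Params.β
  positivity

theorem Params.Admissible.β_le (h : p.Admissible e) (k : ℕ) : p.β k ≤ p.μd / 4 := by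
  have := h.μd_pos
  unfold Params.β
  rw [div_le_div_iff₀ (by positivity) (by norm_num)]
  nlinarith

theorem Params.Admissible.le_β (h : p.Admissible e) {k : ℕ} (hk : 1 ≤ k) :
    p.μd / 6 ≤ p.β k := by
  have := h.μd_pos
  have hk' : (1 : ℝ) ≤ k := by exact_mod_cast hk
  unfold Params.β
  rw [div_le_div_iff₀ (by norm_num) (by positivity)]
  nlinarith

theorem Params.Admissible.α_pos (h : p.Admissible e) (k : ℕ) : 0 < p.α e k := by
  have h1 := h.β_pos k
  have h2 := h.one_lt_Λ
  have h3 : 0 < p.Λ e - 1 := by linarith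
  unfold Params.α
  positivity

theorem Params.Admissible.step_le (h : p.Admissible e) (hk : 1 ≤ k) :
    3 * p.η e k ^ 2 * (2 * (p.L ^ 2 + p.β k ^ 2)) ≤ 1 := by
  have hL := h.L_pos
  have hη := h.η_pos k
  have hk' : (1 : ℝ) ≤ k := by exact_mod_cast hk
  -- The worst case is k = 1, where the first bound in the step size is 1/(16 L).
  have h1 : p.η e k * p.L ≤ 1 / 16 := by
    have : p.η e k ≤ ((k : ℝ) + 2) / (24 * ((k : ℝ) + 1) * p.L) := min_le_left _ _
    calc p.η e k * p.L ≤ ((k : ℝ) + 2) / (24 * ((k : ℝ) + 1) * p.L) * p.L := by gcongr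
      _ = ((k : ℝ) + 2) / (24 * ((k : ℝ) + 1)) := by field_simp
      _ ≤ 1 / 16 := by
        rw [div_le_div_iff₀ (by positivity) (by norm_num)]
        linarith
  have h2 : p.β k ≤ p.L := by linarith [h.β_le k, h.μd_le, h.μd_pos]
  have h3 : p.η e k * p.β k ≤ 1 / 16 :=
    (mul_le_mul_of_nonneg_left h2 hη.le).trans h1
  have h4 : (p.η e k * p.L) ^ 2 ≤ (1 / 16) ^ 2 := by gcongr
  have h5 : (p.η e k * p.β k) ^ 2 ≤ (1 / 16) ^ 2 := by
    have := h.β_pos k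
    gcongr
  nlinarith

theorem catalystStep_mem (hP : IsMinimaxProblem F gx gy X Q Y p.L p.μp p.μd)
    (hp : p.Admissible e) (hX : X.Nonempty) (hY : Y.Nonempty) :
    (catalystStep p X Q Y g s e k st).xtil ∈ X ∧ (catalystStep p X Q Y g s e k st).y ∈ Y := by
  have hS := hP.isSaddle_prox hp.L_pos.le hp.μp_pos.le (β := p.β k) (proxCenter k st)
  refine ⟨(sregAverage_mem hS hX hY (hp.β_pos k).le (hp.η_pos k) hp.T_pos).1, ?_⟩
  have hT : p.T e = p.T e - 1 + 1 := (Nat.sub_add_cancel hp.T_pos).symm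
  change (sregIter _ _ _ _ _ _ _ _ (p.T e)).2 ∈ Y
  rw [hT]
  exact (sregIter_succ_mem hS hX hY (hp.β_pos k).le hp.μd_pos.le (hp.η_pos k).le _).2

theorem inv_sum_weights (hp : p.Admissible e) (k : ℕ) :
    (∑ t ∈ Finset.range (p.T e), p.η e k * (1 + p.β k * p.η e k) ^ t)⁻¹
      = p.β k / (p.Λ e - 1) := by
  have h := sum_geom_weights (μX := p.β k) (η := p.η e k) (p.T e)
  rw [hp.Λ_eq] at h
  have hβ := hp.β_pos k
  have hS : 0 < ∑ t ∈ Finset.range (p.T e), p.η e k * (1 + p.β k * p.η e k) ^ t :=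
    Finset.sum_pos (fun t _ => by have := hp.η_pos k; positivity) ⟨0, by simpa using hp.T_pos⟩
  rw [← h]
  field_simp

/-- One iteration of Catalyst-Minimax(SREG), for every realization of the samples. -/
theorem catalystStep_le (hP : IsMinimaxProblem F gx gy X Q Y p.L p.μp p.μd)
    (hp : p.Admissible e) {xs : E} (hxs : xs ∈ X) (hopt : primal F Y xs = primalOpt F X Y)
    (hk : 1 ≤ k) (hx : st.xtil ∈ X) (hy : st.y ∈ Y) :
    let st' := catalystStep p X Q Y g s e k st
    primal F Y st'.xtil - primalOpt F X Y
        + p.α e k * gam k ^ 2 * (1 / 2 * ‖xs - st'.xbar‖ ^ 2)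
        + p.α e k / 2 * ‖bestResponse F Y st'.xtil - st'.y‖ ^ 2
      ≤ (1 - gam k) * (primal F Y st.xtil - primalOpt F X Y)
        + p.α e k * gam k ^ 2 * (1 / 2 * ‖xs - st.xbar‖ ^ 2)
        + p.β k / (p.Λ e - 1) * ‖bestResponse F Y st'.xtil - st.y‖ ^ 2
        + catalystNoise p X Q Y g (oracleError g gx gy) s xs e k st := by
  intro st'
  have hX : X.Nonempty := ⟨xs, hxs⟩
  have hY : Y.Nonempty := ⟨st.y, hy⟩
  have hγ0 := gam_pos k
  have hγ1 := gam_le_one hk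
  have hβ := hp.β_pos k
  have hα := hp.α_pos k
  have hS := hP.isSaddle_prox hp.L_pos.le hp.μp_pos.le (β := p.β k) (proxCenter k st)
  have hmem : st'.xtil ∈ X ∧ st'.y ∈ Y := catalystStep_mem hP hp hX hY
  have hcmp : comparator xs k st ∈ X := hP.convex_X hxs hx hγ0.le (by linarith) (by ring)
  have hbr := hP.bestResponse_mem hY hmem.1
  have hQ := nearest_spec hP.closed_Q hP.convex_Q (hX.mono hP.X_subset_Q) (proxCenter k st)
  -- The y-comparator is the best response to the output x̃_k, so that F at this pair is exactly
  -- f(x̃_k). The x-comparator is fixed before the iteration begins.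
  have hgap := sreg_gap_le (h := proxOracle g (p.β k) (proxCenter k st))
    (e := oracleError g gx gy) (s := fun i => s (st.calls + i))
    (z₀ := (nearest Q (proxCenter k st), st.y)) hS hβ.le
    (by linarith [hp.β_le k, hp.μd_pos]) (hp.η_pos k) (hp.step_le hk)
    (fun x y ξ => by ext <;> simp [proxOracle, oracleError]; abel) hQ.1 hy hcmp hbr hp.T_pos
  simp only [inv_sum_weights hp, hp.Λ_eq] at hgap
  set zT := sregIter X Y (proxOracle g (p.β k) (proxCenter k st)) (p.β k) p.μd
    (fun _ => p.η e k) (fun i => s (st.calls + i)) (nearest Q (proxCenter k st), st.y) (p.T e)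
    with hzT
  set zb := sregAverage X Y (proxOracle g (p.β k) (proxCenter k st)) (p.β k) p.μd
    (fun _ => p.η e k) (fun i => s (st.calls + i)) (nearest Q (proxCenter k st), st.y) (p.T e)
    with hzb
  have hzb2 : zb.2 ∈ Y := (sregAverage_mem hS hX hY hβ.le (hp.η_pos k) hp.T_pos).2
  have e1 : st'.xtil = zb.1 := rfl
  have e2 : st'.y = zT.2 := rfl
  have e3 : st'.xbar = (p.α e k * gam k + p.μp * (1 - gam k))⁻¹ •
      (p.α e k • zT.1 + ((p.μp - p.α e k) * (1 - gam k)) • st.xtil) := rfl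
  have e4 : catalystNoise p X Q Y g (oracleError g gx gy) s xs e k st
    = sregNoise X Y (proxOracle g (p.β k) (proxCenter k st)) (oracleError g gx gy) (p.β k) p.μd
      (p.η e k) (fun i => s (st.calls + i)) (nearest Q (proxCenter k st), st.y)
      (comparator xs k st) (p.T e) := rfl
  have e5 : p.β k / (p.Λ e - 1) * p.Λ e = p.α e k := by unfold Params.α; ring
  rw [← e1, ← e2, ← e4, e5] at hgap
  have hF1 := hP.primal_eq hY hmem.1
  have hF2 := hP.convex_comb_x hxs hx hzb2 hγ0.le hγ1
  have hF3 := hP.le_primal hxs hzb2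
  have hF4 := hP.le_primal hx hzb2
  rw [hopt] at hF3
  have hF5 := mul_le_mul_of_nonneg_left hF3 hγ0.le
  have hF6 := mul_le_mul_of_nonneg_left hF4 (sub_nonneg.2 hγ1)
  have hdiff : comparator xs k st - proxCenter k st = gam k • (xs - st.xbar) := by
    unfold comparator proxCenter; module
  have hd1 : ‖comparator xs k st - proxCenter k st‖ ^ 2 = gam k ^ 2 * ‖xs - st.xbar‖ ^ 2 := by
    rw [hdiff, norm_smul, mul_pow, Real.norm_eq_abs, sq_abs]
  have hd2 := norm_sub_nearest_le hP.closed_Q hP.convex_Q (hP.X_subset_Q hcmp) (proxCenter k st)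
  have hm : 0 ≤ p.μp * (1 - gam k) := mul_nonneg hp.μp_pos.le (sub_nonneg.2 hγ1)
  -- The choice of x̄_k makes (αγ + μp(1-γ))(x̄_k - x*) a combination of z_T minus the comparator
  -- and x̃_{k-1} - x*.
  have hbar : p.α e k * gam k ^ 2 * ‖st'.xbar - xs‖ ^ 2
      ≤ p.α e k * ‖zT.1 - comparator xs k st‖ ^ 2
        + gam k * (p.μp * (1 - gam k)) * ‖st.xtil - xs‖ ^ 2 := by
    refine norm_smul_add_smul_sq_le hα hm hγ0 ?_
    have hA : 0 < p.α e k * gam k + p.μp * (1 - gam k) := by positivity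
    rw [smul_sub, e3, smul_inv_smul₀ hA.ne']
    unfold comparator
    module
  rw [norm_sub_rev st'.xbar, norm_sub_rev zT.1, norm_sub_rev st.xtil] at hbar
  have hΛ : 0 < p.Λ e - 1 := by linarith [hp.one_lt_Λ]
  have hc : 0 ≤ p.β k / (p.Λ e - 1) := by positivity
  have hd3 := mul_le_mul_of_nonneg_left hd2 hc
  have hcmp_eq : comparator xs k st = gam k • xs + (1 - gam k) • st.xtil := rfl
  -- The proximal term at the comparator and the initial distance of SREG add up to the same α as in
  -- the final distance, so the x̄-terms can telescope.
  have hα' : p.α e k = p.β k + p.β k / (p.Λ e - 1) := by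
    unfold Params.α; field_simp; ring
  have hpos : 0 ≤ p.β k / 2 * ‖st'.xtil - proxCenter k st‖ ^ 2 := by positivity
  rw [hd1] at hgap hd3
  rw [← hcmp_eq] at hF2
  have hsplit : p.α e k * gam k ^ 2 * (1 / 2 * ‖xs - st.xbar‖ ^ 2)
      = p.β k / 2 * (gam k ^ 2 * ‖xs - st.xbar‖ ^ 2)
        + p.β k / (p.Λ e - 1) * (gam k ^ 2 * ‖xs - st.xbar‖ ^ 2) / 2 := by
    rw [hα']; ring
  rw [hsplit]
  linarith

/-- Multiplying by (k+1)(k+2) makes the coefficient of b independent of k, and (k+1)(k+2)(1-γ) =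
k(k+1) - 2. The two spare units, one for a and one for a', together with the whole y-term on the
right, absorb the warm-start error d. -/
theorem potential_step {k K μd ρ β γ c a b y a' b' y' d N R : ℝ} (hk : 1 ≤ k) (hkK : k ≤ K)
    (hK : 24 ≤ K) (hμd : 0 < μd) (hρ : 1 ≤ ρ) (hβ : β = μd * (k + 1) / (4 * (k + 2)))
    (hγ : γ = 2 / (k + 1)) (hc : 0 ≤ c) (ha : 0 ≤ a) (ha' : 0 ≤ a') (hy : 0 ≤ y) (hy' : 0 ≤ y')
    (hd : 0 ≤ d)
    (h : a' + ρ * β * γ ^ 2 * b' + ρ * β / 2 * y'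
      ≤ (1 - γ) * a + ρ * β * γ ^ 2 * b + β * c * d + N)
    (hdb : μd * c * d ≤ (6 * a' + 6 * a + 3 * μd * y) / (4000 * K ^ 2) + R) :
    ((k + 1) * (k + 2) - 1) * a' + ρ * μd * b' + (k + 1) * (k + 2) / 12 * μd * y'
      ≤ (k * (k + 1) - 1) * a + ρ * μd * b + k * (k + 1) / 12 * μd * y
        + (k + 1) * (k + 2) * (R / 4 + N) := by
  have hθ : 0 < (k + 1) * (k + 2) := by positivity
  have e1 : (k + 1) * (k + 2) * (ρ * β * γ ^ 2) = ρ * μd := by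
    rw [hβ, hγ]; field_simp; ring
  have e2 : (k + 1) * (k + 2) * (1 - γ) = (k + 2) * (k - 1) := by
    rw [hγ]; field_simp; ring
  have hβ6 : μd / 6 ≤ β := by
    rw [hβ, div_le_div_iff₀ (by norm_num) (by positivity)]; nlinarith
  have hβ4 : β ≤ μd / 4 := by
    rw [hβ, div_le_div_iff₀ (by positivity) (by norm_num)]; nlinarith
  have h1 : (k + 1) * (k + 2) / 12 * μd * y' ≤ (k + 1) * (k + 2) * (ρ * β / 2 * y') := by
    have : μd / 12 ≤ ρ * β / 2 := by nlinarith
    have := mul_le_mul_of_nonneg_left (mul_le_mul_of_nonneg_right this hy') hθ.le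
    linarith
  have h2 : (k + 1) * (k + 2) * (β * c * d)
      ≤ (k + 1) * (k + 2) * ((6 * a' + 6 * a + 3 * μd * y) / (4000 * K ^ 2) + R) / 4 := by
    have h3 := mul_le_mul_of_nonneg_right hβ4 (mul_nonneg hc hd)
    have h4 : β * c * d ≤ ((6 * a' + 6 * a + 3 * μd * y) / (4000 * K ^ 2) + R) / 4 := by linarith
    have := mul_le_mul_of_nonneg_left h4 hθ.le
    linarith
  have hs : 0 ≤ 6 * a' + 6 * a + 3 * μd * y := by positivity
  have h3 : (k + 1) * (k + 2) * ((6 * a' + 6 * a + 3 * μd * y) / (4000 * K ^ 2))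
      ≤ (6 * a' + 6 * a + 3 * μd * y) / 3000 := by
    rw [mul_div_assoc', div_le_div_iff₀ (by positivity) (by norm_num)]
    -- Uses K ≥ 24, which gives (K+1)(K+2) ≤ (4/3) K².
    have : (k + 1) * (k + 2) * 3000 ≤ 4000 * K ^ 2 := by nlinarith
    nlinarith
  have h4 := mul_le_mul_of_nonneg_left h hθ.le
  have h5 : (k + 1) * (k + 2) * ((1 - γ) * a) = (k + 2) * (k - 1) * a := by
    rw [← mul_assoc, e2]
  have h6 : (k + 1) * (k + 2) * (ρ * β * γ ^ 2 * b) = ρ * μd * b := by rw [← mul_assoc, e1]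
  have h7 : (k + 1) * (k + 2) * (ρ * β * γ ^ 2 * b') = ρ * μd * b' := by rw [← mul_assoc, e1]
  have h8 : 2 / 12 * (μd * y) ≤ k * (k + 1) / 12 * μd * y := by
    have : 2 ≤ k * (k + 1) := by nlinarith
    have := mul_le_mul_of_nonneg_right this (mul_nonneg hμd.le hy)
    linarith
  have h9 : 0 ≤ μd * y := by positivity
  generalize (6 * a' + 6 * a + 3 * μd * y) / (4000 * K ^ 2) = S at h2 h3
  clear hdb h hs hβ hγ e1 e2 hβ6 hβ4
  linarith

theorem catalystIter_mem (hP : IsMinimaxProblem F gx gy X Q Y p.L p.μp p.μd)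
    (hp : p.Admissible e) {x : E} {y : G} (hx : x ∈ X) (hy : y ∈ Y) {c : ℕ} (k : ℕ) :
    (catalystIter p X Q Y g s e x y c k).xtil ∈ X ∧
      (catalystIter p X Q Y g s e x y c k).y ∈ Y := by
  cases k with
  | zero => exact ⟨hx, hy⟩
  | succ k => exact catalystStep_mem hP hp ⟨x, hx⟩ ⟨y, hy⟩

/-- For large Λ, pass from y*(x') to y through y*(x*) and y*(x), and bound each best-response drift
by a primal gap. Otherwise the diameter bound is already of the size of the noise. -/
theorem initial_term_le (hP : IsMinimaxProblem F gx gy X Q Y p.L p.μp p.μd)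
    (hp : p.Admissible e) {xs : E} (hxs : xs ∈ X) (hopt : primal F Y xs = primalOpt F X Y)
    {DY R : ℝ} (hDY : ∀ y ∈ Y, ∀ y' ∈ Y, ‖y - y'‖ ≤ DY) (hR : 0 ≤ R)
    (hΛ : 4000 * (p.K : ℝ) ^ 2 ≤ p.Λ e - 1 ∨ p.μd * DY ^ 2 / (p.Λ e - 1) ≤ R) (hK : 0 < p.K)
    {x x' : E} {y : G} (hx : x ∈ X) (hx' : x' ∈ X) (hy : y ∈ Y) :
    p.μd * (1 / (p.Λ e - 1)) * ‖bestResponse F Y x' - y‖ ^ 2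
      ≤ (6 * (primal F Y x' - primalOpt F X Y) + 6 * (primal F Y x - primalOpt F X Y)
          + 3 * p.μd * ‖bestResponse F Y x - y‖ ^ 2) / (4000 * (p.K : ℝ) ^ 2) + R := by
  have hX : X.Nonempty := ⟨xs, hxs⟩
  have hY : Y.Nonempty := ⟨y, hy⟩
  have hK' : (0 : ℝ) < p.K := by exact_mod_cast hK
  have hd := hP.bestResponse_dist_le hX hY hp.L_pos.le hp.μp_pos.le hp.μd_pos hxs hopt hx
  have hd' := hP.bestResponse_dist_le hX hY hp.L_pos.le hp.μp_pos.le hp.μd_pos hxs hopt hx'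
  have hμ := hp.μd_pos
  have hΛ1 : 0 < p.Λ e - 1 := by linarith [hp.one_lt_Λ]
  have htri : ‖bestResponse F Y x' - y‖ ^ 2
      ≤ 3 * (‖bestResponse F Y x' - bestResponse F Y xs‖ ^ 2 + ‖bestResponse F Y x - y‖ ^ 2
        + ‖bestResponse F Y x - bestResponse F Y xs‖ ^ 2) := by
    have := norm_sub_add_sub_sq_le (bestResponse F Y x' - bestResponse F Y xs)
      (bestResponse F Y x - y) (bestResponse F Y x - bestResponse F Y xs)
    have e : bestResponse F Y x' - bestResponse F Y xs + (bestResponse F Y x - y)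
      - (bestResponse F Y x - bestResponse F Y xs) = bestResponse F Y x' - y := by abel
    rwa [e] at this
  have hμtri := mul_le_mul_of_nonneg_left htri hμ.le
  have hnum : p.μd * ‖bestResponse F Y x' - y‖ ^ 2
      ≤ 6 * (primal F Y x' - primalOpt F X Y) + 6 * (primal F Y x - primalOpt F X Y)
          + 3 * p.μd * ‖bestResponse F Y x - y‖ ^ 2 := by linarith
  have hnn : 0 ≤ p.μd * ‖bestResponse F Y x' - y‖ ^ 2 := by positivity
  have heq : p.μd * (1 / (p.Λ e - 1)) * ‖bestResponse F Y x' - y‖ ^ 2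
      = p.μd * ‖bestResponse F Y x' - y‖ ^ 2 / (p.Λ e - 1) := by ring
  rw [heq]
  rcases hΛ with hΛ | hΛ
  · have h1 := div_le_div₀ (hnn.trans hnum) hnum (by positivity) hΛ
    linarith
  · have h1 : p.μd * ‖bestResponse F Y x' - y‖ ^ 2 / (p.Λ e - 1)
        ≤ p.μd * DY ^ 2 / (p.Λ e - 1) := by
      gcongr
      exact hDY _ (hP.bestResponse_mem hY hx') _ hy
    have h2 : 0 ≤ (6 * (primal F Y x' - primalOpt F X Y) + 6 * (primal F Y x - primalOpt F X Y)
          + 3 * p.μd * ‖bestResponse F Y x - y‖ ^ 2) / (4000 * (p.K : ℝ) ^ 2) :=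
      div_nonneg (hnn.trans hnum) (by positivity)
    linarith

/-- One epoch of R-Catalyst-Minimax(SREG), for every realization of the samples. -/
theorem epoch_le (hP : IsMinimaxProblem F gx gy X Q Y p.L p.μp p.μd)
    (hp : p.Admissible e) {xs : E} (hxs : xs ∈ X) (hopt : primal F Y xs = primalOpt F X Y)
    {DY R : ℝ} (hDY : ∀ y ∈ Y, ∀ y' ∈ Y, ‖y - y'‖ ≤ DY) (hR : 0 ≤ R)
    (hΛ : 4000 * (p.K : ℝ) ^ 2 ≤ p.Λ e - 1 ∨ p.μd * DY ^ 2 / (p.Λ e - 1) ≤ R)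
    (hρ : p.Λ e / (p.Λ e - 1) ≤ 2.6) (hK : 24 ≤ p.K) (hKμ : 576 * (p.μd / p.μp) ≤ (p.K : ℝ) ^ 2)
    {x : E} {y : G} (hx : x ∈ X) (hy : y ∈ Y) {c : ℕ} :
    let st := catalystIter p X Q Y g s e x y c
    potential F X Y (p.μd / 6) (st p.K).xtil (st p.K).y
      ≤ 1 / 50 * potential F X Y (p.μd / 12) x y
        + 2 / (p.K : ℝ) ^ 2 * ∑ k ∈ Finset.range p.K, ((k : ℝ) + 2) * ((k : ℝ) + 3) *
          (R / 4 + catalystNoise p X Q Y g (oracleError g gx gy) s xs e (k + 1) (st k)) := by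
  intro st
  have hX : X.Nonempty := ⟨xs, hxs⟩
  have hY : Y.Nonempty := ⟨y, hy⟩
  have hμ := hp.μd_pos
  have hK' : (24 : ℝ) ≤ p.K := by exact_mod_cast hK
  have hΛ1 : 0 < p.Λ e - 1 := by linarith [hp.one_lt_Λ]
  set ρ : ℝ := p.Λ e / (p.Λ e - 1) with hρdef
  have hρ1 : 1 ≤ ρ := by rw [hρdef, le_div_iff₀ hΛ1]; linarith
  have hmem : ∀ k, (st k).xtil ∈ X ∧ (st k).y ∈ Y := catalystIter_mem hP hp hx hy
  have hlow : ∀ x ∈ X, primalOpt F X Y ≤ primal F Y x := by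
    obtain ⟨-, -, -, h⟩ := hP.exists_minimizer hX hY hp.L_pos.le hp.μp_pos.le
    exact h
  set a : ℕ → ℝ := fun k => primal F Y (st k).xtil - primalOpt F X Y with ha
  set b : ℕ → ℝ := fun k => 1 / 2 * ‖xs - (st k).xbar‖ ^ 2 with hb
  set w : ℕ → ℝ := fun k => ‖bestResponse F Y (st k).xtil - (st k).y‖ ^ 2 with hw
  set N : ℕ → ℝ := fun k =>
    catalystNoise p X Q Y g (oracleError g gx gy) s xs e (k + 1) (st k) with hN
  have ha0 : ∀ k, 0 ≤ a k := fun k => sub_nonneg.2 (hlow _ (hmem k).1)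
  have hw0 : ∀ k, 0 ≤ w k := fun k => sq_nonneg _
  -- The potential after n iterations is the right side of `potential_step` at k = n + 1; at n = 0
  -- its coefficients are 1, ρ μd and μd/6.
  have hV : ∀ n ≤ p.K, (((n : ℝ) + 1) * (n + 2) - 1) * a n + ρ * p.μd * b n
      + ((n : ℝ) + 1) * (n + 2) / 12 * p.μd * w n
      ≤ a 0 + ρ * p.μd * b 0 + 1 / 6 * p.μd * w 0
        + ∑ k ∈ Finset.range n, ((k : ℝ) + 2) * ((k : ℝ) + 3) * (R / 4 + N k) := by
    intro n
    induction n with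
    | zero =>
      intro _
      simp only [Nat.cast_zero, Finset.range_zero, Finset.sum_empty]
      linarith
    | succ n ih =>
      intro hn
      have hih := ih (by omega)
      have hstep := catalystStep_le (g := g) (s := s) (k := n + 1) hP hp hxs hopt (by omega)
        (hmem n).1 (hmem n).2
      have hinit := initial_term_le hP hp hxs hopt hDY hR hΛ (by omega) (hmem n).1
        (hmem (n + 1)).1 (hmem n).2
      have hα : p.α e (n + 1) = ρ * p.β (n + 1) := by unfold Params.α; rw [hρdef]; ring
      have hps := potential_step (k := ((n + 1 : ℕ) : ℝ)) (K := p.K) (μd := p.μd) (ρ := ρ)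
        (β := p.β (n + 1)) (γ := gam (n + 1)) (c := 1 / (p.Λ e - 1)) (a := a n) (b := b n)
        (y := w n) (a' := a (n + 1)) (b' := b (n + 1)) (y' := w (n + 1))
        (d := ‖bestResponse F Y (st (n + 1)).xtil - (st n).y‖ ^ 2) (N := N n) (R := R)
        (by push_cast; linarith [(Nat.cast_nonneg n : (0 : ℝ) ≤ n)])
        (by exact_mod_cast hn) hK' hμ hρ1 rfl rfl (by positivity) (ha0 _) (ha0 _) (hw0 _) (hw0 _)
        (sq_nonneg _) (by
          simp only [hα] at hstep
          rw [mul_one_div]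
          exact hstep) hinit
      rw [Finset.sum_range_succ]
      push_cast at hps ⊢
      have e1 : (n : ℝ) + 1 + 1 = n + 2 := by ring
      have e2 : (n : ℝ) + 1 + 2 = n + 3 := by ring
      rw [e1, e2] at hps ⊢
      have e3 : ((n : ℝ) + 1) * (n + 2) = (n + 1) * (n + 2) := rfl
      linarith
  have hfin := hV p.K le_rfl
  set W := ∑ k ∈ Finset.range p.K, ((k : ℝ) + 2) * ((k : ℝ) + 3) * (R / 4 + N k)
  have hpot0 : potential F X Y (p.μd / 12) x y = a 0 + p.μd / 12 * w 0 := rfl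
  have hpotK : potential F X Y (p.μd / 6) (st p.K).xtil (st p.K).y
    = a p.K + p.μd / 6 * w p.K := rfl
  -- This is where the epoch length is used: the initial distance costs μd/μp times the gap, and 576
  -- μd/μp ≤ K².
  have hb0 : ρ * p.μd * b 0 ≤ 2.6 / 576 * (p.K : ℝ) ^ 2 * a 0 := by
    have h1 := hP.quadratic_growth_x hX hY hp.L_pos.le hp.μp_pos.le hμ hxs hopt hx
    have h2 : p.μp * b 0 ≤ a 0 := by
      have e : b 0 = 1 / 2 * ‖x - xs‖ ^ 2 := by simp only [hb]; rw [norm_sub_rev]; rfl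
      rw [e]
      change _ ≤ primal F Y x - primalOpt F X Y
      linarith
    have hμp := hp.μp_pos
    have h3 : p.μd * b 0 ≤ p.μd / p.μp * a 0 := by
      rw [div_mul_eq_mul_div, le_div_iff₀ hμp]
      nlinarith
    have hb0 : 0 ≤ b 0 := by positivity
    have h4 : ρ * (p.μd * b 0) ≤ 2.6 * (p.μd / p.μp * a 0) :=
      mul_le_mul hρ h3 (by positivity) (by norm_num)
    have h5 := mul_le_mul_of_nonneg_right hKμ (ha0 0)
    linarith
  have hbK : 0 ≤ ρ * p.μd * b p.K := by positivity
  have hK2 : 576 ≤ (p.K : ℝ) ^ 2 := by nlinarith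
  have h1 : (p.K : ℝ) ^ 2 * a p.K ≤ (((p.K : ℝ) + 1) * (p.K + 2) - 1) * a p.K :=
    mul_le_mul_of_nonneg_right (by nlinarith) (ha0 _)
  have h2 : (p.K : ℝ) ^ 2 / 12 * (p.μd * w p.K)
      ≤ ((p.K : ℝ) + 1) * (p.K + 2) / 12 * (p.μd * w p.K) :=
    mul_le_mul_of_nonneg_right (by nlinarith) (mul_nonneg hμ.le (hw0 _))
  have h3 := mul_le_mul_of_nonneg_right hK2 (ha0 0)
  have h4 := mul_le_mul_of_nonneg_right hK2 (mul_nonneg hμ.le (hw0 0))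
  have h5 : 0 ≤ (p.K : ℝ) ^ 2 * a p.K := mul_nonneg (sq_nonneg _) (ha0 _)
  have h6 : 0 ≤ (p.K : ℝ) ^ 2 * a 0 := mul_nonneg (sq_nonneg _) (ha0 _)
  have h7 : 0 ≤ (p.K : ℝ) ^ 2 * (p.μd * w 0) :=
    mul_nonneg (sq_nonneg _) (mul_nonneg hμ.le (hw0 0))
  -- The y-coefficient K²/12 forces a factor 2. On the gap this leaves (2 + 5.2)/576 < 1/50, and on
  -- the y-term (1/3)/576 < 1/600.
  have hmain : (p.K : ℝ) ^ 2 * (a p.K + p.μd / 6 * w p.K)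
      ≤ (p.K : ℝ) ^ 2 * (1 / 50 * (a 0 + p.μd / 12 * w 0)) + 2 * W := by
    linarith
  rw [hpot0, hpotK]
  have hKpos : 0 < (p.K : ℝ) ^ 2 := by positivity
  refine le_of_mul_le_mul_left (hmain.trans (le_of_eq ?_)) hKpos
  field_simp

end Outer

/-! ### The filtration of the samples -/

section Past

variable {Ω Ξ : Type*} [MeasurableSpace Ξ]

/-- The information contained in the first `j` samples. -/
abbrev past (ξ : ℕ → Ω → Ξ) (j : ℕ) : MeasurableSpace Ω :=
  ⨆ i ∈ Set.Iio j, MeasurableSpace.comap (ξ i) inferInstance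

theorem past_mono (ξ : ℕ → Ω → Ξ) : Monotone (past ξ) := fun _ _ hij =>
  biSup_mono fun _ h => lt_of_lt_of_le h hij

theorem measurable_past (ξ : ℕ → Ω → Ξ) {i j : ℕ} (hij : i < j) : Measurable[past ξ j] (ξ i) :=
  Measurable.mono (comap_measurable (ξ i))
    (le_biSup (fun i => MeasurableSpace.comap (ξ i) inferInstance) (Set.mem_Iio.2 hij)) le_rfl

variable [MeasurableSpace Ω] {P : Measure Ω}

theorem past_le {ξ : ℕ → Ω → Ξ} (hξ : ∀ i, Measurable (ξ i)) (j : ℕ) : past ξ j ≤ ‹_› :=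
  iSup₂_le fun i _ => (hξ i).comap_le

theorem indepFun_of_measurable_past {ξ : ℕ → Ω → Ξ} (hξ : ∀ i, Measurable (ξ i))
    (hind : iIndepFun ξ P) {j : ℕ} {V : Type*} [MeasurableSpace V] {U : Ω → V}
    (hU : Measurable[past ξ j] U) : IndepFun U (ξ j) P := by
  have h := indep_iSup_of_disjoint (fun i => (hξ i).comap_le) hind
    (S := Set.Iio j) (T := {j}) (by simp)
  rw [iSup_singleton] at h
  rw [IndepFun_iff_Indep]
  exact indep_of_indep_of_le_left h hU.comap_le

end Past

/-! ### Moments of the oracle error at random query points -/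

section Oracle

variable {E G Ξ Ω : Type*} [NormedAddCommGroup E] [InnerProductSpace ℝ E] [CompleteSpace E]
  [NormedAddCommGroup G] [InnerProductSpace ℝ G] [CompleteSpace G]
  [MeasurableSpace E] [BorelSpace E] [SecondCountableTopology E]
  [MeasurableSpace G] [BorelSpace G] [SecondCountableTopology G]
  [MeasurableSpace Ξ] [MeasurableSpace Ω]
  {F : E → G → ℝ} {gx : E → G → E} {gy : E → G → G} {X Q : Set E} {Y : Set G}
  {g : E → G → Ξ → E × G} {ν : Measure Ξ} {σ : ℝ}

theorem IsSFO.measurable_mean_x [SFinite ν] (hO : IsSFO g gx gy Q Y ν σ) :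
    Measurable fun p : E × G => ∫ ξ, (g p.1 p.2 ξ).1 ∂ν := by
  have h : Measurable fun p : (E × G) × Ξ => (g p.1.1 p.1.2 p.2).1 :=
    (hO.measurable.comp ((measurable_fst.comp measurable_fst).prodMk
      ((measurable_snd.comp measurable_fst).prodMk measurable_snd))).fst
  exact (h.stronglyMeasurable.integral_prod_right' (ν := ν)).measurable

theorem IsSFO.measurable_mean_y [SFinite ν] (hO : IsSFO g gx gy Q Y ν σ) :
    Measurable fun p : E × G => ∫ ξ, (g p.1 p.2 ξ).2 ∂ν := by
  have h : Measurable fun p : (E × G) × Ξ => (g p.1.1 p.1.2 p.2).2 :=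
    (hO.measurable.comp ((measurable_fst.comp measurable_fst).prodMk
      ((measurable_snd.comp measurable_fst).prodMk measurable_snd))).snd
  exact (h.stronglyMeasurable.integral_prod_right' (ν := ν)).measurable

theorem IsSFO.congr (hO : IsSFO g gx gy Q Y ν σ) {gx' : E → G → E} {gy' : E → G → G}
    (hx : ∀ x ∈ Q, ∀ y ∈ Y, gx' x y = gx x y) (hy : ∀ x ∈ Q, ∀ y ∈ Y, gy' x y = gy x y) :
    IsSFO g gx' gy' Q Y ν σ where
  measurable := hO.measurable
  integrable_x := hO.integrable_x
  integrable_y := hO.integrable_y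
  unbiased_x x h y h' := by rw [hx x h y h']; exact hO.unbiased_x x h y h'
  unbiased_y x h y h' := by rw [hy x h y h']; exact hO.unbiased_y x h y h'
  variance x h y h' := by rw [hx x h y h', hy x h y h']; exact hO.variance x h y h'

theorem measurable_oracleError (hO : IsSFO g gx gy Q Y ν σ)
    (hgx : Measurable fun p : E × G => gx p.1 p.2) (hgy : Measurable fun p : E × G => gy p.1 p.2) :
    Measurable fun p : (E × G) × Ξ => oracleError g gx gy p.1.1 p.1.2 p.2 := by
  have h : Measurable fun p : (E × G) × Ξ => g p.1.1 p.1.2 p.2 :=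
    hO.measurable.comp ((measurable_fst.comp measurable_fst).prodMk
      ((measurable_snd.comp measurable_fst).prodMk measurable_snd))
  exact h.sub ((hgx.comp measurable_fst).prodMk (hgy.comp measurable_fst))

variable {P : Measure Ω} [IsProbabilityMeasure P] [IsProbabilityMeasure ν]

/-- Independence makes the joint law of query point and sample a product, so the variance bound
applies with the query point frozen. -/
theorem IsSFO.integral_error_sq_le (hO : IsSFO g gx gy Q Y ν σ)
    (hgx : Measurable fun p : E × G => gx p.1 p.2) (hgy : Measurable fun p : E × G => gy p.1 p.2)
    {U : Ω → E × G} (hU : Measurable U) (hmem : ∀ ω, (U ω).1 ∈ Q ∧ (U ω).2 ∈ Y) {ζ : Ω → Ξ}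
    (hζ : Measurable ζ) (hmap : P.map ζ = ν) (hind : IndepFun U ζ P) :
    let er := fun ω => oracleError g gx gy (U ω).1 (U ω).2 (ζ ω)
    Integrable (fun ω => ‖(er ω).1‖ ^ 2 + ‖(er ω).2‖ ^ 2) P ∧
      ∫ ω, (‖(er ω).1‖ ^ 2 + ‖(er ω).2‖ ^ 2) ∂P ≤ σ ^ 2 := by
  intro er
  have hm := measurable_oracleError hO hgx hgy
  have hφ : Measurable fun p : (E × G) × Ξ => ‖(oracleError g gx gy p.1.1 p.1.2 p.2).1‖ ^ 2
      + ‖(oracleError g gx gy p.1.1 p.1.2 p.2).2‖ ^ 2 :=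
    (hm.fst.norm.pow_const 2).add (hm.snd.norm.pow_const 2)
  have hpair : Measurable fun ω => (U ω, ζ ω) := hU.prodMk hζ
  have hlaw : P.map (fun ω => (U ω, ζ ω)) = (P.map U).prod ν := by
    rw [← hmap]
    exact (indepFun_iff_map_prod_eq_prod_map_map hU.aemeasurable hζ.aemeasurable).1 hind
  have hmeas : Measurable fun ω => ‖(er ω).1‖ ^ 2 + ‖(er ω).2‖ ^ 2 := hφ.comp hpair
  have hlint : ∫⁻ ω, ENNReal.ofReal (‖(er ω).1‖ ^ 2 + ‖(er ω).2‖ ^ 2) ∂P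
      ≤ ENNReal.ofReal (σ ^ 2) := by
    have h1 : ∫⁻ ω, ENNReal.ofReal (‖(er ω).1‖ ^ 2 + ‖(er ω).2‖ ^ 2) ∂P
        = ∫⁻ p, ENNReal.ofReal (‖(oracleError g gx gy p.1.1 p.1.2 p.2).1‖ ^ 2
            + ‖(oracleError g gx gy p.1.1 p.1.2 p.2).2‖ ^ 2)
            ∂(P.map (fun ω => (U ω, ζ ω))) :=
      (lintegral_map hφ.ennreal_ofReal hpair).symm
    have hφ' : Measurable fun p : (E × G) × Ξ =>
      ENNReal.ofReal (‖(oracleError g gx gy p.1.1 p.1.2 p.2).1‖ ^ 2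
            + ‖(oracleError g gx gy p.1.1 p.1.2 p.2).2‖ ^ 2) := hφ.ennreal_ofReal
    rw [h1, hlaw, lintegral_prod _ hφ'.aemeasurable, lintegral_map hφ'.lintegral_prod_right' hU]
    calc _ ≤ ∫⁻ _, ENNReal.ofReal (σ ^ 2) ∂P :=
          lintegral_mono fun ω => hO.variance _ (hmem ω).1 _ (hmem ω).2
      _ = _ := by simp
  have hnn : ∀ ω, 0 ≤ ‖(er ω).1‖ ^ 2 + ‖(er ω).2‖ ^ 2 := fun ω => by positivity
  refine ⟨⟨hmeas.aestronglyMeasurable, ?_⟩, ?_⟩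
  · rw [hasFiniteIntegral_iff_ofReal (Filter.Eventually.of_forall hnn)]
    exact hlint.trans_lt ENNReal.ofReal_lt_top
  · rw [integral_eq_lintegral_of_nonneg_ae (Filter.Eventually.of_forall hnn)
      hmeas.aestronglyMeasurable]
    exact ENNReal.toReal_le_of_le_ofReal (sq_nonneg _) hlint

/-- With the query point and the direction frozen, unbiasedness makes the inner integral vanish.
Boundedness of the direction supplies integrability. -/
theorem IsSFO.integral_inner_error (hO : IsSFO g gx gy Q Y ν σ)
    (hgx : Measurable fun p : E × G => gx p.1 p.2) (hgy : Measurable fun p : E × G => gy p.1 p.2)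
    {U W : Ω → E × G} (hU : Measurable U) (hW : Measurable W)
    (hmem : ∀ ω, (U ω).1 ∈ Q ∧ (U ω).2 ∈ Y) {B : ℝ} (hB : ∀ ω, ‖(W ω).1‖ ≤ B ∧ ‖(W ω).2‖ ≤ B)
    {ζ : Ω → Ξ} (hζ : Measurable ζ) (hmap : P.map ζ = ν)
    (hind : IndepFun (fun ω => (U ω, W ω)) ζ P) :
    let er := fun ω => oracleError g gx gy (U ω).1 (U ω).2 (ζ ω)
    Integrable (fun ω => inner ℝ (er ω).1 (W ω).1 + inner ℝ (er ω).2 (W ω).2) P ∧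
      ∫ ω, (inner ℝ (er ω).1 (W ω).1 + inner ℝ (er ω).2 (W ω).2) ∂P = 0 := by
  intro er
  have hm := measurable_oracleError hO hgx hgy
  have hsq := (hO.integral_error_sq_le hgx hgy hU hmem hζ hmap
    (hind.comp measurable_fst measurable_id)).1
  have hm' : Measurable fun p : ((E × G) × (E × G)) × Ξ =>
      oracleError g gx gy p.1.1.1 p.1.1.2 p.2 :=
    hm.comp ((measurable_fst.comp measurable_fst).prodMk measurable_snd)
  have hφ : Measurable fun p : ((E × G) × (E × G)) × Ξ =>
      inner ℝ (oracleError g gx gy p.1.1.1 p.1.1.2 p.2).1 p.1.2.1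
        + inner ℝ (oracleError g gx gy p.1.1.1 p.1.1.2 p.2).2 p.1.2.2 :=
    (hm'.fst.inner measurable_fst.snd.fst).add (hm'.snd.inner measurable_fst.snd.snd)
  have hUW : Measurable fun ω => (U ω, W ω) := hU.prodMk hW
  have hpair : Measurable fun ω => ((U ω, W ω), ζ ω) := hUW.prodMk hζ
  have hlaw : P.map (fun ω => ((U ω, W ω), ζ ω)) = (P.map fun ω => (U ω, W ω)).prod ν := by
    rw [← hmap]
    exact (indepFun_iff_map_prod_eq_prod_map_map hUW.aemeasurable hζ.aemeasurable).1 hind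
  have hint : Integrable (fun ω => inner ℝ (er ω).1 (W ω).1 + inner ℝ (er ω).2 (W ω).2) P := by
    refine Integrable.mono' ((hsq.add (integrable_const 1)).const_mul (2 * |B|))
      (hφ.comp hpair).aestronglyMeasurable (Filter.Eventually.of_forall fun ω => ?_)
    have h1 := norm_inner_le_norm (𝕜 := ℝ) (er ω).1 (W ω).1
    have h2 := norm_inner_le_norm (𝕜 := ℝ) (er ω).2 (W ω).2
    have h3 := norm_add_le (inner ℝ (er ω).1 (W ω).1) (inner ℝ (er ω).2 (W ω).2)
    have hB1 := (hB ω).1.trans (le_abs_self B)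
    have hB2 := (hB ω).2.trans (le_abs_self B)
    have h4 := mul_le_mul_of_nonneg_left hB1 (norm_nonneg (er ω).1)
    have h5 := mul_le_mul_of_nonneg_left hB2 (norm_nonneg (er ω).2)
    have h6 : ‖(er ω).1‖ + ‖(er ω).2‖ ≤ 2 * (‖(er ω).1‖ ^ 2 + ‖(er ω).2‖ ^ 2 + 1) := by
      nlinarith [sq_nonneg (‖(er ω).1‖ - 1), sq_nonneg (‖(er ω).2‖ - 1)]
    have h7 := mul_le_mul_of_nonneg_right h6 (abs_nonneg B)
    simp only [Pi.add_apply]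
    change _ ≤ 2 * |B| * (‖(er ω).1‖ ^ 2 + ‖(er ω).2‖ ^ 2 + 1)
    linarith
  refine ⟨hint, ?_⟩
  have h1 : ∫ ω, (inner ℝ (er ω).1 (W ω).1 + inner ℝ (er ω).2 (W ω).2) ∂P
      = ∫ p, (inner ℝ (oracleError g gx gy p.1.1.1 p.1.1.2 p.2).1 p.1.2.1
        + inner ℝ (oracleError g gx gy p.1.1.1 p.1.1.2 p.2).2 p.1.2.2)
        ∂(P.map fun ω => ((U ω, W ω), ζ ω)) :=
    (integral_map hpair.aemeasurable hφ.aestronglyMeasurable).symm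
  have hint' := (integrable_map_measure hφ.aestronglyMeasurable hpair.aemeasurable).2 hint
  rw [hlaw] at hint'
  have hφ2 := hφ.stronglyMeasurable.integral_prod_right' (ν := ν)
  rw [h1, hlaw, integral_prod _ hint', integral_map hUW.aemeasurable hφ2.aestronglyMeasurable]
  refine integral_eq_zero_of_ae (Filter.Eventually.of_forall fun ω => ?_)
  have hx := hO.integrable_x _ (hmem ω).1 _ (hmem ω).2
  have hy := hO.integrable_y _ (hmem ω).1 _ (hmem ω).2
  have hx' : Integrable (fun ξ => (oracleError g gx gy (U ω).1 (U ω).2 ξ).1) ν :=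
    hx.sub (integrable_const _)
  have hy' : Integrable (fun ξ => (oracleError g gx gy (U ω).1 (U ω).2 ξ).2) ν :=
    hy.sub (integrable_const _)
  have ix : ∫ ξ, (oracleError g gx gy (U ω).1 (U ω).2 ξ).1 ∂ν = 0 := by
    simp only [oracleError, Prod.fst_sub]
    rw [integral_sub hx (integrable_const _), hO.unbiased_x _ (hmem ω).1 _ (hmem ω).2]
    simp
  have iy : ∫ ξ, (oracleError g gx gy (U ω).1 (U ω).2 ξ).2 ∂ν = 0 := by
    simp only [oracleError, Prod.snd_sub]
    rw [integral_sub hy (integrable_const _), hO.unbiased_y _ (hmem ω).1 _ (hmem ω).2]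
    simp
  simp only [Pi.zero_apply]
  rw [integral_add (hx'.inner_const _) (hy'.inner_const _)]
  simp only [real_inner_comm _ (oracleError _ _ _ _ _ _).1,
    real_inner_comm _ (oracleError _ _ _ _ _ _).2]
  rw [integral_inner hx', integral_inner hy', ix, iy]
  simp

end Oracle

/-! ### Measurability of the inner iterates -/

section Measurability

variable {E G Ξ Ω : Type*} [NormedAddCommGroup E] [InnerProductSpace ℝ E] [CompleteSpace E]
  [NormedAddCommGroup G] [InnerProductSpace ℝ G] [CompleteSpace G]
  [MeasurableSpace E] [BorelSpace E] [SecondCountableTopology E]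
  [MeasurableSpace G] [BorelSpace G] [SecondCountableTopology G]
  [MeasurableSpace Ξ]
  {F : E → G → ℝ} {Φ : Ω → E → G → ℝ} {X Q : Set E} {Y : Set G}
  {g : E → G → Ξ → E × G} {μX μY η M β : ℝ}

theorem measurable_sregMidStep {m : MeasurableSpace Ω} (hXc : IsClosed X) (hX : Convex ℝ X)
    (hXne : X.Nonempty) (hYc : IsClosed Y) (hY : Convex ℝ Y) (hYne : Y.Nonempty) (hη : 0 ≤ η)
    {v z : Ω → E × G} (hv : Measurable v) (hz : Measurable z) :
    Measurable fun ω => sregMidStep X Y η (v ω) (z ω) := by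
  simp only [sregMidStep_eq hXc hX hXne hYc hY hYne hη]
  exact ((continuous_nearest hXc hX hXne).measurable.comp (hz.fst.sub (hv.fst.const_smul η))).prodMk
    ((continuous_nearest hYc hY hYne).measurable.comp (hz.snd.add (hv.snd.const_smul η)))

theorem measurable_sregNextStep {m : MeasurableSpace Ω} (hXc : IsClosed X) (hX : Convex ℝ X)
    (hXne : X.Nonempty) (hYc : IsClosed Y) (hY : Convex ℝ Y) (hYne : Y.Nonempty)
    (hμX : 0 ≤ μX) (hμY : 0 ≤ μY) (hη : 0 ≤ η)
    {v zh z : Ω → E × G} (hv : Measurable v) (hzh : Measurable zh) (hz : Measurable z) :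
    Measurable fun ω => sregNextStep X Y μX μY η (v ω) (zh ω) (z ω) := by
  simp only [sregNextStep_eq hXc hX hXne hYc hY hYne hμX hμY hη]
  exact ((continuous_nearest hXc hX hXne).measurable.comp
      (((hz.fst.add (hzh.fst.const_smul _)).sub (hv.fst.const_smul η)).const_smul _)).prodMk
    ((continuous_nearest hYc hY hYne).measurable.comp
      (((hz.snd.add (hzh.snd.const_smul _)).add (hv.snd.const_smul η)).const_smul _))

theorem measurable_proxOracle {m : MeasurableSpace Ω}
    (hg : Measurable fun p : E × G × Ξ => g p.1 p.2.1 p.2.2) {xhat : Ω → E} {z : Ω → E × G}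
    {ζ : Ω → Ξ} (hxhat : Measurable xhat) (hz : Measurable z) (hζ : Measurable ζ) :
    Measurable fun ω => proxOracle g β (xhat ω) (z ω).1 (z ω).2 (ζ ω) := by
  have h : Measurable fun ω => g (z ω).1 (z ω).2 (ζ ω) :=
    hg.comp (hz.fst.prodMk (hz.snd.prodMk hζ))
  exact (h.fst.add ((hz.fst.sub hxhat).const_smul β)).prodMk h.snd

variable {m : ℕ → MeasurableSpace Ω} {s : Ω → ℕ → Ξ} {xhat : Ω → E} {z₀ : Ω → E × G}

/-- In the filtration `m`, the iterate z_t has seen 2t samples and the midpoint 2t + 1, so the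
second query of step t is made before its own sample is revealed. -/
theorem measurable_sregMid_of_iter (hXc : IsClosed X) (hX : Convex ℝ X)
    (hXne : X.Nonempty) (hYc : IsClosed Y) (hY : Convex ℝ Y) (hYne : Y.Nonempty) (hη : 0 ≤ η)
    (hg : Measurable fun p : E × G × Ξ => g p.1 p.2.1 p.2.2) (hm : Monotone m)
    (hs : ∀ i, Measurable[m (i + 1)] fun ω => s ω i) (hxhat : Measurable[m 0] xhat) {t : ℕ}
    (ht : Measurable[m (2 * t)] fun ω =>
      sregIter X Y (proxOracle g β (xhat ω)) μX μY (fun _ => η) (s ω) (z₀ ω) t) :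
    Measurable[m (2 * t + 1)] fun ω =>
      sregMid X Y (proxOracle g β (xhat ω)) μX μY (fun _ => η) (s ω) (z₀ ω) t := by
  have ht' := ht.mono (hm (Nat.le_succ _)) le_rfl
  have hx' := hxhat.mono (hm (Nat.zero_le (2 * t + 1))) le_rfl
  exact measurable_sregMidStep hXc hX hXne hYc hY hYne hη
    (measurable_proxOracle hg hx' ht' (hs (2 * t))) ht'

theorem measurable_sregIter (hXc : IsClosed X) (hX : Convex ℝ X)
    (hXne : X.Nonempty) (hYc : IsClosed Y) (hY : Convex ℝ Y) (hYne : Y.Nonempty)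
    (hμX : 0 ≤ μX) (hμY : 0 ≤ μY) (hη : 0 ≤ η)
    (hg : Measurable fun p : E × G × Ξ => g p.1 p.2.1 p.2.2) (hm : Monotone m)
    (hs : ∀ i, Measurable[m (i + 1)] fun ω => s ω i) (hxhat : Measurable[m 0] xhat)
    (hz₀ : Measurable[m 0] z₀) (t : ℕ) :
    Measurable[m (2 * t)] fun ω =>
      sregIter X Y (proxOracle g β (xhat ω)) μX μY (fun _ => η) (s ω) (z₀ ω) t := by
  induction t with
  | zero => exact hz₀
  | succ t ih =>
    have hmid := measurable_sregMid_of_iter hXc hX hXne hYc hY hYne hη hg hm hs hxhat ih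
    have hmid' := hmid.mono (hm (Nat.le_succ _)) le_rfl
    have hx' := hxhat.mono (hm (Nat.zero_le (2 * t + 1 + 1))) le_rfl
    have ht' := ih.mono (hm (by omega : 2 * t ≤ 2 * t + 1 + 1)) le_rfl
    exact measurable_sregNextStep hXc hX hXne hYc hY hYne hμX hμY hη
      (measurable_proxOracle hg hx' hmid' (hs (2 * t + 1))) hmid' ht'

/-- The ghost at time t uses errors of earlier steps only; this allows it to be paired with the
second error of step t. -/
theorem measurable_sregGhost (hXc : IsClosed X) (hX : Convex ℝ X)
    (hXne : X.Nonempty) (hYc : IsClosed Y) (hY : Convex ℝ Y) (hYne : Y.Nonempty)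
    (hμX : 0 ≤ μX) (hμY : 0 ≤ μY) (hη : 0 ≤ η)
    (hg : Measurable fun p : E × G × Ξ => g p.1 p.2.1 p.2.2) (hm : Monotone m)
    (hs : ∀ i, Measurable[m (i + 1)] fun ω => s ω i) (hxhat : Measurable[m 0] xhat)
    (hz₀ : Measurable[m 0] z₀) {er : E → G → Ξ → E × G}
    (her : Measurable fun p : (E × G) × Ξ => er p.1.1 p.1.2 p.2) (t : ℕ) :
    Measurable[m (2 * t)] fun ω =>
      sregGhost X Y (proxOracle g β (xhat ω)) er μX μY η (s ω) (z₀ ω) t := by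
  induction t with
  | zero => exact hz₀.snd
  | succ t ih =>
    have hit := measurable_sregIter (t := t) hXc hX hXne hYc hY hYne hμX hμY hη hg hm hs
      hxhat hz₀ (β := β)
    have hit' := measurable_sregIter (t := t + 1) hXc hX hXne hYc hY hYne hμX hμY hη hg hm hs
      hxhat hz₀ (β := β)
    have hmid := measurable_sregMid_of_iter hXc hX hXne hYc hY hYne hη hg hm hs hxhat hit
    have hmid' := hmid.mono (hm (Nat.le_succ _)) le_rfl
    have ht' := ih.mono (hm (by omega : 2 * t ≤ 2 * t + 1 + 1)) le_rfl
    have he := (her.comp (hmid'.prodMk (hs (2 * t + 1)))).snd.neg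
    exact (continuous_nearest hYc hY hYne).measurable.comp
      (((ht'.add (hit'.snd.const_smul (μX * η))).add (he.const_smul η)).const_smul _)

end Measurability

/-! ### Expected noise of one outer iteration -/

section Noise

variable {E G Ξ Ω : Type*} [NormedAddCommGroup E] [InnerProductSpace ℝ E] [CompleteSpace E]
  [NormedAddCommGroup G] [InnerProductSpace ℝ G] [CompleteSpace G]
  [MeasurableSpace E] [BorelSpace E] [SecondCountableTopology E]
  [MeasurableSpace G] [BorelSpace G] [SecondCountableTopology G]
  [MeasurableSpace Ξ] [MeasurableSpace Ω]
  {F : E → G → ℝ} {gx : E → G → E} {gy : E → G → G} {X Q : Set E} {Y : Set G}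
  {g : E → G → Ξ → E × G} {ν : Measure Ξ} {σ : ℝ} {P : Measure Ω} {ξ : ℕ → Ω → Ξ} {p : Params}
  {e k : ℕ}

/-- A random state reached after `c` oracle calls. -/
structure IsReachable (ξ : ℕ → Ω → Ξ) (X : Set E) (Y : Set G) (c : ℕ) (st : Ω → State E G) :
    Prop where
  measurable_xbar : Measurable[past ξ c] fun ω => (st ω).xbar
  measurable_xtil : Measurable[past ξ c] fun ω => (st ω).xtil
  measurable_y : Measurable[past ξ c] fun ω => (st ω).y
  xtil_mem : ∀ ω, (st ω).xtil ∈ X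
  y_mem : ∀ ω, (st ω).y ∈ Y
  calls_eq : ∀ ω, (st ω).calls = c

variable {c : ℕ} {st : Ω → State E G}

theorem IsReachable.measurable_proxCenter (h : IsReachable ξ X Y c st) (k : ℕ) :
    Measurable[past ξ c] fun ω => proxCenter k (st ω) :=
  (h.measurable_xbar.const_smul (gam k)).add (h.measurable_xtil.const_smul (1 - gam k))

theorem IsReachable.measurable_comparator (h : IsReachable ξ X Y c st) (xs : E) (k : ℕ) :
    Measurable[past ξ c] fun ω => comparator xs k (st ω) :=
  (measurable_const (a := gam k • xs)).add (h.measurable_xtil.const_smul (1 - gam k))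

theorem past_add_mono (ξ : ℕ → Ω → Ξ) (c : ℕ) : Monotone fun i => past ξ (c + i) :=
  fun _ _ hij => past_mono ξ (Nat.add_le_add_left hij c)

theorem measurable_sample (ξ : ℕ → Ω → Ξ) (c i : ℕ) :
    Measurable[past ξ (c + (i + 1))] fun ω => ξ (c + i) ω :=
  measurable_past ξ (by omega)

theorem IsReachable.step (hP : IsMinimaxProblem F gx gy X Q Y p.L p.μp p.μd)
    (hp : p.Admissible e) (hX : X.Nonempty) (hY : Y.Nonempty) (hO : IsSFO g gx gy Q Y ν σ)
    (h : IsReachable ξ X Y c st) :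
    IsReachable ξ X Y (c + 2 * p.T e)
      fun ω => catalystStep p X Q Y g (fun i => ξ i ω) e k (st ω) := by
  have hXc := hP.compact_X.isClosed
  have hYc := hP.compact_Y.isClosed
  have hβ := (hp.β_pos k).le
  have hη := (hp.η_pos k).le
  have hpc := h.measurable_proxCenter k
  have hz₀ : Measurable[past ξ (c + 0)] fun ω => (nearest Q (proxCenter k (st ω)), (st ω).y) :=
    ((continuous_nearest hP.closed_Q hP.convex_Q (hX.mono hP.X_subset_Q)).measurable.comp
      hpc).prodMk h.measurable_y
  have hit := fun t => measurable_sregIter (β := p.β k) (s := fun ω i => ξ (c + i) ω) hXc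
    hP.convex_X hX hYc hP.convex_Y hY hβ hp.μd_pos.le hη hO.measurable (past_add_mono ξ c)
    (measurable_sample ξ c) hpc hz₀ t
  have hmid := fun t => measurable_sregMid_of_iter hXc hP.convex_X hX hYc hP.convex_Y hY hη
    hO.measurable (past_add_mono ξ c) (measurable_sample ξ c) hpc (hit t)
  have hzT := hit (p.T e)
  have hzb : Measurable[past ξ (c + 2 * p.T e)] fun ω =>
      sregAverage X Y (proxOracle g (p.β k) (proxCenter k (st ω))) (p.β k) p.μd
        (fun _ => p.η e k) (fun i => ξ (c + i) ω)
        (nearest Q (proxCenter k (st ω)), (st ω).y) (p.T e) := by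
    unfold sregAverage
    have hsum : ∀ t ∈ Finset.range (p.T e), Measurable[past ξ (c + 2 * p.T e)] fun ω =>
        (p.η e k * sregWeight (p.β k) (fun _ => p.η e k) t) •
          sregMid X Y (proxOracle g (p.β k) (proxCenter k (st ω))) (p.β k) p.μd
          (fun _ => p.η e k) (fun i => ξ (c + i) ω)
          (nearest Q (proxCenter k (st ω)), (st ω).y) t := fun t ht =>
      ((hmid t).mono (past_add_mono ξ c
        (show 2 * t + 1 ≤ 2 * p.T e by have := Finset.mem_range.1 ht; omega))
        le_rfl).const_smul (p.η e k * sregWeight (p.β k) (fun _ => p.η e k) t)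
    exact (Finset.measurable_fun_sum _ hsum).const_smul
      (∑ t ∈ Finset.range (p.T e), p.η e k * sregWeight (p.β k) (fun _ => p.η e k) t)⁻¹
  have hxt := h.measurable_xtil.mono (past_mono ξ (Nat.le_add_right c (2 * p.T e))) le_rfl
  have hst : ∀ ω, catalystStep p X Q Y g (fun i => ξ i ω) e k (st ω) =
      { xbar := (p.α e k * gam k + p.μp * (1 - gam k))⁻¹ •
          (p.α e k • (sregIter X Y (proxOracle g (p.β k) (proxCenter k (st ω))) (p.β k) p.μd
            (fun _ => p.η e k) (fun i => ξ (c + i) ω)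
            (nearest Q (proxCenter k (st ω)), (st ω).y) (p.T e)).1
            + ((p.μp - p.α e k) * (1 - gam k)) • (st ω).xtil)
        xtil := (sregAverage X Y (proxOracle g (p.β k) (proxCenter k (st ω))) (p.β k) p.μd
          (fun _ => p.η e k) (fun i => ξ (c + i) ω)
          (nearest Q (proxCenter k (st ω)), (st ω).y) (p.T e)).1
        y := (sregIter X Y (proxOracle g (p.β k) (proxCenter k (st ω))) (p.β k) p.μd
            (fun _ => p.η e k) (fun i => ξ (c + i) ω)
            (nearest Q (proxCenter k (st ω)), (st ω).y) (p.T e)).2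
        calls := c + 2 * p.T e } := by
    intro ω
    rw [← h.calls_eq ω]
    rfl
  have hmem : ∀ ω, _ := fun ω => catalystStep_mem (g := g) (s := fun i => ξ i ω) (k := k)
    (st := st ω) hP hp hX hY
  refine ⟨?_, ?_, ?_, fun ω => (hmem ω).1, fun ω => (hmem ω).2, fun ω => ?_⟩
  · simp only [hst]
    exact ((hzT.fst.const_smul _).add (hxt.const_smul _)).const_smul _
  · simp only [hst]
    exact hzb.fst
  · simp only [hst]
    exact hzT.snd
  · simp only [hst]

/-- Each step contributes zero from the inner products and at most 2η(σ² + σ²) from the squares; a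
weighted average preserves the bound. -/
theorem integral_catalystNoise_le [IsProbabilityMeasure P] [IsProbabilityMeasure ν]
    (hP : IsMinimaxProblem F gx gy X Q Y p.L p.μp p.μd)
    (hp : p.Admissible e) (hO : IsSFO g gx gy Q Y ν σ)
    (hgx : Measurable fun p : E × G => gx p.1 p.2) (hgy : Measurable fun p : E × G => gy p.1 p.2)
    (hξ : ∀ i, Measurable (ξ i)) (hind : iIndepFun ξ P) (hmap : ∀ i, P.map (ξ i) = ν)
    {xs : E} (hxs : xs ∈ X) (hY : Y.Nonempty) (hk : 1 ≤ k) (h : IsReachable ξ X Y c st) :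
    Integrable (fun ω => catalystNoise p X Q Y g (oracleError g gx gy) (fun i => ξ i ω) xs e k
        (st ω)) P ∧
      ∫ ω, catalystNoise p X Q Y g (oracleError g gx gy) (fun i => ξ i ω) xs e k (st ω) ∂P
        ≤ 4 * p.η e k * σ ^ 2 := by
  have hX : X.Nonempty := ⟨xs, hxs⟩
  have hXc := hP.compact_X.isClosed
  have hYc := hP.compact_Y.isClosed
  have hβ := (hp.β_pos k).le
  have hη := hp.η_pos k
  have hpc := h.measurable_proxCenter k
  have hQne := hX.mono hP.X_subset_Q
  have hz₀ : Measurable[past ξ (c + 0)] fun ω => (nearest Q (proxCenter k (st ω)), (st ω).y) :=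
    ((continuous_nearest hP.closed_Q hP.convex_Q hQne).measurable.comp
      hpc).prodMk h.measurable_y
  have her := measurable_oracleError hO hgx hgy
  set z : ℕ → Ω → E × G := fun t ω =>
    sregIter X Y (proxOracle g (p.β k) (proxCenter k (st ω))) (p.β k) p.μd (fun _ => p.η e k)
      (fun i => ξ (c + i) ω) (nearest Q (proxCenter k (st ω)), (st ω).y) t with hz
  set zh : ℕ → Ω → E × G := fun t ω =>
    sregMid X Y (proxOracle g (p.β k) (proxCenter k (st ω))) (p.β k) p.μd (fun _ => p.η e k)
      (fun i => ξ (c + i) ω) (nearest Q (proxCenter k (st ω)), (st ω).y) t with hzh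
  set v : ℕ → Ω → G := fun t ω =>
    sregGhost X Y (proxOracle g (p.β k) (proxCenter k (st ω))) (oracleError g gx gy) (p.β k) p.μd
      (p.η e k) (fun i => ξ (c + i) ω) (nearest Q (proxCenter k (st ω)), (st ω).y) t with hv
  have hit : ∀ t, Measurable[past ξ (c + 2 * t)] (z t) := fun t =>
    measurable_sregIter (s := fun ω i => ξ (c + i) ω) hXc
      hP.convex_X hX hYc hP.convex_Y hY hβ hp.μd_pos.le hη.le hO.measurable (past_add_mono ξ c)
      (measurable_sample ξ c) hpc hz₀ t
  have hmid : ∀ t, Measurable[past ξ (c + (2 * t + 1))] (zh t) := fun t =>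
    measurable_sregMid_of_iter hXc hP.convex_X hX hYc hP.convex_Y hY hη.le
      hO.measurable (past_add_mono ξ c) (measurable_sample ξ c) hpc (hit t)
  have hgh : ∀ t, Measurable[past ξ (c + 2 * t)] (v t) := fun t =>
    measurable_sregGhost (s := fun ω i => ξ (c + i) ω) hXc
      hP.convex_X hX hYc hP.convex_Y hY hβ hp.μd_pos.le hη.le hO.measurable (past_add_mono ξ c)
      (measurable_sample ξ c) hpc hz₀ her t
  have hS := fun ω => hP.isSaddle_prox hp.L_pos.le hp.μp_pos.le (β := p.β k) (proxCenter k (st ω))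
  have hz_mem : ∀ t ω, (z t ω).1 ∈ Q ∧ (z t ω).2 ∈ Y := fun t ω =>
    sregIter_mem (hS ω) hX hY hβ hp.μd_pos.le hη.le
      (nearest_spec hP.closed_Q hP.convex_Q hQne _).1 (h.y_mem ω) t
  have hzh_mem : ∀ t ω, zh t ω ∈ X ×ˢ Y := fun t ω => sregMid_mem (hS ω) hX hY hη.le t
  have hv_mem : ∀ t ω, v t ω ∈ Y := fun t ω => sregGhost_mem (hS ω) (h.y_mem ω) t
  have hcmp_mem : ∀ ω, comparator xs k (st ω) ∈ X := fun ω =>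
    hP.convex_X hxs (h.xtil_mem ω) (gam_pos k).le (by linarith [gam_le_one hk]) (by ring)
  obtain ⟨A, hA⟩ := hP.compact_X.isBounded.exists_norm_le
  obtain ⟨B, hB⟩ := hP.compact_Y.isBounded.exists_norm_le
  have hle : ∀ j, past ξ j ≤ ‹MeasurableSpace Ω› := past_le hξ
  have hn : ∀ t, Integrable (fun ω => sregStepNoise X Y
        (proxOracle g (p.β k) (proxCenter k (st ω))) (oracleError g gx gy) (p.β k) p.μd (p.η e k)
        (fun i => ξ (c + i) ω) (nearest Q (proxCenter k (st ω)), (st ω).y)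
        (comparator xs k (st ω)) t) P ∧
      ∫ ω, sregStepNoise X Y
        (proxOracle g (p.β k) (proxCenter k (st ω))) (oracleError g gx gy) (p.β k) p.μd (p.η e k)
        (fun i => ξ (c + i) ω) (nearest Q (proxCenter k (st ω)), (st ω).y)
        (comparator xs k (st ω)) t ∂P ≤ 4 * p.η e k * σ ^ 2 := by
    intro t
    have h1 := hO.integral_error_sq_le hgx hgy ((hit t).mono (hle _) le_rfl) (hz_mem t)
      (hξ _) (hmap _) (indepFun_of_measurable_past hξ hind (hit t))
    have h2 := hO.integral_error_sq_le hgx hgy ((hmid t).mono (hle _) le_rfl)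
      (fun ω => ⟨hP.X_subset_Q (hzh_mem t ω).1, (hzh_mem t ω).2⟩)
      (hξ _) (hmap _) (indepFun_of_measurable_past hξ hind (hmid t))
    -- The direction paired with the second error precedes sample 2t + 1: the best response has been
    -- replaced by the ghost.
    have hW : Measurable[past ξ (c + (2 * t + 1))] fun ω =>
        (comparator xs k (st ω) - (zh t ω).1, (zh t ω).2 - v t ω) :=
      (((h.measurable_comparator xs k).mono
        (past_mono ξ (Nat.le_add_right c (2 * t + 1))) le_rfl).sub (hmid t).fst).prodMk
        ((hmid t).snd.sub ((hgh t).mono (past_mono ξ (by omega)) le_rfl))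
    have h3 := hO.integral_inner_error hgx hgy ((hmid t).mono (hle _) le_rfl)
      (hW.mono (hle _) le_rfl)
      (fun ω => ⟨hP.X_subset_Q (hzh_mem t ω).1, (hzh_mem t ω).2⟩) (B := max (2 * A) (2 * B))
      (fun ω => ⟨le_max_of_le_left (by
          have := norm_sub_le (comparator xs k (st ω)) (zh t ω).1
          linarith [hA _ (hcmp_mem ω), hA _ (hzh_mem t ω).1]), le_max_of_le_right (by
          have := norm_sub_le (zh t ω).2 (v t ω)
          linarith [hB _ (hv_mem t ω), hB _ (hzh_mem t ω).2])⟩)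
      (hξ _) (hmap _) (indepFun_of_measurable_past hξ hind ((hmid t).prodMk hW))
    have h12 := (h1.1.add h2.1).const_mul (2 * p.η e k)
    refine ⟨h3.1.add h12, ?_⟩
    have heq := integral_add h3.1 h12
    have heq2 := integral_add h1.1 h2.1
    simp only [Pi.add_apply] at heq heq2
    rw [integral_const_mul, heq2, h3.2] at heq
    refine (le_of_eq heq).trans ?_
    have hb := add_le_add h1.2 h2.2
    have := mul_le_mul_of_nonneg_left hb (by positivity : 0 ≤ 2 * p.η e k)
    linarith
  have hS0 : 0 < ∑ t ∈ Finset.range (p.T e), p.η e k * (1 + p.β k * p.η e k) ^ t :=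
    Finset.sum_pos (fun t _ => by positivity) ⟨0, by simpa using hp.T_pos⟩
  have hNeq : (fun ω => catalystNoise p X Q Y g (oracleError g gx gy) (fun i => ξ i ω) xs e k
      (st ω)) = fun ω => (∑ t ∈ Finset.range (p.T e), p.η e k * (1 + p.β k * p.η e k) ^ t)⁻¹ *
        ∑ t ∈ Finset.range (p.T e), p.η e k * (1 + p.β k * p.η e k) ^ t * sregStepNoise X Y
        (proxOracle g (p.β k) (proxCenter k (st ω))) (oracleError g gx gy) (p.β k) p.μd (p.η e k)
        (fun i => ξ (c + i) ω) (nearest Q (proxCenter k (st ω)), (st ω).y)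
        (comparator xs k (st ω)) t := by
    funext ω
    rw [catalystNoise, sregNoise, h.calls_eq ω]
  have hint := fun t => (hn t).1.const_mul (p.η e k * (1 + p.β k * p.η e k) ^ t)
  rw [hNeq]
  refine ⟨(integrable_finsetSum _ fun t _ => hint t).const_mul _, ?_⟩
  rw [integral_const_mul, integral_finsetSum _ fun t _ => hint t, inv_mul_le_iff₀ hS0,
    Finset.sum_mul]
  refine Finset.sum_le_sum fun t _ => ?_
  rw [integral_const_mul]
  exact mul_le_mul_of_nonneg_left (hn t).2 (by positivity)

end Noise

/-! ### Expected decrease per epoch and restarts -/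

section Epochs

variable {E G Ξ Ω : Type*} [NormedAddCommGroup E] [InnerProductSpace ℝ E] [CompleteSpace E]
  [NormedAddCommGroup G] [InnerProductSpace ℝ G] [CompleteSpace G]
  [MeasurableSpace E] [BorelSpace E] [SecondCountableTopology E]
  [MeasurableSpace G] [BorelSpace G] [SecondCountableTopology G]
  [MeasurableSpace Ξ] [MeasurableSpace Ω]
  {F : E → G → ℝ} {gx : E → G → E} {gy : E → G → G} {X Q : Set E} {Y : Set G}
  {g : E → G → Ξ → E × G} {ν : Measure Ξ} {σ : ℝ} {P : Measure Ω} {ξ : ℕ → Ω → Ξ} {p : Params}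
  {e : ℕ} {c : ℕ} {st : Ω → State E G}

theorem measurable_comp_of_continuousOn {A B : Type*} [TopologicalSpace A] [MeasurableSpace A]
    [BorelSpace A] [TopologicalSpace B] [MeasurableSpace B] [BorelSpace B] {S : Set A} {f : A → B}
    (hf : ContinuousOn f S) {U : Ω → A} (hU : Measurable U) (hmem : ∀ ω, U ω ∈ S) :
    Measurable fun ω => f (U ω) :=
  (continuousOn_iff_continuous_domRestrict.1 hf).measurable.comp (hU.subtype_mk (h := hmem))

theorem IsReachable.integrable_potential [IsFiniteMeasure P] {L μp μd : ℝ}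
    (hP : IsMinimaxProblem F gx gy X Q Y L μp μd) (hX : X.Nonempty) (hY : Y.Nonempty)
    (hL : 0 ≤ L) (hμp : 0 ≤ μp) (hμd : 0 < μd) (hξ : ∀ i, Measurable (ξ i))
    (h : IsReachable ξ X Y c st) (κ : ℝ) :
    Integrable (fun ω => potential F X Y κ (st ω).xtil (st ω).y) P := by
  have hx := h.measurable_xtil.mono (past_le hξ c) le_rfl
  have hy := h.measurable_y.mono (past_le hξ c) le_rfl
  have hf := hP.continuousOn_primal hX hY hL hμp
  have hmf := measurable_comp_of_continuousOn hf hx h.xtil_mem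
  have hmb := measurable_comp_of_continuousOn (hP.continuousOn_bestResponse hY hL hμd) hx
    h.xtil_mem
  obtain ⟨A, hA⟩ := (hP.compact_X.image_of_continuousOn hf).isBounded.exists_norm_le
  obtain ⟨B, hB⟩ := hP.compact_Y.isBounded.exists_norm_le
  refine Integrable.add (Integrable.sub ?_ (integrable_const _)) (Integrable.const_mul ?_ κ)
  · exact Integrable.of_bound hmf.aestronglyMeasurable A
      (Filter.Eventually.of_forall fun ω => hA _ ⟨_, h.xtil_mem ω, rfl⟩)
  · refine Integrable.of_bound ((hmb.sub hy).norm.pow_const 2).aestronglyMeasurable ((B + B) ^ 2)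
      (Filter.Eventually.of_forall fun ω => ?_)
    rw [norm_pow, norm_norm]
    have h1 := norm_sub_le (bestResponse F Y (st ω).xtil) (st ω).y
    have h2 := hB _ (hP.bestResponse_mem hY (h.xtil_mem ω))
    have h3 := hB _ (h.y_mem ω)
    gcongr
    linarith

theorem IsReachable.iterate (hP : IsMinimaxProblem F gx gy X Q Y p.L p.μp p.μd)
    (hp : p.Admissible e) (hX : X.Nonempty) (hY : Y.Nonempty) (hO : IsSFO g gx gy Q Y ν σ)
    (h : IsReachable ξ X Y c st) (k : ℕ) :
    IsReachable ξ X Y (c + k * (2 * p.T e)) fun ω =>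
      catalystIter p X Q Y g (fun i => ξ i ω) e (st ω).xtil (st ω).y (st ω).calls k := by
  induction k with
  | zero =>
    rw [Nat.zero_mul, Nat.add_zero]
    exact ⟨h.measurable_xtil, h.measurable_xtil, h.measurable_y, h.xtil_mem, h.y_mem, h.calls_eq⟩
  | succ k ih =>
    have := ih.step (k := k + 1) hP hp hX hY hO
    rwa [Nat.succ_mul, ← Nat.add_assoc]

/-- What is needed of the parameters of epoch `e` beyond admissibility. -/
structure Params.Calibrated (p : Params) (e : ℕ) : Prop extends p.Admissible e where
  ratio_le : p.Λ e / (p.Λ e - 1) ≤ 2.6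
  le_K : 24 ≤ p.K
  le_K_sq : 576 * (p.μd / p.μp) ≤ (p.K : ℝ) ^ 2
  noise_le : ∃ R ηb, 0 ≤ R ∧ 0 ≤ ηb ∧
    (4000 * (p.K : ℝ) ^ 2 ≤ p.Λ e - 1 ∨ p.μd * p.DY ^ 2 / (p.Λ e - 1) ≤ R) ∧
    (∀ k, 1 ≤ k → p.η e k ≤ ηb) ∧
    2.4 * p.K * (R / 4 + 4 * ηb * p.σ ^ 2) ≤ p.Δ₀ / 2 ^ e / 2

theorem integral_epoch_le [IsProbabilityMeasure P] [IsProbabilityMeasure ν]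
    (hP : IsMinimaxProblem F gx gy X Q Y p.L p.μp p.μd) (hp : p.Calibrated e)
    (hO : IsSFO g gx gy Q Y ν p.σ)
    (hgx : Measurable fun p : E × G => gx p.1 p.2) (hgy : Measurable fun p : E × G => gy p.1 p.2)
    (hξ : ∀ i, Measurable (ξ i)) (hind : iIndepFun ξ P) (hmap : ∀ i, P.map (ξ i) = ν)
    (hX : X.Nonempty) (hY : Y.Nonempty) (hDY : ∀ y ∈ Y, ∀ y' ∈ Y, ‖y - y'‖ ≤ p.DY)
    (h : IsReachable ξ X Y c st) :
    let st' := fun ω =>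
      catalystIter p X Q Y g (fun i => ξ i ω) e (st ω).xtil (st ω).y (st ω).calls p.K
    ∫ ω, potential F X Y (p.μd / 6) (st' ω).xtil (st' ω).y ∂P
      ≤ 1 / 50 * ∫ ω, potential F X Y (p.μd / 12) (st ω).xtil (st ω).y ∂P
        + p.Δ₀ / 2 ^ e / 2 := by
  intro st'
  have ha := hp.toAdmissible
  obtain ⟨xs, hxs, hopt, -⟩ := hP.exists_minimizer hX hY ha.L_pos.le ha.μp_pos.le
  obtain ⟨R, ηb, hR, hηb0, hΛ, hηb, hbound⟩ := hp.noise_le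
  have hK : (24 : ℝ) ≤ p.K := by exact_mod_cast hp.le_K
  have hreach := h.iterate hP ha hX hY hO
  have hpot := fun (κ : ℝ) {c : ℕ} {st : Ω → State E G} (h : IsReachable ξ X Y c st) =>
    h.integrable_potential (P := P) hP hX hY ha.L_pos.le ha.μp_pos.le ha.μd_pos hξ κ
  set N : ℕ → Ω → ℝ := fun k ω => catalystNoise p X Q Y g (oracleError g gx gy)
    (fun i => ξ i ω) xs e (k + 1)
    (catalystIter p X Q Y g (fun i => ξ i ω) e (st ω).xtil (st ω).y (st ω).calls k) with hN
  have hNint : ∀ k, Integrable (N k) P ∧ ∫ ω, N k ω ∂P ≤ 4 * p.η e (k + 1) * p.σ ^ 2 := fun k =>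
    integral_catalystNoise_le hP ha hO hgx hgy hξ hind hmap hxs hY (by omega) (hreach k)
  have hterm : ∀ k ∈ Finset.range p.K,
      Integrable (fun ω => ((k : ℝ) + 2) * ((k : ℝ) + 3) * (R / 4 + N k ω)) P := fun k _ =>
    ((integrable_const _).add (hNint k).1).const_mul _
  have hpath : ∀ ω, potential F X Y (p.μd / 6) (st' ω).xtil (st' ω).y
      ≤ 1 / 50 * potential F X Y (p.μd / 12) (st ω).xtil (st ω).y
        + 2 / (p.K : ℝ) ^ 2 * ∑ k ∈ Finset.range p.K,
          ((k : ℝ) + 2) * ((k : ℝ) + 3) * (R / 4 + N k ω) := fun ω =>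
    epoch_le hP ha hxs hopt hDY hR hΛ hp.ratio_le hp.le_K hp.le_K_sq (h.xtil_mem ω) (h.y_mem ω)
  have hi1 := (hpot (p.μd / 12) h).const_mul (1 / 50)
  have hi2 := (integrable_finsetSum _ hterm).const_mul (2 / (p.K : ℝ) ^ 2)
  have hmono := integral_mono (hpot (p.μd / 6) (hreach p.K)) (hi1.add hi2) hpath
  have hadd := integral_add hi1 hi2
  simp only [Pi.add_apply] at hmono hadd
  refine hmono.trans ?_
  rw [hadd, integral_const_mul, integral_const_mul, integral_finsetSum _ hterm]
  gcongr
  have hsum : ∑ k ∈ Finset.range p.K,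
      ∫ ω, ((k : ℝ) + 2) * ((k : ℝ) + 3) * (R / 4 + N k ω) ∂P
      ≤ ∑ k ∈ Finset.range p.K, 1.2 * (p.K : ℝ) ^ 2 * (R / 4 + 4 * ηb * p.σ ^ 2) := by
    refine Finset.sum_le_sum fun k hk => ?_
    have hkK : (k : ℝ) + 1 ≤ p.K := by exact_mod_cast Finset.mem_range.1 hk
    have hk0 : (0 : ℝ) ≤ k := Nat.cast_nonneg k
    rw [integral_const_mul, integral_add (integrable_const _) (hNint k).1]
    simp only [integral_const, probReal_univ, one_smul]
    have h1 : 4 * p.η e (k + 1) * p.σ ^ 2 ≤ 4 * ηb * p.σ ^ 2 := by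
      gcongr
      exact hηb _ (by omega)
    -- From k + 1 ≤ K and K ≥ 24; summed over K iterations and multiplied by 2/K², it gives the
    -- factor 2.4 K in the noise budget.
    have h2 : ((k : ℝ) + 2) * (k + 3) ≤ 1.2 * (p.K : ℝ) ^ 2 := by nlinarith
    calc ((k : ℝ) + 2) * (k + 3) * (R / 4 + ∫ ω, N k ω ∂P)
        ≤ ((k : ℝ) + 2) * (k + 3) * (R / 4 + 4 * ηb * p.σ ^ 2) := by
          gcongr
          exact (hNint k).2.trans h1
      _ ≤ _ := by gcongr
  rw [Finset.sum_const, Finset.card_range, nsmul_eq_mul] at hsum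
  calc 2 / (p.K : ℝ) ^ 2 * _
      ≤ 2 / (p.K : ℝ) ^ 2 * ((p.K : ℝ) * (1.2 * (p.K : ℝ) ^ 2 * (R / 4 + 4 * ηb * p.σ ^ 2))) := by
        gcongr
    _ = 2.4 * p.K * (R / 4 + 4 * ηb * p.σ ^ 2) := by field_simp; ring
    _ ≤ _ := hbound

/-- The expected potential is halved in every epoch. -/
theorem integral_rCatalyst_le [IsProbabilityMeasure P] [IsProbabilityMeasure ν]
    (hP : IsMinimaxProblem F gx gy X Q Y p.L p.μp p.μd) (hp : ∀ e, 1 ≤ e → p.Calibrated e)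
    (hO : IsSFO g gx gy Q Y ν p.σ)
    (hgx : Measurable fun p : E × G => gx p.1 p.2) (hgy : Measurable fun p : E × G => gy p.1 p.2)
    (hξ : ∀ i, Measurable (ξ i)) (hind : iIndepFun ξ P) (hmap : ∀ i, P.map (ξ i) = ν)
    (hDY : ∀ y ∈ Y, ∀ y' ∈ Y, ‖y - y'‖ ≤ p.DY) {x₀ : E} {y₀ : G} (hx₀ : x₀ ∈ X) (hy₀ : y₀ ∈ Y)
    (hΔ₀ : p.Δ₀ = potential F X Y (p.μd / 12) x₀ y₀) (e : ℕ) :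
    let st := fun ω => rCatalyst p X Q Y g (fun i => ξ i ω) x₀ y₀ e
    IsReachable ξ X Y (∑ i ∈ Finset.range e, p.K * (2 * p.T (i + 1))) st ∧
      ∫ ω, potential F X Y (p.μd / 12) (st ω).xtil (st ω).y ∂P ≤ p.Δ₀ / 2 ^ e ∧
      (1 ≤ e → ∫ ω, potential F X Y (p.μd / 6) (st ω).xtil (st ω).y ∂P ≤ p.Δ₀ / 2 ^ e) := by
  have ha := (hp 1 le_rfl).toAdmissible
  have hX : X.Nonempty := ⟨x₀, hx₀⟩
  have hY : Y.Nonempty := ⟨y₀, hy₀⟩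
  induction e with
  | zero =>
    refine ⟨⟨measurable_const, measurable_const, measurable_const, fun _ => hx₀, fun _ => hy₀,
      fun _ => rfl⟩, ?_, by simp⟩
    simp [rCatalyst, hΔ₀]
  | succ e ih =>
    obtain ⟨hr, hpot, -⟩ := ih
    have hc := hp (e + 1) (by omega)
    have hr' := hr.iterate hP hc.toAdmissible hX hY hO p.K
    rw [← Finset.sum_range_succ (fun i => p.K * (2 * p.T (i + 1)))] at hr'
    have hle := integral_epoch_le hP hc hO hgx hgy hξ hind hmap hX hY hDY hr
    have hΔ : 0 ≤ p.Δ₀ / 2 ^ e := by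
      have hmu := ha.μd_pos
      have hnn : 0 ≤ primal F Y x₀ - primalOpt F X Y := by
        obtain ⟨-, -, -, h⟩ := hP.exists_minimizer hX hY ha.L_pos.le ha.μp_pos.le
        exact sub_nonneg.2 (h x₀ hx₀)
      have : 0 ≤ p.Δ₀ := by rw [hΔ₀]; unfold potential; positivity
      positivity
    have hhalf : p.Δ₀ / 2 ^ (e + 1) = p.Δ₀ / 2 ^ e / 2 := by rw [pow_succ]; field_simp
    have h6 : ∫ ω, potential F X Y (p.μd / 6) (rCatalyst p X Q Y g (fun i => ξ i ω) x₀ y₀ (e + 1)).xtil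
        (rCatalyst p X Q Y g (fun i => ξ i ω) x₀ y₀ (e + 1)).y ∂P ≤ p.Δ₀ / 2 ^ (e + 1) := by
      refine hle.trans ?_
      rw [hhalf]
      linarith
    -- An epoch outputs the potential with constant μd/6 but starts from the smaller one with μd/12,
    -- so the recursion closes.
    refine ⟨hr', le_trans (integral_mono ?_ ?_ fun ω => ?_) h6, fun _ => h6⟩
    · exact hr'.integrable_potential hP hX hY ha.L_pos.le ha.μp_pos.le ha.μd_pos hξ _
    · exact hr'.integrable_potential hP hX hY ha.L_pos.le ha.μp_pos.le ha.μd_pos hξ _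
    · have hmu := ha.μd_pos
      unfold potential
      gcongr
      norm_num

end Epochs

/-! ### Calibration of T_e, η and Λ -/

namespace Params

/-- The sign and order conditions on the constants of the problem. -/
structure Valid (p : Params) : Prop where
  μp_pos : 0 < p.μp
  μp_le : p.μp ≤ p.μd
  μd_le : p.μd ≤ p.L
  σ_pos : 0 < p.σ
  DY_pos : 0 < p.DY
  Δ₀_pos : 0 < p.Δ₀

variable {p : Params} (hp : p.Valid) (e : ℕ)

/-- The product `q log T_e`. -/
noncomputable def qLogT (p : Params) (e : ℕ) : ℝ :=
  max (2 * (Real.log (p.μd ^ 2 * p.DY ^ 2 / (16 * p.σ ^ 2)) + Real.log (p.T e))) 1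

/-- The noise-to-accuracy ratio that governs the number of steps in epoch `e`. -/
noncomputable def noiseRatio (p : Params) (e : ℕ) : ℝ :=
  128 * (p.K : ℝ) * 2 ^ e * p.σ ^ 2 / (p.Δ₀ * p.μd)

namespace Valid

include hp

theorem μd_pos : 0 < p.μd := hp.μp_pos.trans_le hp.μp_le

theorem L_pos : 0 < p.L := hp.μd_pos.trans_le hp.μd_le

theorem one_le_sqrt : 1 ≤ √(p.μd / p.μp) :=
  Real.one_le_sqrt.2 ((one_le_div hp.μp_pos).2 hp.μp_le)

theorem le_K : 24 ≤ p.K := by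
  have h1 : (24 : ℝ) * √(p.μd / p.μp) ≤ p.K := Nat.le_ceil _
  have h2 := hp.one_le_sqrt
  have h3 : (24 : ℝ) ≤ p.K := by linarith
  exact_mod_cast h3

theorem le_K_sq : 576 * (p.μd / p.μp) ≤ (p.K : ℝ) ^ 2 := by
  have h1 : (24 : ℝ) * √(p.μd / p.μp) ≤ p.K := Nat.le_ceil _
  have h2 := hp.one_le_sqrt
  have h3 : √(p.μd / p.μp) ^ 2 = p.μd / p.μp :=
    Real.sq_sqrt (div_pos hp.μd_pos hp.μp_pos).le
  nlinarith

theorem K_pos : (0 : ℝ) < p.K := by exact_mod_cast (by norm_num : 0 < 24).trans_le hp.le_K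

theorem noiseRatio_pos : 0 < p.noiseRatio e := by
  have := hp.K_pos
  have := hp.μd_pos
  have := hp.σ_pos
  have := hp.Δ₀_pos
  unfold noiseRatio
  positivity

/-- The noise part depends on K, e, σ and Δ₀ only through `noiseRatio`; 49152 = 384 · 128 and e log
2 merge into one logarithm. -/
theorem T_arg_eq : 288 * p.L * (Real.log 96 + Real.log (48 * (p.K : ℝ) ^ 2)) / p.μd
    + 128 * (p.K : ℝ) * 2 ^ e / p.Δ₀ *
      (192 * p.σ ^ 2 * max (Real.log (p.μd ^ 2 * p.DY ^ 2 / p.σ ^ 2) + 2) 0 / p.μd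
        + 384 * p.σ ^ 2 *
          max (Real.log (49152 * (p.K : ℝ) * p.σ ^ 2 / (p.μd * p.Δ₀)) + e * Real.log 2) 1
            / p.μd)
    = 288 * (p.L / p.μd) * Real.log (4608 * (p.K : ℝ) ^ 2)
      + p.noiseRatio e * (192 * max (Real.log (p.μd ^ 2 * p.DY ^ 2 / p.σ ^ 2) + 2) 0
        + 384 * max (Real.log (384 * p.noiseRatio e)) 1) := by
  have hK := hp.K_pos
  have hμ := hp.μd_pos
  have hσ := hp.σ_pos
  have hΔ := hp.Δ₀_pos
  have h1 : Real.log 96 + Real.log (48 * (p.K : ℝ) ^ 2) = Real.log (4608 * (p.K : ℝ) ^ 2) := by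
    rw [← Real.log_mul (by norm_num) (by positivity)]
    congr 1
    ring
  have h2 : Real.log (49152 * (p.K : ℝ) * p.σ ^ 2 / (p.μd * p.Δ₀)) + e * Real.log 2
      = Real.log (384 * p.noiseRatio e) := by
    rw [← Real.log_pow, ← Real.log_mul (by positivity) (by positivity)]
    congr 1
    unfold noiseRatio
    field_simp
    ring
  rw [h1, h2, noiseRatio]
  field_simp

theorem le_T : 288 * (p.L / p.μd) * Real.log (4608 * (p.K : ℝ) ^ 2)
      + p.noiseRatio e * (192 * max (Real.log (p.μd ^ 2 * p.DY ^ 2 / p.σ ^ 2) + 2) 0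
        + 384 * max (Real.log (384 * p.noiseRatio e)) 1) ≤ p.T e := by
  rw [← hp.T_arg_eq]
  exact Nat.le_ceil _

theorem log_K_nonneg : 1 ≤ Real.log (4608 * (p.K : ℝ) ^ 2) := by
  have hK : (24 : ℝ) ≤ p.K := by exact_mod_cast hp.le_K
  rw [Real.le_log_iff_exp_le (by positivity)]
  have := Real.exp_one_lt_d9
  nlinarith

theorem le_T_curvature : 288 * (p.L / p.μd) * Real.log (4608 * (p.K : ℝ) ^ 2) ≤ p.T e := by
  have h := hp.le_T e
  have hM := hp.noiseRatio_pos e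
  have h1 := le_max_right (Real.log (p.μd ^ 2 * p.DY ^ 2 / p.σ ^ 2) + 2) 0
  have h2 := le_max_right (Real.log (384 * p.noiseRatio e)) 1
  have : 0 ≤ p.noiseRatio e * (192 * max (Real.log (p.μd ^ 2 * p.DY ^ 2 / p.σ ^ 2) + 2) 0
        + 384 * max (Real.log (384 * p.noiseRatio e)) 1) := by positivity
  linarith

theorem two_le_T : (2 : ℝ) ≤ p.T e := by
  have h := hp.le_T_curvature e
  have h1 := hp.log_K_nonneg
  have h2 : 1 ≤ p.L / p.μd := (one_le_div hp.μd_pos).2 hp.μd_le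
  nlinarith

theorem q_mul_log_T : p.q e * Real.log (p.T e) = p.qLogT e := by
  have h : 0 < Real.log (p.T e) := Real.log_pos (by linarith [hp.two_le_T e])
  rw [q, max_mul_of_nonneg _ _ h.le, div_mul_cancel₀ _ h.ne', div_mul_cancel₀ _ h.ne', qLogT]

omit hp in
theorem one_le_qLogT : 1 ≤ p.qLogT e := le_max_right _ _

/-- The common value of `β_k η_k`. -/
theorem β_mul_η (k : ℕ) :
    p.β k * p.η e k = min (p.μd / (96 * p.L)) (p.qLogT e / (p.T e : ℝ)) := by
  have hμ := hp.μd_pos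
  have hL := hp.L_pos
  have hT : (0 : ℝ) < p.T e := by linarith [hp.two_le_T e]
  have hβ : 0 < p.β k := by unfold β; positivity
  rw [η, hp.q_mul_log_T, mul_min_of_nonneg _ _ hβ.le]
  congr 1
  · unfold β; field_simp; norm_num
  · field_simp

/-- For 0 ≤ u ≤ 1 one has log(1+u) ≥ 2u/(u+2) ≥ u/2. -/
theorem half_step_le_log_Λ :
    (p.T e : ℝ) * (min (p.μd / (96 * p.L)) (p.qLogT e / (p.T e : ℝ)) / 2) ≤ Real.log (p.Λ e) := by
  have hμ := hp.μd_pos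
  have hL := hp.L_pos
  have hT : (0 : ℝ) < p.T e := by linarith [hp.two_le_T e]
  have hq := one_le_qLogT (p := p) e
  rw [Λ, hp.q_mul_log_T]
  set u := min (p.μd / (96 * p.L)) (p.qLogT e / (p.T e : ℝ)) with hu
  have hu0 : 0 < u := lt_min (by positivity) (by positivity)
  have hu1 : u ≤ 1 := (min_le_left _ _).trans (by
    rw [div_le_one (by positivity)]; linarith [hp.μd_le])
  rw [Real.log_pow]
  refine mul_le_mul_of_nonneg_left ?_ hT.le
  refine le_trans ?_ (Real.le_log_one_add_of_nonneg hu0.le)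
  rw [div_le_div_iff₀ (by norm_num) (by positivity)]
  nlinarith

theorem one_lt_Λ : 1 < p.Λ e := by
  have hμ := hp.μd_pos
  have hL := hp.L_pos
  have hT : (0 : ℝ) < p.T e := by linarith [hp.two_le_T e]
  have hq := one_le_qLogT (p := p) e
  rw [Λ, hp.q_mul_log_T]
  refine one_lt_pow₀ ?_ (by exact_mod_cast hT.ne')
  have : 0 < min (p.μd / (96 * p.L)) (p.qLogT e / (p.T e : ℝ)) :=
    lt_min (by positivity) (by positivity)
  linarith

theorem admissible : p.Admissible e where
  μp_pos := hp.μp_pos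
  μp_le := hp.μp_le
  μd_le := hp.μd_le
  T_pos := by
    have := hp.two_le_T e
    exact_mod_cast (by linarith : (0 : ℝ) < p.T e)
  η_pos k := by
    have hμ := hp.μd_pos
    have hL := hp.L_pos
    have hT : (0 : ℝ) < p.T e := by linarith [hp.two_le_T e]
    have hq := one_le_qLogT (p := p) e
    have hβ : 0 < p.β k := by unfold β; positivity
    rw [η, hp.q_mul_log_T]
    exact lt_min (by positivity) (by positivity)
  Λ_eq k := by rw [hp.β_mul_η, Λ, hp.q_mul_log_T]
  one_lt_Λ := hp.one_lt_Λ e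

/-- The alternatives are the branches of the minimum. When curvature limits the step, the first part
of T_e makes log Λ at least the logarithm of 4608 K². Otherwise log Λ ≥ (q log T_e)/2, and the two
entries of the maximum in q give the two bounds. -/
theorem Λ_cases : 4608 * (p.K : ℝ) ^ 2 ≤ p.Λ e ∨
    (p.μd ^ 2 * p.DY ^ 2 / (16 * p.σ ^ 2) * p.T e ≤ p.Λ e ∧ 1.625 ≤ p.Λ e) := by
  have hμ := hp.μd_pos
  have hL := hp.L_pos
  have hσ := hp.σ_pos
  have hD := hp.DY_pos
  have hK := hp.K_pos
  have hT : (0 : ℝ) < p.T e := by linarith [hp.two_le_T e]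
  have hΛ : 0 < p.Λ e := by linarith [hp.one_lt_Λ e]
  have h := hp.half_step_le_log_Λ e
  rcases min_choice (p.μd / (96 * p.L)) (p.qLogT e / (p.T e : ℝ)) with hm | hm <;> rw [hm] at h
  · left
    rw [← Real.log_le_log_iff (by positivity) hΛ]
    refine le_trans ?_ h
    have h1 := mul_le_mul_of_nonneg_right (hp.le_T_curvature e)
      (by positivity : 0 ≤ p.μd / (96 * p.L) / 2)
    have h2 : 288 * (p.L / p.μd) * Real.log (4608 * (p.K : ℝ) ^ 2) * (p.μd / (96 * p.L) / 2)
        = 3 / 2 * Real.log (4608 * (p.K : ℝ) ^ 2) := by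
      field_simp; ring
    have h3 := hp.log_K_nonneg
    linarith
  · right
    have h1 : (p.T e : ℝ) * (p.qLogT e / p.T e / 2) = p.qLogT e / 2 := by field_simp
    rw [h1] at h
    constructor
    · rw [← Real.log_le_log_iff (by positivity) hΛ, Real.log_mul (by positivity) hT.ne']
      have := le_max_left
        (2 * (Real.log (p.μd ^ 2 * p.DY ^ 2 / (16 * p.σ ^ 2)) + Real.log (p.T e))) 1
      unfold qLogT at h
      linarith
    · have h2 : 1 / 2 ≤ Real.log (p.Λ e) := by linarith [one_le_qLogT (p := p) e]
      rw [Real.le_log_iff_exp_le hΛ] at h2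
      -- The bound exp(1/2) ≥ 1 + 1/2 + 1/8 = 1.625 gives the ratio 1.625/0.625 = 2.6 used for
      -- Λ/(Λ-1).
      have := Real.quadratic_le_exp_of_nonneg (by norm_num : (0 : ℝ) ≤ 1 / 2)
      norm_num at this ⊢
      linarith

/-- The condition on T_e is implicit, since q log T_e contains log T_e. The tangent line of log at
384 M, with M the noise ratio, bounds log T_e by T_e/(384 M) plus log(384 M), so only a small
fraction of T_e is spent on it. -/
theorem noiseRatio_mul_qLogT_le : 1.3 * p.noiseRatio e * p.qLogT e ≤ p.T e := by
  have hT : (0 : ℝ) < p.T e := by linarith [hp.two_le_T e]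
  have hM := hp.noiseRatio_pos e
  have hμ := hp.μd_pos
  have hσ := hp.σ_pos
  have hD := hp.DY_pos
  have h := hp.le_T e
  have h0 : 0 ≤ 288 * (p.L / p.μd) * Real.log (4608 * (p.K : ℝ) ^ 2) := by
    have := hp.L_pos
    have := hp.log_K_nonneg
    positivity
  set M := p.noiseRatio e with hMdef
  set a := max (Real.log (p.μd ^ 2 * p.DY ^ 2 / p.σ ^ 2) + 2) 0 with ha
  set b := max (Real.log (384 * M)) 1 with hb
  have ha0 : 0 ≤ a := le_max_right _ _
  have ha1 : Real.log (p.μd ^ 2 * p.DY ^ 2 / p.σ ^ 2) + 2 ≤ a := le_max_left _ _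
  have hb0 : 1 ≤ b := le_max_right _ _
  have hb1 : Real.log (384 * M) ≤ b := le_max_left _ _
  have hMa := mul_nonneg hM.le ha0
  have hMb := mul_le_mul_of_nonneg_left hb0 hM.le
  have hlogA : Real.log (p.μd ^ 2 * p.DY ^ 2 / (16 * p.σ ^ 2))
      ≤ Real.log (p.μd ^ 2 * p.DY ^ 2 / p.σ ^ 2) := by
    refine Real.log_le_log (by positivity) ?_
    gcongr
    nlinarith [sq_nonneg p.σ]
  have hlogT : Real.log (p.T e) ≤ p.T e / (384 * M) + Real.log (384 * M) - 1 := by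
    have h1 := Real.log_le_sub_one_of_pos (by positivity : 0 < p.T e / (384 * M))
    rw [Real.log_div hT.ne' (by positivity)] at h1
    linarith
  rw [qLogT, mul_max_of_nonneg _ _ (by positivity)]
  refine max_le ?_ (by linarith)
  have h1 : Real.log (p.μd ^ 2 * p.DY ^ 2 / (16 * p.σ ^ 2)) + Real.log (p.T e)
      ≤ a + p.T e / (384 * M) + b := by linarith
  have h2 := mul_le_mul_of_nonneg_left h1 (by positivity : 0 ≤ 2.6 * M)
  have h3 : 2.6 * M * (a + p.T e / (384 * M) + b)
      = 2.6 * (M * a) + 2.6 / 384 * p.T e + 2.6 * (M * b) := by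
    field_simp
  rw [h3] at h2
  linarith

theorem calibrated : p.Calibrated e where
  toAdmissible := hp.admissible e
  ratio_le := by
    have h1 := hp.one_lt_Λ e
    rw [div_le_iff₀ (by linarith)]
    have hK : (24 : ℝ) ≤ p.K := by exact_mod_cast hp.le_K
    rcases hp.Λ_cases e with h | ⟨-, h⟩ <;> nlinarith
  le_K := hp.le_K
  le_K_sq := hp.le_K_sq
  noise_le := by
    have hμ := hp.μd_pos
    have hσ := hp.σ_pos
    have hD := hp.DY_pos
    have hΔ := hp.Δ₀_pos
    have hT : (0 : ℝ) < p.T e := by linarith [hp.two_le_T e]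
    have hq := one_le_qLogT (p := p) e
    have hK : (24 : ℝ) ≤ p.K := by exact_mod_cast hp.le_K
    have hΛ := hp.one_lt_Λ e
    -- The first witness comes from 2.6 · 16 = 41.6 ≤ 42, the second from β_k ≥ μd/6. The final
    -- budget then reads 2 · 82.8 ≤ 1.3 · 128.
    refine ⟨42 * p.σ ^ 2 / (p.μd * p.T e), 6 * p.qLogT e / (p.μd * p.T e), by positivity,
      by positivity, ?_, fun k hk => ?_, ?_⟩
    · rcases hp.Λ_cases e with h | ⟨h, h'⟩
      · left; nlinarith
      · right
        rw [div_le_div_iff₀ (by linarith) (by positivity)]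
        have h1 : p.μd ^ 2 * p.DY ^ 2 * p.T e ≤ 16 * p.σ ^ 2 * p.Λ e := by
          rw [div_mul_eq_mul_div, div_le_iff₀ (by positivity)] at h
          linarith
        have h2 : p.Λ e ≤ 2.6 * (p.Λ e - 1) := by linarith
        have h3 := mul_le_mul_of_nonneg_left h2 (by positivity : 0 ≤ 16 * p.σ ^ 2)
        have h4 : 0 ≤ p.σ ^ 2 * (p.Λ e - 1) := mul_nonneg (sq_nonneg _) (by linarith)
        linarith
    · have hβ := (hp.admissible e).le_β hk
      have h1 : p.η e k ≤ p.qLogT e / (p.β k * p.T e) := by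
        rw [η, hp.q_mul_log_T]; exact min_le_right _ _
      refine h1.trans ?_
      have h2 : 0 < p.β k := by linarith
      rw [div_le_div_iff₀ (by positivity) (by positivity)]
      have := mul_le_mul_of_nonneg_left hβ (by positivity : 0 ≤ 6 * p.qLogT e * p.T e)
      linarith
    · have h1 := hp.noiseRatio_mul_qLogT_le e
      have h2 : 2.4 * p.K * (42 * p.σ ^ 2 / (p.μd * p.T e) / 4
          + 4 * (6 * p.qLogT e / (p.μd * p.T e)) * p.σ ^ 2)
          ≤ 82.8 * p.K * p.σ ^ 2 * p.qLogT e / (p.μd * p.T e) := by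
        have h3 : 2.4 * p.K * (42 * p.σ ^ 2 / (p.μd * p.T e) / 4
          + 4 * (6 * p.qLogT e / (p.μd * p.T e)) * p.σ ^ 2)
          = (25.2 + 57.6 * p.qLogT e) * (p.K * p.σ ^ 2 / (p.μd * p.T e)) := by
          field_simp; ring
        have h4 : 82.8 * p.K * p.σ ^ 2 * p.qLogT e / (p.μd * p.T e)
          = (82.8 * p.qLogT e) * (p.K * p.σ ^ 2 / (p.μd * p.T e)) := by ring
        rw [h3, h4]
        gcongr
        linarith
      refine h2.trans ?_
      rw [div_div, div_le_div_iff₀ (by positivity) (by positivity)]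
      have h5 : 166.4 * (p.K * 2 ^ e * p.σ ^ 2 * p.qLogT e) ≤ p.T e * (p.Δ₀ * p.μd) := by
        have h6 : 1.3 * p.noiseRatio e * p.qLogT e
            = 166.4 * (p.K * 2 ^ e * p.σ ^ 2 * p.qLogT e) / (p.Δ₀ * p.μd) := by
          unfold noiseRatio; ring
        rw [h6, div_le_iff₀ (by positivity)] at h1
        exact h1
      have h7 : 0 ≤ p.K * 2 ^ e * p.σ ^ 2 * p.qLogT e := by positivity
      linarith

end Valid

end Params

/-! ### Counting oracle calls -/

namespace Params.Valid

variable {p : Params} (hp : p.Valid)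
include hp

theorem K_le : (p.K : ℝ) ≤ 25 * √(p.μd / p.μp) := by
  have h1 : (p.K : ℝ) < 24 * √(p.μd / p.μp) + 1 := Nat.ceil_lt_add_one (by positivity)
  linarith [hp.one_le_sqrt]

theorem K_sq_le : (p.K : ℝ) ^ 2 ≤ 625 * (p.μd / p.μp) := by
  have h : √(p.μd / p.μp) ^ 2 = p.μd / p.μp :=
    Real.sq_sqrt (div_pos hp.μd_pos hp.μp_pos).le
  have h2 := pow_le_pow_left₀ hp.K_pos.le hp.K_le 2
  rw [mul_pow, h] at h2
  linarith

theorem log_K_le : Real.log (4608 * (p.K : ℝ) ^ 2) ≤ 16 + Real.log (p.μd / p.μp) := by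
  have hr : 0 < p.μd / p.μp := div_pos hp.μd_pos hp.μp_pos
  have hK := hp.K_pos
  -- 4608 · 625 < 2^22, and 22 log 2 < 16.
  have h1 : Real.log (4608 * (p.K : ℝ) ^ 2) ≤ Real.log (2 ^ 22 * (p.μd / p.μp)) := by
    refine Real.log_le_log (by positivity) ?_
    nlinarith [hp.K_sq_le]
  rw [Real.log_mul (by positivity) hr.ne', Real.log_pow] at h1
  push_cast at h1
  linarith [Real.log_two_lt_d9]

theorem log_noiseRatio_le (e : ℕ) :
    max (Real.log (384 * p.noiseRatio e)) 1
      ≤ 16 + Real.posLog (p.σ ^ 2 / (p.Δ₀ * p.μp)) + e := by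
  have hμ := hp.μd_pos
  have hμp := hp.μp_pos
  have hσ := hp.σ_pos
  have hΔ := hp.Δ₀_pos
  have hK := hp.K_pos
  have hpl := Real.posLog_nonneg (x := p.σ ^ 2 / (p.Δ₀ * p.μp))
  have he : (0 : ℝ) ≤ e := Nat.cast_nonneg e
  refine max_le ?_ (by linarith)
  have hr : (p.K : ℝ) / p.μd ≤ 25 / p.μp := by
    rw [div_le_div_iff₀ hμ hμp]
    have h1 : √(p.μd / p.μp) ≤ p.μd / p.μp := by
      have h2 : √(p.μd / p.μp) ^ 2 = p.μd / p.μp := Real.sq_sqrt (div_pos hμ hμp).le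
      nlinarith [hp.one_le_sqrt]
    have h3 := mul_le_mul_of_nonneg_right (hp.K_le.trans (mul_le_mul_of_nonneg_left h1
      (by norm_num : (0 : ℝ) ≤ 25))) hμp.le
    have h4 : 25 * (p.μd / p.μp) * p.μp = 25 * p.μd := by field_simp
    linarith
  have h1 : 384 * p.noiseRatio e ≤ 2 ^ 21 * 2 ^ e * (p.σ ^ 2 / (p.Δ₀ * p.μp)) := by
    have e1 : 384 * p.noiseRatio e = 49152 * 2 ^ e * (p.σ ^ 2 / p.Δ₀) * (p.K / p.μd) := by
      unfold noiseRatio; field_simp; ring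
    have e2 : 2 ^ 21 * 2 ^ e * (p.σ ^ 2 / (p.Δ₀ * p.μp))
      = 2 ^ 21 * 2 ^ e * (p.σ ^ 2 / p.Δ₀) * (1 / p.μp) := by field_simp
    have h2 := mul_le_mul_of_nonneg_left hr
      (by positivity : 0 ≤ 49152 * 2 ^ e * (p.σ ^ 2 / p.Δ₀))
    have h3 : 0 ≤ 2 ^ e * (p.σ ^ 2 / p.Δ₀) * (1 / p.μp) := by positivity
    have h4 : 49152 * 2 ^ e * (p.σ ^ 2 / p.Δ₀) * (25 / p.μp)
      = 1228800 * (2 ^ e * (p.σ ^ 2 / p.Δ₀) * (1 / p.μp)) := by ring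
    rw [e1, e2]
    linarith
  have hM := hp.noiseRatio_pos e
  have h2 := Real.log_le_log (by positivity) h1
  rw [Real.log_mul (x := 2 ^ 21 * 2 ^ e) (by positivity) (by positivity),
    Real.log_mul (x := 2 ^ 21) (by positivity) (by positivity), Real.log_pow, Real.log_pow] at h2
  push_cast at h2
  have h3 : Real.log (p.σ ^ 2 / (p.Δ₀ * p.μp)) ≤ Real.posLog (p.σ ^ 2 / (p.Δ₀ * p.μp)) :=
    le_max_right _ _
  have h4 := Real.log_two_lt_d9
  nlinarith

theorem T_le (e : ℕ) : (p.T e : ℝ) ≤ 4896 * (p.L / p.μd) * (1 + Real.log (p.μd / p.μp))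
    + p.noiseRatio e * (192 * (Real.posLog (p.μd ^ 2 * p.DY ^ 2 / p.σ ^ 2) + 2)
      + 384 * (16 + Real.posLog (p.σ ^ 2 / (p.Δ₀ * p.μp)) + e)) := by
  have hM := hp.noiseRatio_pos e
  have hT : (p.T e : ℝ) < _ := Nat.ceil_lt_add_one (by
    rw [hp.T_arg_eq]
    have := hp.L_pos
    have := hp.μd_pos
    have := hp.log_K_nonneg
    have := le_max_right (Real.log (p.μd ^ 2 * p.DY ^ 2 / p.σ ^ 2) + 2) 0
    have := le_max_right (Real.log (384 * p.noiseRatio e)) 1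
    positivity)
  rw [hp.T_arg_eq] at hT
  refine hT.le.trans ?_
  have h1 : 1 ≤ p.L / p.μd := (one_le_div hp.μd_pos).2 hp.μd_le
  have hlog : 0 ≤ Real.log (p.μd / p.μp) :=
    Real.log_nonneg ((one_le_div hp.μp_pos).2 hp.μp_le)
  have h2 : 288 * (p.L / p.μd) * Real.log (4608 * (p.K : ℝ) ^ 2) + 1
      ≤ 4896 * (p.L / p.μd) * (1 + Real.log (p.μd / p.μp)) := by
    have h3 := mul_le_mul_of_nonneg_left hp.log_K_le (by positivity : 0 ≤ 288 * (p.L / p.μd))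
    have h4 : 0 ≤ (p.L / p.μd) * Real.log (p.μd / p.μp) := by positivity
    linarith
  have h3 : max (Real.log (p.μd ^ 2 * p.DY ^ 2 / p.σ ^ 2) + 2) 0
      ≤ Real.posLog (p.μd ^ 2 * p.DY ^ 2 / p.σ ^ 2) + 2 :=
    max_le (add_le_add_left (le_max_right _ _) 2)
      (by linarith [Real.posLog_nonneg (x := p.μd ^ 2 * p.DY ^ 2 / p.σ ^ 2)])
  have h4 := hp.log_noiseRatio_le e
  have h5 := mul_le_mul_of_nonneg_left (add_le_add
    (mul_le_mul_of_nonneg_left h3 (by norm_num : (0 : ℝ) ≤ 192))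
    (mul_le_mul_of_nonneg_left h4 (by norm_num : (0 : ℝ) ≤ 384))) hM.le
  linarith

omit hp in
theorem sum_two_pow_succ_le (n : ℕ) :
    ∑ i ∈ Finset.range n, (2 : ℝ) ^ (i + 1) ≤ 2 * 2 ^ n := by
  induction n with
  | zero => simp
  | succ n ih => rw [Finset.sum_range_succ, pow_succ 2 n]; linarith

theorem calls_le {ε : ℝ} (hε : 0 < ε) (hεΔ : ε < p.Δ₀) :
    ((∑ i ∈ Finset.range ⌈Real.logb 2 (p.Δ₀ / ε)⌉₊, p.K * (2 * p.T (i + 1)) : ℕ) : ℝ)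
      ≤ 3000000000 * (p.L / √(p.μd * p.μp) * (1 + Real.log (p.μd / p.μp))
            * (1 + Real.logb 2 (p.Δ₀ / ε))
          + p.σ ^ 2 / (p.μp * ε) * (Real.posLog (p.μd ^ 2 * p.DY ^ 2 / p.σ ^ 2) + 2
            + Real.posLog (p.σ ^ 2 / (p.Δ₀ * p.μp)))
          + p.σ ^ 2 / (p.μp * ε) * Real.logb 2 (p.Δ₀ / ε)) := by
  have hμ := hp.μd_pos
  have hμp := hp.μp_pos
  have hσ := hp.σ_pos
  have hΔ := hp.Δ₀_pos
  have hL := hp.L_pos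
  have hK := hp.K_pos
  set ℓ := Real.logb 2 (p.Δ₀ / ε) with hℓ
  set n := ⌈ℓ⌉₊ with hn
  set b₁ := Real.posLog (p.μd ^ 2 * p.DY ^ 2 / p.σ ^ 2) with hb₁
  set b₂ := Real.posLog (p.σ ^ 2 / (p.Δ₀ * p.μp)) with hb₂
  set lr := Real.log (p.μd / p.μp) with hlr
  have hb₁0 : 0 ≤ b₁ := Real.posLog_nonneg
  have hb₂0 : 0 ≤ b₂ := Real.posLog_nonneg
  have hlr0 : 0 ≤ lr := Real.log_nonneg ((one_le_div hp.μp_pos).2 hp.μp_le)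
  have hℓ0 : 0 ≤ ℓ := (Real.logb_pos (by norm_num) ((one_lt_div hε).2 hεΔ)).le
  have hnℓ : (n : ℝ) ≤ ℓ + 1 := (Nat.ceil_lt_add_one hℓ0).le
  -- Rounding the number of epochs up costs at most a factor 2 in the last and largest term of the
  -- geometric sum.
  have hpow : (2 : ℝ) ^ n ≤ 2 * (p.Δ₀ / ε) := by
    have h1 : (2 : ℝ) ^ (n : ℝ) ≤ 2 ^ (ℓ + 1) :=
      Real.rpow_le_rpow_of_exponent_le (by norm_num) hnℓ
    rw [Real.rpow_natCast, Real.rpow_add (by norm_num), Real.rpow_one,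
      Real.rpow_logb (by norm_num) (by norm_num) (by positivity)] at h1
    linarith
  -- A bound on the logarithmic factor uniform over epochs: the epoch index is at most ℓ + 1, whence
  -- 17 instead of 16.
  set H := 192 * (b₁ + 2) + 384 * (17 + b₂ + ℓ) with hH
  set m := 128 * (p.K : ℝ) * p.σ ^ 2 / (p.Δ₀ * p.μd) with hm
  have hterm : ∀ i ∈ Finset.range n, (p.K : ℝ) * (2 * p.T (i + 1))
      ≤ 2 * p.K * (4896 * (p.L / p.μd) * (1 + lr)) + 2 * p.K * m * H * 2 ^ (i + 1) := by
    intro i hi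
    have h1 := hp.T_le (i + 1)
    have hi' : ((i + 1 : ℕ) : ℝ) ≤ ℓ + 1 :=
      le_trans (by exact_mod_cast Finset.mem_range.1 hi) hnℓ
    have hM := hp.noiseRatio_pos (i + 1)
    have hMm : p.noiseRatio (i + 1) = m * 2 ^ (i + 1) := by
      rw [hm, noiseRatio]; ring
    have h2 : 192 * (b₁ + 2) + 384 * (16 + b₂ + ((i + 1 : ℕ) : ℝ)) ≤ H := by
      rw [hH]; linarith
    have h3 := mul_le_mul_of_nonneg_left h2 hM.le
    have h4 := mul_le_mul_of_nonneg_left (h1.trans (add_le_add_right h3 _))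
      (by positivity : 0 ≤ 2 * (p.K : ℝ))
    rw [hMm] at h4
    linarith
  push_cast
  refine (Finset.sum_le_sum hterm).trans ?_
  rw [Finset.sum_add_distrib, Finset.sum_const, Finset.card_range, nsmul_eq_mul, ← Finset.mul_sum]
  have hH0 : 0 ≤ H := by positivity
  have hm0 : 0 ≤ m := by positivity
  -- One factor K counts iterations and the other sits in the noise ratio; together they exchange μd
  -- for μp through K² ≤ 625 μd/μp.
  have hs : 2 * p.K * m * H * ∑ i ∈ Finset.range n, (2 : ℝ) ^ (i + 1)
      ≤ 640000 * (p.σ ^ 2 / (p.μp * ε)) * H := by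
    have h1 : ∑ i ∈ Finset.range n, (2 : ℝ) ^ (i + 1) ≤ 4 * (p.Δ₀ / ε) := by
      linarith [sum_two_pow_succ_le n]
    have h2 := mul_le_mul_of_nonneg_left h1 (by positivity : 0 ≤ 2 * p.K * m * H)
    have h3 : 2 * p.K * m * H * (4 * (p.Δ₀ / ε))
        = 1024 * (p.σ ^ 2 / (p.μd * ε)) * H * (p.K : ℝ) ^ 2 := by
      rw [hm]; field_simp; ring
    have h4 := mul_le_mul_of_nonneg_left hp.K_sq_le
      (by positivity : 0 ≤ 1024 * (p.σ ^ 2 / (p.μd * ε)) * H)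
    have h5 : 1024 * (p.σ ^ 2 / (p.μd * ε)) * H * (625 * (p.μd / p.μp))
        = 640000 * (p.σ ^ 2 / (p.μp * ε)) * H := by
      field_simp; ring
    linarith
  have hd : (n : ℝ) * (2 * p.K * (4896 * (p.L / p.μd) * (1 + lr)))
      ≤ 244800 * (p.L / √(p.μd * p.μp) * (1 + lr) * (1 + ℓ)) := by
    have h1 : √(p.μd / p.μp) * (p.L / p.μd) = p.L / √(p.μd * p.μp) := by
      rw [Real.sqrt_div hμ.le, Real.sqrt_mul hμ.le]
      have e1 : √p.μd * √p.μd = p.μd := Real.mul_self_sqrt hμ.le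
      have e2 : 0 < √p.μd := Real.sqrt_pos.2 hμ
      have e3 : 0 < √p.μp := Real.sqrt_pos.2 hμp
      field_simp
      rw [sq, e1]
    have h2 : (p.K : ℝ) * (p.L / p.μd) ≤ 25 * (p.L / √(p.μd * p.μp)) := by
      rw [← h1]
      have := mul_le_mul_of_nonneg_right hp.K_le (by positivity : 0 ≤ p.L / p.μd)
      linarith
    calc (n : ℝ) * (2 * p.K * (4896 * (p.L / p.μd) * (1 + lr)))
        = 9792 * ((p.K : ℝ) * (p.L / p.μd)) * (1 + lr) * n := by ring
      _ ≤ 9792 * (25 * (p.L / √(p.μd * p.μp))) * (1 + lr) * (1 + ℓ) := by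
        gcongr
        linarith
      _ = _ := by ring
  have hfin : H ≤ 3840 * (b₁ + 2 + b₂) + 384 * ℓ := by rw [hH]; linarith
  have hσε : 0 ≤ p.σ ^ 2 / (p.μp * ε) := by positivity
  have h6 := mul_le_mul_of_nonneg_left hfin (by positivity : 0 ≤ 640000 * (p.σ ^ 2 / (p.μp * ε)))
  have h7 : 0 ≤ p.L / √(p.μd * p.μp) * (1 + lr) * (1 + ℓ) := by positivity
  have h8 : 0 ≤ p.σ ^ 2 / (p.μp * ε) * (b₁ + 2 + b₂) := by positivity
  have h9 : 0 ≤ p.σ ^ 2 / (p.μp * ε) * ℓ := by positivity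
  linarith

end Params.Valid

end CatalystMinimax

/-! ### The theorem -/

theorem mainTheorem9 :
    ∃ C : ℝ, 0 < C ∧
      ∀ (m n : ℕ) (Ξ Ω : Type*) [MeasurableSpace Ξ] [MeasurableSpace Ω]
        (ν : Measure Ξ) [IsProbabilityMeasure ν] (P : Measure Ω) [IsProbabilityMeasure P]
        (F : EuclideanSpace ℝ (Fin m) → EuclideanSpace ℝ (Fin n) → ℝ)
        (gx : EuclideanSpace ℝ (Fin m) → EuclideanSpace ℝ (Fin n) → EuclideanSpace ℝ (Fin m))
        (gy : EuclideanSpace ℝ (Fin m) → EuclideanSpace ℝ (Fin n) → EuclideanSpace ℝ (Fin n))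
        (X Q : Set (EuclideanSpace ℝ (Fin m))) (Y : Set (EuclideanSpace ℝ (Fin n)))
        (L μp μd σ DY ε : ℝ)
        (g : EuclideanSpace ℝ (Fin m) → EuclideanSpace ℝ (Fin n) → Ξ →
          EuclideanSpace ℝ (Fin m) × EuclideanSpace ℝ (Fin n))
        (ξ : ℕ → Ω → Ξ)
        (x₀ : EuclideanSpace ℝ (Fin m)) (y₀ : EuclideanSpace ℝ (Fin n)),
        0 < μp → μp ≤ μd → μd ≤ L → 0 < σ →
        CatalystMinimax.IsMinimaxProblem F gx gy X Q Y L μp μd →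
        0 < DY → (∀ y ∈ Y, ∀ y' ∈ Y, ‖y - y'‖ ≤ DY) →
        CatalystMinimax.IsSFO g gx gy Q Y ν σ →
        (∀ i, Measurable (ξ i)) → iIndepFun ξ P → (∀ i, P.map (ξ i) = ν) →
        x₀ ∈ X → y₀ ∈ Y →
        ∀ Δ₀ : ℝ, Δ₀ = CatalystMinimax.potential F X Y (μd / 12) x₀ y₀ →
        0 < ε → ε < Δ₀ →
        let p : CatalystMinimax.Params := ⟨L, μp, μd, σ, DY, Δ₀⟩
        let numEpochs : ℕ := ⌈Real.logb 2 (Δ₀ / ε)⌉₊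
        let out : Ω → CatalystMinimax.State (EuclideanSpace ℝ (Fin m)) (EuclideanSpace ℝ (Fin n)) :=
          fun ω => CatalystMinimax.rCatalyst p X Q Y g (fun i => ξ i ω) x₀ y₀ numEpochs
        Integrable
            (fun ω => CatalystMinimax.potential F X Y (μd / 6) (out ω).xtil (out ω).y) P ∧
          ∫ ω, CatalystMinimax.potential F X Y (μd / 6) (out ω).xtil (out ω).y ∂P ≤ ε ∧
          ∀ ω, ((out ω).calls : ℝ) ≤
            C * (L / √(μd * μp) * (1 + Real.log (μd / μp)) * (1 + Real.logb 2 (Δ₀ / ε))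
              + σ ^ 2 / (μp * ε) *
                (Real.posLog (μd ^ 2 * DY ^ 2 / σ ^ 2) + 2 + Real.posLog (σ ^ 2 / (Δ₀ * μp)))
              + σ ^ 2 / (μp * ε) * Real.logb 2 (Δ₀ / ε)) := by
  refine ⟨3000000000, by norm_num, ?_⟩
  intro m n Ξ Ω _ _ ν _ P _ F gx gy X Q Y L μp μd σ DY ε g ξ x₀ y₀ hμp hμpd hμdL hσ hP hDY hdiam hO
    hξ hind hmap hx₀ hy₀ Δ₀ hΔ₀ hε hεΔ p numEpochs out
  have hp : p.Valid := ⟨hμp, hμpd, hμdL, hσ, hDY, hε.trans hεΔ⟩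
  -- The gradient is unspecified off Q × Y and need not be measurable there. The mean of the oracle
  -- agrees with it on Q × Y and is measurable everywhere, so it is used in its place.
  have hmx : ∀ x ∈ Q, ∀ y ∈ Y, (∫ s, (g x y s).1 ∂ν) = gx x y := hO.unbiased_x
  have hmy : ∀ x ∈ Q, ∀ y ∈ Y, (∫ s, (g x y s).2 ∂ν) = gy x y := hO.unbiased_y
  have hmain := CatalystMinimax.integral_rCatalyst_le (p := p) (hP.congr hmx hmy)
    (fun e _ => hp.calibrated e) (hO.congr hmx hmy) hO.measurable_mean_x hO.measurable_mean_y
    hξ hind hmap hdiam hx₀ hy₀ hΔ₀ numEpochs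
  obtain ⟨hreach, -, hle⟩ := hmain
  have hratio : 1 < Δ₀ / ε := (one_lt_div hε).2 hεΔ
  have hnum : 1 ≤ numEpochs := Nat.one_le_ceil_iff.2 (Real.logb_pos (by norm_num) hratio)
  refine ⟨hreach.integrable_potential hP ⟨x₀, hx₀⟩ ⟨y₀, hy₀⟩ hp.L_pos.le hμp.le hp.μd_pos hξ _,
    (hle hnum).trans ?_, fun ω => ?_⟩
  · have h1 : Δ₀ / ε ≤ 2 ^ numEpochs := by
      rw [← Real.rpow_natCast, ← Real.logb_le_iff_le_rpow (by norm_num) (by linarith)]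
      exact Nat.le_ceil _
    change Δ₀ / 2 ^ numEpochs ≤ ε
    rw [div_le_iff₀ hε] at h1
    rw [div_le_iff₀ (by positivity)]
    linarith
  · rw [hreach.calls_eq ω]
    exact hp.calls_le hε hεΔ
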